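/- Let $I$ denote the best constant (that is, the largest real number $I$) in the inequality $$\int_{\mathbb R} (u'')^2\,dx-\int_{\mathbb R} u''\,u^2\,dx\;\ge\; I\int_{\mathbb R} u^4\,dx\qquad\text{for all real-valued } u\in L^4(\mathbb R)\text{ with } u''\in L^2(\mathbb R),$$ where $u''$ is the derivative in the sense of distributions; equivalently, $I$ is the infimum over such $u\not\equiv 0$ of $Q_{\mathbb R}(u)=\big(\int_{\mathbb R} (u'')^2\,dx-\int_{\mathbb R} u''u^2\,dx\big)\big/\int_{\mathbb R} u^4\,dx$. For $T>0$ let $$Q_{T}(u)=\frac{\int_0^T (u'')^2\,dx-\int_0^T u''\,u^2\,dx}{\int_0^T u^4\,dx}.$$ Then the best constant $I$ exists and the following hold. 1. $I$ is not achieved on $\mathbb R$: there is no $u\not\equiv0$ with $u\in L^4(\mathbb R)$, $u''\in L^2(\mathbb R)$ and $Q_{\mathbb R}(u)=I$. 2. For every $T>0$ (so independently of the period), $$I=\min\{Q_T(u)\;:\; u\in C^\infty(\mathbb R),\ u(\cdot+T)=u,\ u\not\equiv 0\},$$ the minimum being achieved. The same holds with $C^\infty(\mathbb R)$ replaced by the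 class of $u\in L^4_{\rm loc}(\mathbb R)$ with $u''\in L^2_{\rm loc}(\mathbb R)$. 3. $-\tfrac14<I<-\tfrac9{64}$. 4. For every $T>0$ there is a minimizer of $Q_T$ with minimal period $T$, and it is unique up to translations: there is a $C^\infty$ function $u_0$ with minimal period $T$ and $Q_T(u_0)=I$, which takes both positive and negative values, and every $u\in L^4_{\rm loc}(\mathbb R)$ with $u''\in L^2_{\rm loc}(\mathbb R)$, minimal period $T$ and $Q_T(u)=I$ is (almost everywhere) equal to a translate $u_0(\cdot+a)$, $a\in\mathbb R$. -/

import Mathlib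

open MeasureTheory
open scoped ContDiff

noncomputable section

/-- `w` is the second derivative of `u` in the sense of distributions on `ℝ`
(used for locally integrable `u` and `w`). -/
def HasWeakSecondDeriv (u w : ℝ → ℝ) : Prop :=
  ∀ φ : ℝ → ℝ, ContDiff ℝ ∞ φ → HasCompactSupport φ →
    ∫ x, u x * iteratedDeriv 2 φ x = ∫ x, w x * φ x

/-- `u ∈ L⁴(ℝ)` with `u'' = w ∈ L²(ℝ)`. -/
structure IsAdmissible (u w : ℝ → ℝ) : Prop where
  memLp_fun : MemLp u 4 volume
  memLp_deriv : MemLp w 2 volume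
  weakDeriv : HasWeakSecondDeriv u w

/-- `u ∈ L⁴_loc(ℝ)` with `u'' = w ∈ L²_loc(ℝ)` and `u(· + T) = u` (almost everywhere). -/
structure IsPeriodicAdmissible (T : ℝ) (u w : ℝ → ℝ) : Prop where
  memLp_fun : ∀ K : Set ℝ, IsCompact K → MemLp u 4 (volume.restrict K)
  memLp_deriv : ∀ K : Set ℝ, IsCompact K → MemLp w 2 (volume.restrict K)
  weakDeriv : HasWeakSecondDeriv u w
  periodic : (fun x => u (x + T)) =ᵐ[volume] u

/-- The set of nonzero functions in `C^∞(ℝ/Tℤ)`. -/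
def smoothPeriodic (T : ℝ) : Set (ℝ → ℝ) :=
  {u | ContDiff ℝ ∞ u ∧ Function.Periodic u T ∧ u ≠ 0}

/-- The numerator `∫_J u''² - ∫_J u'' u²`, where `w` stands for `u''`. -/
def energy (J : Set ℝ) (u w : ℝ → ℝ) : ℝ :=
  (∫ x in J, w x ^ 2) - ∫ x in J, w x * u x ^ 2

/-- The quotient `Q_J(u)`, where `w` stands for `u''`. -/
def quotient (J : Set ℝ) (u w : ℝ → ℝ) : ℝ :=
  energy J u w / ∫ x in J, u x ^ 4

/-- One period. -/
abbrev period (T : ℝ) : Set ℝ := Set.Ioc 0 T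

/-- `T > 0` is the smallest positive period of `u`, functions being identified when they
coincide almost everywhere. -/
def HasMinimalPeriod (u : ℝ → ℝ) (T : ℝ) : Prop :=
  IsLeast {S : ℝ | 0 < S ∧ (fun x => u (x + S)) =ᵐ[volume] u} T

end

namespace BestConstant

open Set Filter Topology

/-! Put J = -I and call ∫ (u''² - u''u² + J u⁴) the action. The problem is reduced to arcs, that is,
intervals with u' = 0 at both ends; J is taken to be the least constant for which every arc has
nonnegative action (`exists_best_arc`). Arcs control everything else. A loop, along which u and u'
return to their initial values, has a critical point by Rolle and can be rotated into an arc. A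
function of finite energy on the line can be capped far out at vanishing cost. Conversely, an arc
and its mirror image form one period of a periodic function. The period is immaterial, because u ↦
l² u(l x) multiplies the action by l⁷.

The number 9/64 is a threshold for compactness. Where u ≥ 0, -∫ u''u² = 2 ∫ u u'² ≥ 0 on arcs. Where
u ≤ 0, adding the exact derivatives of u'³/(σ - u) and u'u² completes a square and shows that 9/64
suffices (`action_add_nonneg_of_nonpos`). An explicit sign-changing quartic violates the inequality
with 9/64, so J > 9/64. Hence a monotone arc that is negative for a constant slightly below J must
cross zero with slope bounded below in terms of J - 9/64. This bounds its length after normalisation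
(`bounds_of_action_neg`), and the direct method yields an arc of zero action (`exists_minimal_arc`).

Uniqueness and non-attainment rest on gluing. If two minimizers agree in u and u' at one point,
following the first up to that point and the second afterwards is still of class H² and still
minimal. It therefore solves the fourth order Euler-Lagrange equation through the junction, and ODE
uniqueness identifies the two minimizers: two initial data do the work of four. At a maximum u' = 0
and u > 0, so scaling and translation match any two periodic minimizers. A minimizer on the line,
cut at a critical point, has zero action on each half; one half could be glued to a scaled periodic
minimizer, which would make a decaying function periodic. That the infimum on the line is still -J
is seen by taking many periods of a periodic minimizer between two fixed tails.

Finally J < 1/4: for J = 1/4 the integrand is (u'' - u²/2)², which cannot have zero integral over a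
period of a nonzero periodic u, since u'' has mean zero there. -/

/-- `u` is of class `H²` on bounded intervals, with `u' = p` and `u'' = w`. -/
structure IsH2 (u p w : ℝ → ℝ) : Prop where
  hasDerivAt : ∀ x, HasDerivAt u (p x) x
  integrable : ∀ a b, IntervalIntegrable w volume a b
  sq_integrable : ∀ a b, IntervalIntegrable (fun x => w x ^ 2) volume a b
  integral_eq : ∀ a b, ∫ x in a..b, w x = p b - p a

/-- The functional `∫ u''² - u'' u² + J u⁴` on `[a, b]`. -/
noncomputable def action (J : ℝ) (u w : ℝ → ℝ) (a b : ℝ) : ℝ :=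
  ∫ x in a..b, (w x ^ 2 - w x * u x ^ 2 + J * u x ^ 4)

/-! ### Calculus in H²: integration by parts, scaling, translation -/

namespace IsH2

variable {u p w u₁ p₁ w₁ u₂ p₂ w₂ : ℝ → ℝ} {a b c J : ℝ}

lemma continuous_fst (h : IsH2 u p w) : Continuous u :=
  continuous_iff_continuousAt.2 fun x => (h.hasDerivAt x).continuousAt

lemma eq_add_integral (h : IsH2 u p w) (a x : ℝ) : p x = p a + ∫ t in a..x, w t := by
  rw [h.integral_eq]; ring

lemma continuous_snd (h : IsH2 u p w) : Continuous p := by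
  have : p = fun x => p 0 + ∫ t in (0:ℝ)..x, w t := funext fun x => h.eq_add_integral 0 x
  rw [this]
  exact continuous_const.add (intervalIntegral.continuous_primitive h.integrable 0)

lemma integral_snd (h : IsH2 u p w) (a b : ℝ) : ∫ x in a..b, p x = u b - u a :=
  intervalIntegral.integral_eq_sub_of_hasDerivAt (fun x _ => h.hasDerivAt x)
    (h.continuous_snd.intervalIntegrable _ _)

lemma mul_integrable (h : IsH2 u p w) {f : ℝ → ℝ} (hf : Continuous f) (a b : ℝ) :
    IntervalIntegrable (fun x => w x * f x) volume a b :=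
  (h.integrable a b).mul_continuousOn hf.continuousOn

lemma lag_integrable (h : IsH2 u p w) (J a b : ℝ) :
    IntervalIntegrable (fun x => w x ^ 2 - w x * u x ^ 2 + J * u x ^ 4) volume a b := by
  have hu := h.continuous_fst
  exact ((h.sq_integrable a b).sub (h.mul_integrable (hu.pow 2) a b)).add
    ((continuous_const.mul (hu.pow 4)).intervalIntegrable _ _)

lemma action_eq (h : IsH2 u p w) (J a b : ℝ) :
    action J u w a b = (∫ x in a..b, w x ^ 2) - (∫ x in a..b, w x * u x ^ 2)
      + J * ∫ x in a..b, u x ^ 4 := by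
  have hu := h.continuous_fst
  have h2 : IntervalIntegrable (fun x => w x * u x ^ 2) volume a b :=
    h.mul_integrable (hu.pow 2) a b
  have h4 : IntervalIntegrable (fun x => J * u x ^ 4) volume a b :=
    (continuous_const.mul (hu.pow 4)).intervalIntegrable _ _
  unfold action
  rw [intervalIntegral.integral_add ((h.sq_integrable a b).sub h2) h4,
    intervalIntegral.integral_sub (h.sq_integrable a b) h2,
    intervalIntegral.integral_const_mul]

lemma action_add (h : IsH2 u p w) (J a b c : ℝ) :
    action J u w a b + action J u w b c = action J u w a c :=
  intervalIntegral.integral_add_adjacent_intervals (h.lag_integrable J a b)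
    (h.lag_integrable J b c)

lemma action_change (h : IsH2 u p w) (J J' a b : ℝ) :
    action J u w a b = action J' u w a b + (J - J') * ∫ x in a..b, u x ^ 4 := by
  rw [h.action_eq J, h.action_eq J']; ring

lemma ae_hasDerivAt (h : IsH2 u p w) (a b : ℝ) :
    ∀ᵐ x : ℝ, x ∈ uIcc a b → HasDerivAt p (w x) x := by
  filter_upwards [(h.integrable a b).ae_hasDerivAt_integral] with x hx hxm
  have := (hx hxm a left_mem_uIcc).const_add (p a)
  have e : p = fun x => p a + ∫ t in a..x, w t := funext fun x => h.eq_add_integral a x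
  rw [e]
  exact this

lemma absolutelyContinuous_snd (h : IsH2 u p w) (a b : ℝ) :
    AbsolutelyContinuousOnInterval p a b := by
  have e : p = fun x => p a + ∫ t in a..x, w t := funext fun x => h.eq_add_integral a x
  rw [e]
  have h1 : AbsolutelyContinuousOnInterval (fun _ : ℝ => p a) a b :=
    (LipschitzWith.const (p a)).lipschitzOnWith.absolutelyContinuousOnInterval
  exact h1.add ((h.integrable a b).absolutelyContinuousOnInterval_intervalIntegral left_mem_uIcc)

/-- Integration by parts for `p ^ (n + 1) * φ`. -/
lemma integral_pow_mul (h : IsH2 u p w) (n : ℕ) {φ φ' : ℝ → ℝ}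
    (hφ : ∀ x ∈ uIcc a b, HasDerivAt φ (φ' x) x) (hφ' : ContinuousOn φ' (uIcc a b)) :
    ∫ x in a..b, ((n + 1 : ℝ) * p x ^ n * w x * φ x + p x ^ (n + 1) * φ' x) =
      p b ^ (n + 1) * φ b - p a ^ (n + 1) * φ a := by
  have hφi : IntervalIntegrable φ' volume a b := hφ'.intervalIntegrable
  -- An absolutely continuous copy of `φ`, which is controlled only on the interval itself.
  set ψ : ℝ → ℝ := fun x => φ a + ∫ t in a..x, φ' t with hψ
  have hψac : AbsolutelyContinuousOnInterval ψ a b := by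
    have h1 : AbsolutelyContinuousOnInterval (fun _ : ℝ => φ a) a b :=
      (LipschitzWith.const (φ a)).lipschitzOnWith.absolutelyContinuousOnInterval
    exact h1.add (hφi.absolutelyContinuousOnInterval_intervalIntegral left_mem_uIcc)
  have hψeq : ∀ x ∈ uIcc a b, ψ x = φ x := by
    intro x hx
    have hs : uIcc a x ⊆ uIcc a b := uIcc_subset_uIcc_left hx
    have : ∫ t in a..x, φ' t = φ x - φ a :=
      intervalIntegral.integral_eq_sub_of_hasDerivAt (fun y hy => hφ y (hs hy))
        ((hφ'.mono hs).intervalIntegrable)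
    simp only [hψ, this]; ring
  have hψd : ∀ᵐ x : ℝ, x ∈ uIcc a b → HasDerivAt ψ (φ' x) x := by
    filter_upwards [hφi.ae_hasDerivAt_integral] with x hx hxm
    exact (hx hxm a left_mem_uIcc).const_add (φ a)
  have hpac : ∀ n : ℕ, AbsolutelyContinuousOnInterval (fun x => p x ^ (n + 1)) a b := by
    intro n
    induction n with
    | zero => simpa using h.absolutelyContinuous_snd a b
    | succ k ih =>
      have := ih.fun_mul (h.absolutelyContinuous_snd a b)
      simpa only [← pow_succ] using this
  rw [← hψeq b right_mem_uIcc, ← hψeq a left_mem_uIcc,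
    ← ((hpac n).fun_mul hψac).integral_deriv_eq_sub]
  refine intervalIntegral.integral_congr_ae ?_
  filter_upwards [hψd, h.ae_hasDerivAt a b] with x h1 h2 hx
  have hx' := uIoc_subset_uIcc hx
  have h3 := ((h2 hx').pow (n + 1)).mul (h1 hx')
  have h4 : deriv (fun x => p x ^ (n + 1) * ψ x) x = _ := h3.deriv
  rw [h4, hψeq x hx']
  simp

/-- Constructor from the second derivative and initial data. -/
lemma of_primitive {w : ℝ → ℝ} (h1 : ∀ a b, IntervalIntegrable w volume a b)
    (h2 : ∀ a b, IntervalIntegrable (fun x => w x ^ 2) volume a b) (c α β : ℝ) :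
    IsH2 (fun x => α + ∫ t in c..x, (β + ∫ s in c..t, w s)) (fun x => β + ∫ s in c..x, w s) w where
  hasDerivAt x := by
    have hc : Continuous fun x => β + ∫ s in c..x, w s :=
      continuous_const.add (intervalIntegral.continuous_primitive h1 c)
    exact (hc.integral_hasStrictDerivAt c x).hasDerivAt.const_add α
  integrable := h1
  sq_integrable := h2
  integral_eq a b := by
    rw [← intervalIntegral.integral_add_adjacent_intervals (h1 c a) (h1 a b)]; ring

lemma congr_snd (h : IsH2 u p w) {w' : ℝ → ℝ} (hw : w =ᵐ[volume] w') : IsH2 u p w' where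
  hasDerivAt := h.hasDerivAt
  integrable a b := (h.integrable a b).congr_ae (ae_restrict_of_ae hw)
  sq_integrable a b := (h.sq_integrable a b).congr_ae (ae_restrict_of_ae (by
    filter_upwards [hw] with x hx; rw [hx]))
  integral_eq a b := by
    rw [← h.integral_eq]
    exact intervalIntegral.integral_congr_ae (by filter_upwards [hw] with x hx _; rw [hx])

/-- Smooth functions. -/
lemma of_hasDerivAt (h1 : ∀ x, HasDerivAt u (p x) x) (h2 : ∀ x, HasDerivAt p (w x) x)
    (hw : Continuous w) : IsH2 u p w where
  hasDerivAt := h1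
  integrable := hw.intervalIntegrable
  sq_integrable := (hw.pow 2).intervalIntegrable
  integral_eq _ _ := intervalIntegral.integral_eq_sub_of_hasDerivAt (fun x _ => h2 x)
    (hw.intervalIntegrable _ _)

lemma add (h₁ : IsH2 u₁ p₁ w₁) (h₂ : IsH2 u₂ p₂ w₂) (hc : Continuous w₂) :
    IsH2 (fun x => u₁ x + u₂ x) (fun x => p₁ x + p₂ x) (fun x => w₁ x + w₂ x) where
  hasDerivAt x := (h₁.hasDerivAt x).add (h₂.hasDerivAt x)
  integrable a b := (h₁.integrable a b).add (h₂.integrable a b)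
  sq_integrable a b := by
    have := ((h₁.sq_integrable a b).add (h₂.sq_integrable a b)).add
      ((h₁.mul_integrable hc a b).const_mul 2)
    refine this.congr ?_
    intro x _
    simp only; ring
  integral_eq a b := by
    rw [intervalIntegral.integral_add (h₁.integrable a b) (h₂.integrable a b),
      h₁.integral_eq, h₂.integral_eq]; ring

lemma neg (h : IsH2 u p w) : IsH2 (fun x => - u x) (fun x => - p x) (fun x => - w x) where
  hasDerivAt x := (h.hasDerivAt x).neg
  integrable a b := (h.integrable a b).neg
  sq_integrable a b := by simpa using h.sq_integrable a b
  integral_eq a b := by rw [intervalIntegral.integral_neg, h.integral_eq]; ring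

/-- The scaling that leaves the quotient invariant, combined with a translation. -/
lemma scale (h : IsH2 u p w) {l : ℝ} (hl : l ≠ 0) (τ : ℝ) :
    IsH2 (fun x => l ^ 2 * u (l * x + τ)) (fun x => l ^ 3 * p (l * x + τ))
      (fun x => l ^ 4 * w (l * x + τ)) where
  hasDerivAt x := by
    have h1 : HasDerivAt (fun x => l * x + τ) l x := by
      simpa using ((hasDerivAt_id x).const_mul l).add_const τ
    have := ((h.hasDerivAt (l * x + τ)).comp x h1).const_mul (l ^ 2)
    refine this.congr_deriv ?_
    ring
  integrable a b := by
    have := ((h.integrable (l * a + τ) (l * b + τ)).comp_add_right τ).comp_mul_left (c := l)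
    simp only [add_sub_cancel_right, mul_div_cancel_left₀ _ hl] at this
    exact this.const_mul _
  sq_integrable a b := by
    have := ((h.sq_integrable (l * a + τ) (l * b + τ)).comp_add_right τ).comp_mul_left (c := l)
    simp only [add_sub_cancel_right, mul_div_cancel_left₀ _ hl] at this
    simpa only [mul_pow] using this.const_mul ((l ^ 4) ^ 2)
  integral_eq a b := by
    rw [intervalIntegral.integral_const_mul, intervalIntegral.integral_comp_mul_add _ hl,
      h.integral_eq, smul_eq_mul]
    field_simp

lemma shift (h : IsH2 u p w) (τ : ℝ) :
    IsH2 (fun x => u (x + τ)) (fun x => p (x + τ)) (fun x => w (x + τ)) := by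
  simpa using h.scale one_ne_zero τ

end IsH2

/-- Each of the three terms scales like l⁸, and the change of variables removes one power. For l > 0
the sign of the action is thus invariant while lengths are free. -/
lemma action_scale (J : ℝ) (u w : ℝ → ℝ) {l : ℝ} (hl : l ≠ 0) (τ a b : ℝ) :
    action J (fun x => l ^ 2 * u (l * x + τ)) (fun x => l ^ 4 * w (l * x + τ)) a b =
      l ^ 7 * action J u w (l * a + τ) (l * b + τ) := by
  unfold action
  have := intervalIntegral.integral_comp_mul_add (a := a) (b := b)
    (fun y => l ^ 8 * (w y ^ 2 - w y * u y ^ 2 + J * u y ^ 4)) hl τ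
  simp only [intervalIntegral.integral_const_mul, smul_eq_mul] at this
  rw [show l ^ 7 = l⁻¹ * l ^ 8 by field_simp, mul_assoc, ← this,
    ← intervalIntegral.integral_const_mul]
  congr 1; ext x; ring

lemma action_shift (J : ℝ) (u w : ℝ → ℝ) (τ a b : ℝ) :
    action J (fun x => u (x + τ)) (fun x => w (x + τ)) a b = action J u w (a + τ) (b + τ) := by
  simpa using action_scale J u w one_ne_zero τ a b

lemma action_congr {J : ℝ} {u u' w w' : ℝ → ℝ} {a b : ℝ} (hab : a ≤ b)
    (hu : ∀ x ∈ Ioo a b, u x = u' x) (hw : ∀ x ∈ Ioo a b, w x = w' x) :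
    action J u w a b = action J u' w' a b := by
  unfold action
  refine intervalIntegral.integral_congr_ae ?_
  have : ∀ᵐ x : ℝ, x ≠ b := by simp [ae_iff, measure_singleton]
  filter_upwards [this] with x hxb hx
  rw [uIoc_of_le hab] at hx
  have : x ∈ Ioo a b := ⟨hx.1, lt_of_le_of_ne hx.2 hxb⟩
  rw [hu x this, hw x this]

/-! ### Gluing and periodic extension -/

/-- Gluing two functions at `c`. -/
noncomputable def join (c : ℝ) (f g : ℝ → ℝ) : ℝ → ℝ := fun x => if x ≤ c then f x else g x

lemma join_of_le {c x : ℝ} {f g : ℝ → ℝ} (h : x ≤ c) : join c f g x = f x := if_pos h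
lemma join_of_lt {c x : ℝ} {f g : ℝ → ℝ} (h : c < x) : join c f g x = g x := if_neg h.not_ge
lemma join_of_ge {c x : ℝ} {f g : ℝ → ℝ} (hc : f c = g c) (h : c ≤ x) : join c f g x = g x := by
  rcases h.eq_or_lt with rfl | h
  · rw [join_of_le le_rfl, hc]
  · exact join_of_lt h

lemma join_integrable {f g : ℝ → ℝ} (hf : ∀ a b, IntervalIntegrable f volume a b)
    (hg : ∀ a b, IntervalIntegrable g volume a b) (c a b : ℝ) :
    IntervalIntegrable (join c f g) volume a b := by
  have key : ∀ x, IntervalIntegrable (join c f g) volume c x := by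
    intro x
    rcases le_total x c with hx | hx
    · refine (hf c x).congr ?_
      intro y hy
      rw [uIoc_of_ge hx] at hy
      exact (join_of_le hy.2).symm
    · refine (hg c x).congr ?_
      intro y hy
      rw [uIoc_of_le hx] at hy
      exact (join_of_lt hy.1).symm
  exact (key a).symm.trans (key b)

lemma IsH2.join {u₁ p₁ w₁ u₂ p₂ w₂ : ℝ → ℝ} (h₁ : IsH2 u₁ p₁ w₁) (h₂ : IsH2 u₂ p₂ w₂) {c : ℝ}
    (hu : u₁ c = u₂ c) (hp : p₁ c = p₂ c) :
    IsH2 (join c u₁ u₂) (join c p₁ p₂) (join c w₁ w₂) where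
  hasDerivAt x := by
    have hl : ∀ x, x ≤ c → HasDerivWithinAt (BestConstant.join c u₁ u₂) (p₁ x) (Iic c) x :=
      fun x hx => (h₁.hasDerivAt x).hasDerivWithinAt.congr (fun y hy => join_of_le hy)
        (join_of_le hx)
    have hr : ∀ x, c ≤ x → HasDerivWithinAt (BestConstant.join c u₁ u₂) (p₂ x) (Ici c) x :=
      fun x hx => (h₂.hasDerivAt x).hasDerivWithinAt.congr (fun y hy => join_of_ge hu hy)
        (join_of_ge hu hx)
    rcases lt_trichotomy x c with hx | hx | hx
    · rw [join_of_le hx.le]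
      exact (hl x hx.le).hasDerivAt (Iic_mem_nhds hx)
    · subst hx
      rw [join_of_le le_rfl]
      have := (hl x le_rfl).union (hp ▸ hr x le_rfl)
      rwa [Iic_union_Ici, hasDerivWithinAt_univ] at this
    · rw [join_of_lt hx]
      exact (hr x hx.le).hasDerivAt (Ici_mem_nhds hx)
  integrable := join_integrable h₁.integrable h₂.integrable c
  sq_integrable a b := by
    refine (join_integrable h₁.sq_integrable h₂.sq_integrable c a b).congr ?_
    intro x _
    simp only [BestConstant.join]; split_ifs <;> rfl
  integral_eq a b := by
    have hI := join_integrable h₁.integrable h₂.integrable c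
    have key : ∀ x, ∫ t in c..x, BestConstant.join c w₁ w₂ t =
        BestConstant.join c p₁ p₂ x - p₁ c := by
      intro x
      rcases le_total x c with hx | hx
      · rw [join_of_le hx, ← h₁.integral_eq]
        refine intervalIntegral.integral_congr_ae (ae_of_all _ fun y hy => ?_)
        rw [uIoc_of_ge hx] at hy
        exact join_of_le hy.2
      · rw [join_of_ge hp hx, hp, ← h₂.integral_eq]
        refine intervalIntegral.integral_congr_ae (ae_of_all _ fun y hy => ?_)
        rw [uIoc_of_le hx] at hy
        exact join_of_lt hy.1
    rw [← intervalIntegral.integral_interval_sub_left (hI c b) (hI c a), key, key]; ring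

/-- Periodic extension of a loop. -/
lemma IsH2.exists_periodic {u p w : ℝ → ℝ} (h : IsH2 u p w) {a T : ℝ} (hT : 0 < T)
    (hu : u a = u (a + T)) (hp : p a = p (a + T)) :
    ∃ u' p' w', IsH2 u' p' w' ∧ Function.Periodic u' T ∧ Function.Periodic p' T ∧
      Function.Periodic w' T ∧ (∀ x ∈ Icc a (a + T), u' x = u x) ∧
      (∀ x ∈ Icc a (a + T), p' x = p x) ∧ (∀ x ∈ Ioc a (a + T), w' x = w x) := by
  have haT : a ≤ a + T := by linarith
  have hper : ∀ f : ℝ → ℝ, Function.Periodic (fun x => f (toIocMod hT a x)) T := fun f x => by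
    simp only [toIocMod_add_right]
  have heq : ∀ f : ℝ → ℝ, ∀ x ∈ Ioc a (a + T), f (toIocMod hT a x) = f x := fun f x hx => by
    rw [(toIocMod_eq_self hT).2 hx]
  have key : ∀ f : ℝ → ℝ, IntervalIntegrable f volume a (a + T) →
      ∀ c d, IntervalIntegrable (fun x => f (toIocMod hT a x)) volume c d := by
    intro f hf c d
    refine (hper f).intervalIntegrable (t := a) hT.ne' (hf.congr ?_) c d
    intro x hx
    rw [uIoc_of_le haT] at hx
    exact (heq f x hx).symm
  set w' : ℝ → ℝ := fun x => w (toIocMod hT a x) with hw'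
  have hH := IsH2.of_primitive (key w (h.integrable _ _))
    (key (fun x => w x ^ 2) (h.sq_integrable _ _)) a (u a) (p a)
  have hpeq : ∀ x ∈ Icc a (a + T), p a + ∫ s in a..x, w' s = p x := by
    intro x hx
    rw [h.eq_add_integral a x]
    congr 1
    refine intervalIntegral.integral_congr_ae (ae_of_all _ fun y hy => ?_)
    rw [uIoc_of_le hx.1] at hy
    exact heq w y ⟨hy.1, hy.2.trans hx.2⟩
  have hueq : ∀ x ∈ Icc a (a + T), u a + ∫ t in a..x, (p a + ∫ s in a..t, w' s) = u x := by
    intro x hx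
    have : ∫ t in a..x, (p a + ∫ s in a..t, w' s) = ∫ t in a..x, p t := by
      refine intervalIntegral.integral_congr_ae (ae_of_all _ fun y hy => ?_)
      rw [uIoc_of_le hx.1] at hy
      exact hpeq y ⟨hy.1.le, hy.2.trans hx.2⟩
    rw [this, h.integral_snd]; ring
  have hpp : Function.Periodic (fun x => p a + ∫ s in a..x, w' s) T := by
    intro x
    have h1 := hH.integral_eq x (x + T)
    have h2 := (hper w).intervalIntegral_add_eq x a
    have h3 := hpeq (a + T) ⟨haT, le_rfl⟩
    simp only [hw'] at h1 h2 h3 ⊢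
    linarith
  refine ⟨_, _, w', hH, ?_, hpp, hper w, hueq, hpeq, heq w⟩
  intro x
  have h1 := hH.integral_snd x (x + T)
  have h2 := hpp.intervalIntegral_add_eq x a
  have h3 := hueq (a + T) ⟨haT, le_rfl⟩
  simp only [hw'] at h1 h2 h3 ⊢
  linarith

/-! ### Lower bounds on arcs where `u` has a sign -/

namespace IsH2

variable {u p w : ℝ → ℝ} {a b J : ℝ}

lemma pow_mul_integrable (h : IsH2 u p w) (n : ℕ) {φ φ' : ℝ → ℝ}
    (hφ : ContinuousOn φ (uIcc a b)) (hφ' : ContinuousOn φ' (uIcc a b)) :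
    IntervalIntegrable (fun x => (n + 1 : ℝ) * p x ^ n * w x * φ x + p x ^ (n + 1) * φ' x)
      volume a b := by
  have hp := h.continuous_snd
  refine IntervalIntegrable.add ?_ ?_
  · refine IntervalIntegrable.mul_continuousOn ?_ hφ
    exact (h.integrable a b).continuousOn_mul (by fun_prop)
  · exact (ContinuousOn.mul (by fun_prop) hφ').intervalIntegrable

/-- The integrand is (p u²)'. This trades `w u²` for `-2 u p²`, which has a sign when `u` has one
and passes to weak limits. -/
lemma integral_mul_sq (h : IsH2 u p w) (a b : ℝ) :
    ∫ x in a..b, (w x * u x ^ 2 + 2 * u x * p x ^ 2) = p b * u b ^ 2 - p a * u a ^ 2 := by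
  have hu := h.continuous_fst
  have hp := h.continuous_snd
  have := h.integral_pow_mul (a := a) (b := b) 0 (φ := fun x => u x ^ 2)
    (φ' := fun x => 2 * u x * p x) (fun x _ => by
      refine ((h.hasDerivAt x).pow 2).congr_deriv ?_; simp)
    (by fun_prop)
  simp only [Nat.cast_zero, zero_add, pow_zero, one_mul, pow_one] at this
  rw [← this]
  congr 1; ext x; ring

/-- Lower bound for nonpositive functions, from the expansion of
`∫ (u'' + (2/3) u'² / (σ - u) - (3/8) u²)²`. -/
lemma action_add_nonneg_of_nonpos (h : IsH2 u p w) (hab : a ≤ b)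
    (hu : ∀ x ∈ Icc a b, u x ≤ 0) (ha : p a = 0) (hb : 0 ≤ p b) (hbd : p b = 0 ∨ u b = 0)
    {σ : ℝ} (hσ : 0 < σ) :
    0 ≤ action (9 / 64) u w a b + 4 / 9 * (p b ^ 3 / σ) + σ / 2 * ∫ x in a..b, p x ^ 2 := by
  have huc := h.continuous_fst
  have hpc := h.continuous_snd
  have hpos : ∀ x ∈ Icc a b, 0 < σ - u x := fun x hx => by linarith [hu x hx]
  -- The ideal weight 1/|u| is singular at zeros of `u`; σ > 0 regularises it. Since θ' = p θ², the
  -- terms added below are 4/9 (p³θ)' and 1/4 (p u²)', and what is left beside the square is σ²θp²/2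
  -- ≥ 0.
  set θ : ℝ → ℝ := fun x => (σ - u x)⁻¹ with hθ
  have hθc : ContinuousOn θ (uIcc a b) := by
    rw [uIcc_of_le hab]
    exact ContinuousOn.inv₀ (by fun_prop) fun x hx => (hpos x hx).ne'
  have hθ'c : ContinuousOn (fun x => p x * θ x ^ 2) (uIcc a b) := by fun_prop
  have hθd : ∀ x ∈ uIcc a b, HasDerivAt θ (p x * θ x ^ 2) x := by
    intro x hx
    rw [uIcc_of_le hab] at hx
    have := ((h.hasDerivAt x).const_sub σ).inv (hpos x hx).ne'
    refine this.congr_deriv ?_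
    simp only [hθ]; field_simp
  have i1 := h.lag_integrable (9 / 64) a b
  have i2 := h.pow_mul_integrable 2 hθc hθ'c
  have i3 : IntervalIntegrable (fun x => w x * u x ^ 2 + 2 * u x * p x ^ 2) volume a b :=
    (h.mul_integrable (huc.pow 2) a b).add (Continuous.intervalIntegrable (by fun_prop) _ _)
  have i4 : IntervalIntegrable (fun x => p x ^ 2) volume a b := (hpc.pow 2).intervalIntegrable _ _
  have e2 := h.integral_pow_mul 2 hθd hθ'c
  have e3 := h.integral_mul_sq a b
  have key : 0 ≤ ∫ x in a..b, ((w x ^ 2 - w x * u x ^ 2 + 9 / 64 * u x ^ 4) +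
      4 / 9 * (((2 : ℕ) + 1 : ℝ) * p x ^ 2 * w x * θ x + p x ^ (2 + 1) * (p x * θ x ^ 2)) +
      1 / 4 * (w x * u x ^ 2 + 2 * u x * p x ^ 2) + σ / 2 * p x ^ 2) := by
    refine intervalIntegral.integral_nonneg hab fun x hx => ?_
    have hne := (hpos x hx).ne'
    have h0 : 0 < θ x := inv_pos.2 (hpos x hx)
    have h1 : σ * θ x = 1 + u x * θ x := by
      have : (σ - u x) * θ x = 1 := mul_inv_cancel₀ hne
      linarith
    have h2 : u x ^ 2 * θ x + u x + σ = σ ^ 2 * θ x := by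
      linear_combination (-u x - σ) * h1
    have : (w x ^ 2 - w x * u x ^ 2 + 9 / 64 * u x ^ 4) +
      4 / 9 * (((2 : ℕ) + 1 : ℝ) * p x ^ 2 * w x * θ x + p x ^ (2 + 1) * (p x * θ x ^ 2)) +
      1 / 4 * (w x * u x ^ 2 + 2 * u x * p x ^ 2) + σ / 2 * p x ^ 2 =
      (w x + 2 / 3 * p x ^ 2 * θ x - 3 / 8 * u x ^ 2) ^ 2 + 1 / 2 * p x ^ 2 * (σ ^ 2 * θ x) := by
      rw [← h2]; push_cast; ring
    rw [this]; positivity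
  rw [intervalIntegral.integral_add ((i1.add (i2.const_mul _)).add (i3.const_mul _))
      (i4.const_mul _),
    intervalIntegral.integral_add (i1.add (i2.const_mul _)) (i3.const_mul _),
    intervalIntegral.integral_add i1 (i2.const_mul _),
    intervalIntegral.integral_const_mul, intervalIntegral.integral_const_mul,
    intervalIntegral.integral_const_mul, e2, e3, ha] at key
  have hz : p b * u b ^ 2 = 0 := by rcases hbd with h | h <;> simp [h]
  have hle : p b ^ (2 + 1) * θ b ≤ p b ^ 3 / σ := by
    rw [div_eq_mul_inv]
    have : θ b ≤ σ⁻¹ := inv_anti₀ hσ (by linarith [hu b ⟨hab, le_rfl⟩])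
    gcongr
  rw [hz] at key
  unfold action
  simp only [ne_eq, OfNat.ofNat_ne_zero, not_false_eq_true, zero_pow, zero_mul, sub_zero,
    Nat.reduceAdd] at key hle
  linarith

/-- With `p b = 0` the cubic boundary term disappears, and σ can be sent to 0; a negative action is
contradicted by one sufficiently small σ. -/
lemma action_nonneg_of_nonpos (h : IsH2 u p w) (hab : a ≤ b)
    (hu : ∀ x ∈ Icc a b, u x ≤ 0) (ha : p a = 0) (hb : p b = 0) :
    0 ≤ action (9 / 64) u w a b := by
  by_contra! hneg
  set K := ∫ x in a..b, p x ^ 2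
  have hK : 0 ≤ K := intervalIntegral.integral_nonneg hab fun x _ => sq_nonneg _
  set F := action (9 / 64) u w a b
  have hσ : 0 < -F / (K + 1) := div_pos (by linarith) (by linarith)
  have := h.action_add_nonneg_of_nonpos hab hu ha hb.ge (Or.inl hb) hσ
  rw [hb] at this
  have h1 : -F / (K + 1) * K ≤ -F := by
    rw [div_mul_eq_mul_div, div_le_iff₀ (by linarith)]; nlinarith
  norm_num at this
  have : -F / (K + 1) / 2 * K = (-F / (K + 1) * K) / 2 := by ring
  linarith

lemma action_ge_of_nonneg (h : IsH2 u p w) (hab : a ≤ b)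
    (hu : ∀ x ∈ Icc a b, 0 ≤ u x) (ha : p a * u a ^ 2 = 0) (hb : p b = 0) :
    J * ∫ x in a..b, u x ^ 4 ≤ action J u w a b := by
  have huc := h.continuous_fst
  have hpc := h.continuous_snd
  have e := h.integral_mul_sq a b
  have i3 : IntervalIntegrable (fun x => 2 * u x * p x ^ 2) volume a b :=
    Continuous.intervalIntegrable (by fun_prop) _ _
  have i2 : IntervalIntegrable (fun x => w x * u x ^ 2) volume a b :=
    h.mul_integrable (huc.pow 2) a b
  rw [intervalIntegral.integral_add i2 i3, ha, hb] at e
  rw [h.action_eq]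
  have h1 : 0 ≤ ∫ x in a..b, w x ^ 2 :=
    intervalIntegral.integral_nonneg hab fun x _ => sq_nonneg _
  have h2 : 0 ≤ ∫ x in a..b, 2 * u x * p x ^ 2 :=
    intervalIntegral.integral_nonneg hab fun x hx => by have := hu x hx; positivity
  linarith

/-- Cauchy-Schwarz, read off from the nonnegativity of the integral of the squared deviation of `w`
from its mean. -/
lemma sq_sub_le (h : IsH2 u p w) (hab : a ≤ b) :
    (p b - p a) ^ 2 ≤ (b - a) * ∫ x in a..b, w x ^ 2 := by
  set m := p b - p a
  rcases hab.eq_or_lt with rfl | hlt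
  · simp [m]
  have hL : 0 < b - a := sub_pos.2 hlt
  have h0 : 0 ≤ ∫ x in a..b, (w x ^ 2 - 2 * (m / (b - a)) * w x + (m / (b - a)) ^ 2) :=
    intervalIntegral.integral_nonneg hab fun x _ => by
      have := sq_nonneg (w x - m / (b - a)); nlinarith
  rw [intervalIntegral.integral_add ((h.sq_integrable a b).sub ((h.integrable a b).const_mul _))
      intervalIntegrable_const,
    intervalIntegral.integral_sub (h.sq_integrable a b) ((h.integrable a b).const_mul _),
    intervalIntegral.integral_const_mul, h.integral_eq, intervalIntegral.integral_const,
    smul_eq_mul] at h0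
  have h1 : (b - a) * ((∫ x in a..b, w x ^ 2) - 2 * (m / (b - a)) * m +
      (b - a) * (m / (b - a)) ^ 2) = (b - a) * (∫ x in a..b, w x ^ 2) - m ^ 2 := by
    field_simp; ring
  have h2 := mul_nonneg hL.le h0
  rw [h1] at h2
  linarith

lemma integral_sq_mono (h : IsH2 u p w) {c d : ℝ} (hac : a ≤ c) (hcd : c ≤ d) (hdb : d ≤ b) :
    ∫ x in c..d, w x ^ 2 ≤ ∫ x in a..b, w x ^ 2 :=
  intervalIntegral.integral_mono_interval hac hcd hdb (ae_of_all _ fun _ => sq_nonneg _)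
    (h.sq_integrable a b)

lemma abs_sub_le (h : IsH2 u p w) {A : ℝ} (hA : ∫ x in a..b, w x ^ 2 ≤ A) {c d : ℝ}
    (hac : a ≤ c) (hcd : c ≤ d) (hdb : d ≤ b) : |p d - p c| ≤ Real.sqrt ((d - c) * A) := by
  refine Real.abs_le_sqrt ((h.sq_sub_le hcd).trans ?_)
  have := (h.integral_sq_mono hac hcd hdb).trans hA
  exact mul_le_mul_of_nonneg_left this (sub_nonneg.2 hcd)

end IsH2

/-! ### The best constant for arcs -/

/-- The inequality `∫ u''² - u'' u² + J u⁴ ≥ 0` on all intervals with `u' = 0` at both ends. -/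
def ArcNonneg (J : ℝ) : Prop :=
  ∀ u p w : ℝ → ℝ, IsH2 u p w → ∀ a b : ℝ, a ≤ b → p a = 0 → p b = 0 → 0 ≤ action J u w a b

lemma integral_pow_four_nonneg (u : ℝ → ℝ) {a b : ℝ} (hab : a ≤ b) :
    0 ≤ ∫ x in a..b, u x ^ 4 :=
  intervalIntegral.integral_nonneg hab fun x _ => by positivity

lemma ArcNonneg.mono {J J' : ℝ} (h : ArcNonneg J) (hJ : J ≤ J') : ArcNonneg J' := by
  intro u p w hH a b hab ha hb
  rw [hH.action_change J' J]
  have := h u p w hH a b hab ha hb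
  have := integral_pow_four_nonneg u hab
  have := mul_nonneg (sub_nonneg.2 hJ) this
  linarith

lemma arcNonneg_quarter : ArcNonneg (1 / 4) := by
  intro u p w hH a b hab _ _
  refine intervalIntegral.integral_nonneg hab fun x _ => ?_
  have := sq_nonneg (w x - u x ^ 2 / 2)
  nlinarith

-- The test arc has p = 420 x (1 - x)² and rises from -30 to 5, so neither one-sign bound applies to
-- it. `G` is an explicit primitive of the integrand, which makes the action a rational number of
-- negative sign.
open Polynomial in
lemma not_arcNonneg : ¬ ArcNonneg (9 / 64) := by
  intro h
  set u : ℝ → ℝ := fun x => -30 + 210 * x ^ 2 - 280 * x ^ 3 + 105 * x ^ 4 with hu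
  set p : ℝ → ℝ := fun x => 420 * x - 840 * x ^ 2 + 420 * x ^ 3 with hp
  set w : ℝ → ℝ := fun x => 420 - 1680 * x + 1260 * x ^ 2 with hw
  have hH : IsH2 u p w := by
    refine .of_hasDerivAt (fun x => ?_) (fun x => ?_) (by fun_prop)
    · have := (C (-30 : ℝ) + C 210 * X ^ 2 - C 280 * X ^ 3 + C 105 * X ^ 4).hasDerivAt x
      simp at this
      refine this.congr_deriv ?_
      simp only [hp]; ring
    · have := (C (420 : ℝ) * X - C 840 * X ^ 2 + C 420 * X ^ 3).hasDerivAt x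
      simp at this
      refine this.congr_deriv ?_
      simp only [hw]; ring
  have h0 := h u p w hH 0 1 zero_le_one (by simp [hp]) (by norm_num [hp])
  set G : ℝ[X] := C (-350775/4) * X ^ 1 + C (50400) * X ^ 2 + C (1616475) * X ^ 3 + C (-7051275)
      * X ^ 4 + C (12341070) * X ^ 5 + C (404250) * X ^ 6 + C (-102829125/2) * X ^ 7 + C
      (479569125/4) * X ^ 8 + C (-927833375/8) * X ^ 9 + C (-37044000) * X ^ 10 + C
      (11665387125/44) * X ^ 11 + C (-1541570625/4) * X ^ 12 + C (8344546875/26) * X ^ 13 + C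
      (-341499375/2) * X ^ 14 + C (461892375/8) * X ^ 15 + C (-364651875/32) * X ^ 16 + C
      (1093955625/1088) * X ^ 17 with hG
  have key : action (9 / 64) u w 0 1 = G.eval 1 - G.eval 0 := by
    refine intervalIntegral.integral_eq_sub_of_hasDerivAt (f := fun x => G.eval x)
      (fun x _ => ?_) (hH.lag_integrable _ _ _)
    refine (G.hasDerivAt x).congr_deriv ?_
    simp [hG, hu, hw]
    ring
  rw [key] at h0
  norm_num [hG] at h0

/-- The action is affine in the constant, so the infimum of the valid constants is itself valid. As
9/64 is not valid, the inequality 9/64 < J is strict, and this gap is what later gives compactness.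
-/
lemma exists_best_arc : ∃ J : ℝ, 9 / 64 < J ∧ J ≤ 1 / 4 ∧ ArcNonneg J ∧
    ∀ J' < J, ¬ ArcNonneg J' := by
  set S := {J | ArcNonneg J} with hS
  have hlb : 9 / 64 ∈ lowerBounds S := fun J hJ => by
    by_contra! hlt
    exact not_arcNonneg (ArcNonneg.mono hJ hlt.le)
  have hbdd : BddBelow S := ⟨_, hlb⟩
  have hne : S.Nonempty := ⟨1 / 4, arcNonneg_quarter⟩
  have hmem : ArcNonneg (sInf S) := by
    intro u p w hH a b hab ha hb
    by_contra! hneg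
    set C := ∫ x in a..b, u x ^ 4
    have hC : 0 ≤ C := integral_pow_four_nonneg u hab
    have hpos : 0 < -action (sInf S) u w a b / (C + 1) := div_pos (by linarith) (by linarith)
    obtain ⟨J, hJ, hlt⟩ := exists_lt_of_csInf_lt hne (lt_add_of_pos_right (sInf S) hpos)
    have h1 := hJ u p w hH a b hab ha hb
    rw [hH.action_change J (sInf S)] at h1
    have h2 : (J - sInf S) * C ≤ -action (sInf S) u w a b / (C + 1) * C :=
      mul_le_mul_of_nonneg_right (by linarith) hC
    have h3 : -action (sInf S) u w a b / (C + 1) * C < -action (sInf S) u w a b := by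
      rw [div_mul_eq_mul_div, div_lt_iff₀ (by linarith)]; nlinarith
    linarith
  refine ⟨sInf S, lt_of_le_of_ne (le_csInf hne hlb) ?_, csInf_le hbdd arcNonneg_quarter, hmem,
    fun J' hJ' hA => absurd (csInf_le hbdd hA) (not_le.2 hJ')⟩
  intro he
  exact not_arcNonneg (he ▸ hmem)

/-! ### Reduction to monotone arcs -/

namespace IsH2

variable {u p w : ℝ → ℝ} {a b J : ℝ}

lemma continuous_action (h : IsH2 u p w) (J a : ℝ) : Continuous fun x => action J u w a x :=
  intervalIntegral.continuous_primitive (fun c d => h.lag_integrable J c d) a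

/-- Short arcs have nonnegative action. -/
lemma action_nonneg_of_short (h : IsH2 u p w) {U c d : ℝ} (hJ : 0 ≤ J) (hcd : c ≤ d)
    (hU : ∀ x ∈ Icc c d, |u x| ≤ U) (hc : p c = 0) (hd : p d = 0)
    (hs : 2 * U * (d - c) ^ 2 ≤ 1) : 0 ≤ action J u w c d := by
  have huc := h.continuous_fst
  have hpc := h.continuous_snd
  set W := ∫ x in c..d, w x ^ 2
  have hW : 0 ≤ W := intervalIntegral.integral_nonneg hcd fun x _ => sq_nonneg _
  have hU0 : 0 ≤ U := (abs_nonneg _).trans (hU c ⟨le_rfl, hcd⟩)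
  have hL : 0 ≤ d - c := sub_nonneg.2 hcd
  have e := h.integral_mul_sq c d
  have i2 : IntervalIntegrable (fun x => w x * u x ^ 2) volume c d :=
    h.mul_integrable (huc.pow 2) c d
  have i3 : IntervalIntegrable (fun x => 2 * u x * p x ^ 2) volume c d :=
    Continuous.intervalIntegrable (by fun_prop) _ _
  rw [intervalIntegral.integral_add i2 i3, hc, hd] at e
  -- Starting from `p c = 0`, p² ≤ (d - c) W, so the possibly negative term 2∫u p² is at most 2U(d -
  -- c)² W ≤ W in size.
  have hlow : ∫ _ in c..d, -(2 * U * ((d - c) * W)) ≤ ∫ x in c..d, 2 * u x * p x ^ 2 := by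
    refine intervalIntegral.integral_mono_on hcd intervalIntegrable_const i3 fun x hx => ?_
    have h1 : p x ^ 2 ≤ (d - c) * W := by
      have h2 := h.sq_sub_le hx.1
      rw [hc, sub_zero] at h2
      have h3 : ∫ t in c..x, w t ^ 2 ≤ W := h.integral_sq_mono le_rfl hx.1 hx.2
      have h4 : 0 ≤ ∫ t in c..x, w t ^ 2 :=
        intervalIntegral.integral_nonneg hx.1 fun x _ => sq_nonneg _
      have h5 : x - c ≤ d - c := by linarith [hx.2]
      calc p x ^ 2 ≤ (x - c) * ∫ t in c..x, w t ^ 2 := h2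
        _ ≤ (d - c) * W := by gcongr
    have h6 : -U ≤ u x := (abs_le.1 (hU x hx)).1
    have h7 : 2 * U * p x ^ 2 ≤ 2 * U * ((d - c) * W) := by gcongr
    nlinarith [sq_nonneg (p x)]
  rw [intervalIntegral.integral_const, smul_eq_mul] at hlow
  rw [h.action_eq]
  have h8 := mul_nonneg hJ (integral_pow_four_nonneg u hcd)
  have h9 : 2 * U * (d - c) ^ 2 * W ≤ 1 * W := mul_le_mul_of_nonneg_right hs hW
  change 0 ≤ W - _ + _
  nlinarith

/-- An arc of negative action contains one on which `u` is strictly monotone. -/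
lemma exists_monotone_subarc (h : IsH2 u p w) (hJ : 0 ≤ J) (hab : a ≤ b) (ha : p a = 0)
    (hb : p b = 0) (hneg : action J u w a b < 0) :
    ∃ c d, c < d ∧ p c = 0 ∧ p d = 0 ∧ (∀ x ∈ Ioo c d, p x ≠ 0) ∧ action J u w c d < 0 := by
  have huc := h.continuous_fst
  have hpc := h.continuous_snd
  obtain ⟨U, hU⟩ := isCompact_Icc.exists_bound_of_continuousOn (s := Icc a b) huc.continuousOn
  simp only [Real.norm_eq_abs] at hU
  have hU0 : 0 ≤ U := (abs_nonneg _).trans (hU a ⟨le_rfl, hab⟩)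
  -- Arcs shorter than δ meet the smallness condition 2Uδ² ≤ 1 and have nonnegative action.
  set δ := 1 / (2 * U + 1) with hδ
  have hδ0 : 0 < δ := by positivity
  have hδ1 : 2 * U * δ ^ 2 ≤ 1 := by
    have h1 : δ ≤ 1 := by rw [hδ, div_le_one (by positivity)]; linarith
    have h2 : (2 * U + 1) * δ = 1 := by rw [hδ]; field_simp
    nlinarith
  have hshort : ∀ c d, a ≤ c → c ≤ d → d ≤ b → p c = 0 → p d = 0 → d - c < δ →
      0 ≤ action J u w c d := by
    intro c d hac hcd hdb hc hd hlt
    refine h.action_nonneg_of_short hJ hcd (fun x hx => hU x ⟨hac.trans hx.1, hx.2.trans hdb⟩)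
      hc hd (le_trans ?_ hδ1)
    have : 0 ≤ d - c := sub_nonneg.2 hcd
    gcongr
  have hlen : δ ≤ b - a := by
    by_contra! hlt
    exact absurd (hshort a b le_rfl hab le_rfl ha hb hlt) (not_le.2 hneg)
  have hba : 0 < b - a := hδ0.trans_le hlen
  -- Minus the mean action per unit length. The condition "action at most -ρ times length" is closed
  -- and, when an arc is split, passes to at least one of the two pieces.
  set ρ := -action J u w a b / (b - a) with hρ
  have hρ0 : 0 < ρ := div_pos (by linarith) hba
  have hcont : Continuous fun z : ℝ × ℝ => action J u w z.1 z.2 := by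
    have : (fun z : ℝ × ℝ => action J u w z.1 z.2) =
        fun z => action J u w a z.2 - action J u w a z.1 := by
      ext z; rw [← h.action_add J a z.1 z.2]; ring
    rw [this]
    exact ((h.continuous_action J a).comp _root_.continuous_snd).sub
      ((h.continuous_action J a).comp _root_.continuous_fst)
  -- The bound δ from below keeps degenerate arcs out of this compact set. A shortest element cannot
  -- be split at an interior zero of `p`: the piece that inherits the density bound would be a
  -- shorter element.
  set S : Set (ℝ × ℝ) := (Icc a b ×ˢ Icc a b) ∩ {z | z.1 + δ ≤ z.2 ∧ p z.1 = 0 ∧ p z.2 = 0 ∧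
    action J u w z.1 z.2 + ρ * (z.2 - z.1) ≤ 0} with hS
  have hScl : IsCompact S := by
    refine (isCompact_Icc.prod isCompact_Icc).inter_right ?_
    have c1 : IsClosed {z : ℝ × ℝ | z.1 + δ ≤ z.2} := isClosed_le (by fun_prop) (by fun_prop)
    have c2 : IsClosed {z : ℝ × ℝ | p z.1 = 0} := isClosed_eq (by fun_prop) (by fun_prop)
    have c3 : IsClosed {z : ℝ × ℝ | p z.2 = 0} := isClosed_eq (by fun_prop) (by fun_prop)
    have c4 : IsClosed {z : ℝ × ℝ | action J u w z.1 z.2 + ρ * (z.2 - z.1) ≤ 0} :=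
      isClosed_le (hcont.add (by fun_prop)) continuous_const
    exact c1.inter (c2.inter (c3.inter c4))
  have hSne : S.Nonempty := by
    refine ⟨(a, b), ⟨⟨le_rfl, hab⟩, hab, le_rfl⟩, by simp only; linarith, ha, hb, ?_⟩
    simp only [hρ]
    rw [div_mul_cancel₀ _ hba.ne']; linarith
  obtain ⟨⟨c, d⟩, ⟨⟨⟨hac, hcb⟩, ⟨had, hdb⟩⟩, hcd, hpc0, hpd0, hact⟩, hmin⟩ :=
    hScl.exists_isMinOn hSne (f := fun z => z.2 - z.1) (by fun_prop)
  simp only at hac hcb had hdb hcd hpc0 hpd0 hact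
  have hlt : c < d := by linarith
  refine ⟨c, d, hlt, hpc0, hpd0, ?_, by nlinarith⟩
  intro e he hpe
  have hsplit := h.action_add J c e d
  have hor : action J u w c e + ρ * (e - c) ≤ 0 ∨ action J u w e d + ρ * (d - e) ≤ 0 := by
    by_contra! hcon
    nlinarith [hcon.1, hcon.2]
  rcases hor with h1 | h1
  · have hlen' : c + δ ≤ e := by
      by_contra! hlt'
      have := hshort c e hac he.1.le (he.2.le.trans hdb) hpc0 hpe (by linarith)
      nlinarith [mul_pos hρ0 (sub_pos.2 he.1)]
    have := hmin (a := (c, e)) ⟨⟨⟨hac, hcb⟩, hac.trans he.1.le, he.2.le.trans hdb⟩, hlen', hpc0,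
      hpe, h1⟩
    simp only [mem_ofPred_eq] at this
    linarith [he.2]
  · have hlen' : e + δ ≤ d := by
      by_contra! hlt'
      have := hshort e d (hac.trans he.1.le) he.2.le hdb hpe hpd0 (by linarith)
      nlinarith [mul_pos hρ0 (sub_pos.2 he.2)]
    have := hmin (a := (e, d)) ⟨⟨⟨hac.trans he.1.le, he.2.le.trans hdb⟩, had, hdb⟩, hlen', hpe,
      hpd0, h1⟩
    simp only [mem_ofPred_eq] at this
    linarith [he.1]

lemma sub_ge_of_ge (h : IsH2 u p w) {c d κ : ℝ} (hcd : c ≤ d) (hκ : ∀ x ∈ Icc c d, κ ≤ p x) :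
    κ * (d - c) ≤ u d - u c := by
  rw [← h.integral_snd]
  have := intervalIntegral.integral_mono_on hcd (μ := volume) (f := fun _ => κ) (g := p)
    intervalIntegrable_const (h.continuous_snd.intervalIntegrable _ _) hκ
  rw [intervalIntegral.integral_const, smul_eq_mul] at this
  linarith

lemma sub_le_of_le (h : IsH2 u p w) {c d κ : ℝ} (hcd : c ≤ d) (hκ : ∀ x ∈ Icc c d, p x ≤ κ) :
    u d - u c ≤ κ * (d - c) := by
  rw [← h.integral_snd]
  have := intervalIntegral.integral_mono_on hcd (μ := volume) (f := p) (g := fun _ => κ)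
    (h.continuous_snd.intervalIntegrable _ _) intervalIntegrable_const hκ
  rw [intervalIntegral.integral_const, smul_eq_mul] at this
  linarith

lemma mul_pow_four_le (h : IsH2 u p w) {c d κ : ℝ} (hκ : 0 ≤ κ) (hac : a ≤ c) (hcd : c ≤ d)
    (hdb : d ≤ b) (hu : ∀ x ∈ Icc c d, κ ≤ u x) : (d - c) * κ ^ 4 ≤ ∫ x in a..b, u x ^ 4 := by
  have hi : ∀ c d, IntervalIntegrable (fun x => u x ^ 4) volume c d := fun c d =>
    (h.continuous_fst.pow 4).intervalIntegrable _ _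
  have h1 := intervalIntegral.integral_mono_on hcd (μ := volume) (f := fun _ => κ ^ 4)
    (g := fun x => u x ^ 4) intervalIntegrable_const (hi c d)
    fun x hx => pow_le_pow_left₀ hκ (hu x hx) 4
  rw [intervalIntegral.integral_const, smul_eq_mul] at h1
  exact h1.trans (intervalIntegral.integral_mono_interval hac hcd hdb
    (ae_of_all _ fun x => by simp only [Pi.zero_apply]; positivity) (hi a b))

lemma reflect (h : IsH2 u p w) :
    IsH2 (fun x => u (-x)) (fun x => -p (-x)) (fun x => w (-x)) := by
  have := h.scale (l := -1) (by norm_num) 0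
  norm_num [Odd.neg_one_pow (by decide : Odd 3)] at this
  exact this

end IsH2

/-! ### Length bounds for normalised monotone arcs -/

/-- An increasing arc starting at a zero of `u`, with normalised norms. -/
structure IsHalfArc (u p w : ℝ → ℝ) (a b : ℝ) : Prop extends IsH2 u p w where
  le : a ≤ b
  left : u a = 0
  right : p b = 0
  nonneg : ∀ x ∈ Icc a b, 0 ≤ p x
  sq_le : ∫ x in a..b, w x ^ 2 ≤ 1
  four_le : ∫ x in a..b, u x ^ 4 ≤ 1

namespace IsHalfArc

variable {u p w : ℝ → ℝ} {a b : ℝ}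

lemma mono (h : IsHalfArc u p w a b) {x y : ℝ} (hx : a ≤ x) (hxy : x ≤ y) (hy : y ≤ b) :
    u x ≤ u y := by
  have := h.sub_ge_of_ge hxy (κ := 0) fun z hz => h.nonneg z ⟨hx.trans hz.1, hz.2.trans hy⟩
  linarith

lemma fst_nonneg (h : IsHalfArc u p w a b) {x : ℝ} (hx : x ∈ Icc a b) : 0 ≤ u x :=
  h.left ▸ h.mono le_rfl hx.1 hx.2

/-- Since ∫w² ≤ 1, the slope is Hölder continuous of exponent 1/2 with constant 1. -/
lemma sub_le {x y r : ℝ} (h : IsHalfArc u p w a b) (hr : 0 ≤ r) (hx : a ≤ x) (hxy : x ≤ y)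
    (hy : y ≤ b) (hl : y - x ≤ r ^ 2) : p x - r ≤ p y := by
  have h1 := h.abs_sub_le h.sq_le hx hxy hy
  have h2 : Real.sqrt ((y - x) * 1) ≤ r := by
    rw [mul_one]; exact Real.sqrt_le_iff.2 ⟨hr, hl⟩
  have := (abs_le.1 (h1.trans h2)).1
  linarith

/-- A slope above 3 stays above 3/2 for length 9/8 and cannot vanish before length 9/4. Over the
second 9/8, u ≥ 3/2, which is incompatible with ∫u⁴ ≤ 1. -/
lemma snd_le (h : IsHalfArc u p w a b) {x : ℝ} (hx : x ∈ Icc a b) : p x ≤ 3 := by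
  by_contra! hgt
  have hb : x + 9 / 4 < b := by
    by_contra! hle
    have := h.sub_le (r := 3 / 2) (by norm_num) hx.1 hx.2 le_rfl (by linarith)
    rw [h.right] at this
    linarith
  have hp : ∀ y ∈ Icc x (x + 9 / 8), (3 / 2 : ℝ) ≤ p y := fun y hy => by
    have := h.sub_le (r := 3 / 2) (by norm_num) hx.1 hy.1 (by linarith [hy.2])
      (by linarith [hy.2])
    linarith
  have h1 := h.sub_ge_of_ge (by linarith) hp
  have h2 := h.mul_pow_four_le (a := a) (b := b) (c := x + 9 / 8) (d := x + 9 / 4) (κ := 3 / 2)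
    (by norm_num) (by linarith [hx.1]) (by linarith) hb.le fun y hy => by
      have := h.mono (by linarith [hx.1]) hy.1 (by linarith [hy.2])
      have := h.fst_nonneg hx
      linarith
  have := h.four_le
  norm_num at h2
  linarith

/-- If u(b) > 3, the slope bound 3 keeps u above 3/2 on the last half unit, where u⁴ already
integrates to more than 1. -/
lemma fst_le (h : IsHalfArc u p w a b) : u b ≤ 3 := by
  by_contra! hgt
  have h1 : ∀ y ∈ Icc a b, u b - u y ≤ 3 * (b - y) := fun y hy =>
    h.sub_le_of_le hy.2 fun z hz => h.snd_le ⟨hy.1.trans hz.1, hz.2⟩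
  have h2 := h1 a ⟨le_rfl, h.le⟩
  rw [h.left] at h2
  have h3 := h.mul_pow_four_le (a := a) (b := b) (c := b - 1 / 2) (d := b) (κ := 3 / 2)
    (by norm_num) (by linarith) (by linarith) le_rfl fun y hy => by
      have := h1 y ⟨by linarith [hy.1], hy.2⟩
      linarith [hy.1]
  have := h.four_le
  norm_num at h3
  linarith

lemma integral_sq_le (h : IsHalfArc u p w a b) : ∫ x in a..b, p x ^ 2 ≤ 9 := by
  have hpc := h.continuous_snd
  have h1 : ∫ x in a..b, p x ^ 2 ≤ ∫ x in a..b, 3 * p x :=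
    intervalIntegral.integral_mono_on h.le (by apply Continuous.intervalIntegrable; fun_prop)
      (by apply Continuous.intervalIntegrable; fun_prop) fun x hx => by
        have := h.snd_le hx; have := h.nonneg x hx; nlinarith
  rw [intervalIntegral.integral_const_mul, h.integral_snd, h.left] at h1
  linarith [h.fst_le]

lemma le_length (h : IsHalfArc u p w a b) {κ : ℝ} (hκ : 0 < κ) (hp : κ ≤ p a) :
    κ ^ 2 / 4 ≤ b - a := by
  by_contra! hlt
  have := h.sub_le (r := κ / 2) (by positivity) le_rfl h.le le_rfl (by linarith)
  rw [h.right] at this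
  linarith

/-- An initial slope κ remains at least κ/2 for length κ²/4, which lifts u to κ³/8. By monotonicity
u stays above this level, and ∫u⁴ ≤ 1 limits the remaining length. -/
lemma length_le (h : IsHalfArc u p w a b) {κ : ℝ} (hκ : 0 < κ) (hp : κ ≤ p a) :
    b - a ≤ κ ^ 2 / 4 + 1 / (κ ^ 3 / 8) ^ 4 := by
  have hl := h.le_length hκ hp
  have h1 : ∀ y ∈ Icc a (a + κ ^ 2 / 4), κ / 2 ≤ p y := fun y hy => by
    have := h.sub_le (r := κ / 2) (by positivity) le_rfl hy.1 (by linarith [hy.2])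
      (by linarith [hy.2])
    linarith
  have h2 := h.sub_ge_of_ge (by nlinarith) h1
  rw [h.left] at h2
  have h3 := h.mul_pow_four_le (a := a) (b := b) (c := a + κ ^ 2 / 4) (d := b) (κ := κ ^ 3 / 8)
    (by positivity) (by nlinarith) (by linarith) le_rfl fun y hy => by
      have := h.mono (by nlinarith) hy.1 hy.2
      linarith
  have h4 := h3.trans h.four_le
  rw [← le_div_iff₀ (by positivity)] at h4
  linarith

end IsHalfArc

lemma integral_sq_scale (w : ℝ → ℝ) {l : ℝ} (hl : l ≠ 0) (τ a b : ℝ) :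
    ∫ x in a..b, (l ^ 4 * w (l * x + τ)) ^ 2 =
      l ^ 7 * ∫ x in (l * a + τ)..(l * b + τ), w x ^ 2 := by
  have := intervalIntegral.integral_comp_mul_add (a := a) (b := b) (fun y => w y ^ 2) hl τ
  simp only [mul_pow, intervalIntegral.integral_const_mul, this, smul_eq_mul]
  field_simp

lemma integral_four_scale (u : ℝ → ℝ) {l : ℝ} (hl : l ≠ 0) (τ a b : ℝ) :
    ∫ x in a..b, (l ^ 2 * u (l * x + τ)) ^ 4 =
      l ^ 7 * ∫ x in (l * a + τ)..(l * b + τ), u x ^ 4 := by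
  have := intervalIntegral.integral_comp_mul_add (a := a) (b := b) (fun y => u y ^ 4) hl τ
  simp only [mul_pow, intervalIntegral.integral_const_mul, this, smul_eq_mul]
  field_simp

/-- The upper bound for the length of normalised monotone arcs. -/
noncomputable def lengthBound (δ : ℝ) : ℝ := 2 * ((δ / 2) ^ 2 / 4 + 1 / ((δ / 2) ^ 3 / 8) ^ 4)

/-- Bounds for a normalised increasing arc of negative action. -/
lemma IsH2.bounds_of_action_neg {u p w : ℝ → ℝ} {a b J δ : ℝ} (h : IsH2 u p w) (hab : a < b)
    (ha : p a = 0) (hb : p b = 0) (hp : ∀ x ∈ Ioo a b, 0 < p x) (hδ : 0 < δ)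
    (hJδ : 9 / 64 + δ ≤ J) (hJ : J ≤ 1 / 4) (hC : ∫ x in a..b, u x ^ 4 = 1)
    (hneg : action J u w a b < 0) :
    ∫ x in a..b, w x ^ 2 ≤ 1 ∧ |u a| ≤ 3 ∧ (δ / 2) ^ 2 / 4 ≤ b - a ∧ b - a ≤ lengthBound δ := by
  have huc := h.continuous_fst
  have hpn : ∀ x ∈ Icc a b, 0 ≤ p x := by
    intro x hx
    rcases eq_or_lt_of_le hx.1 with rfl | h1
    · exact ha.ge
    rcases eq_or_lt_of_le hx.2 with rfl | h2
    · exact hb.ge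
    exact (hp x ⟨h1, h2⟩).le
  have hmono : ∀ x y, a ≤ x → x ≤ y → y ≤ b → u x ≤ u y := fun x y hx hxy hy => by
    have := h.sub_ge_of_ge hxy (κ := 0) fun z hz => hpn z ⟨hx.trans hz.1, hz.2.trans hy⟩
    linarith
  have hua : u a < 0 := by
    by_contra! hge
    have := h.action_ge_of_nonneg (J := J) hab.le
      (fun x hx => hge.trans (hmono a x le_rfl hx.1 hx.2)) (by simp [ha]) hb
    rw [hC] at this
    linarith
  have hub : 0 < u b := by
    by_contra! hle
    have h1 := h.action_nonneg_of_nonpos hab.le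
      (fun x hx => (hmono x b hx.1 hx.2 le_rfl).trans hle) ha hb
    rw [h.action_change J (9 / 64), hC] at hneg
    linarith
  -- Young's inequality on `w u²` turns negative action into ∫w² < 1 - 2J.
  have hA : ∫ x in a..b, w x ^ 2 ≤ 1 := by
    have i2 : IntervalIntegrable (fun x => w x * u x ^ 2) volume a b :=
      h.mul_integrable (huc.pow 2) a b
    have i4 : IntervalIntegrable (fun x => u x ^ 4) volume a b :=
      (huc.pow 4).intervalIntegrable _ _
    have h1 : ∫ x in a..b, w x * u x ^ 2 ≤ ∫ x in a..b, (1 / 2 * w x ^ 2 + 1 / 2 * u x ^ 4) := by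
      refine intervalIntegral.integral_mono_on hab.le i2
        (((h.sq_integrable a b).const_mul _).add (i4.const_mul _)) fun x _ => ?_
      have := sq_nonneg (w x - u x ^ 2)
      nlinarith
    rw [intervalIntegral.integral_add ((h.sq_integrable a b).const_mul _) (i4.const_mul _),
      intervalIntegral.integral_const_mul, intervalIntegral.integral_const_mul, hC] at h1
    rw [h.action_eq, hC] at hneg
    linarith
  obtain ⟨x₀, hx₀, hux₀⟩ := intermediate_value_Ioo hab.le huc.continuousOn ⟨hua, hub⟩
  have hsplit4 : (∫ x in a..x₀, u x ^ 4) + ∫ x in x₀..b, u x ^ 4 = 1 := by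
    have hi : ∀ c d, IntervalIntegrable (fun x => u x ^ 4) volume c d := fun c d =>
      (huc.pow 4).intervalIntegrable c d
    rw [intervalIntegral.integral_add_adjacent_intervals (hi _ _) (hi _ _), hC]
  have hl0 := integral_pow_four_nonneg u hx₀.1.le
  have hr0 := integral_pow_four_nonneg u hx₀.2.le
  have hR : IsHalfArc u p w x₀ b :=
    { h with
      le := hx₀.2.le
      left := hux₀
      right := hb
      nonneg := fun x hx => hpn x ⟨hx₀.1.le.trans hx.1, hx.2⟩
      sq_le := (h.integral_sq_mono hx₀.1.le hx₀.2.le le_rfl).trans hA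
      four_le := by linarith }
  -- The half turn x ↦ -u(-x) makes the left part an increasing arc starting at a zero.
  have hL : IsHalfArc (fun x => -u (-x)) (fun x => p (-x)) (fun x => -w (-x)) (-x₀) (-a) := by
    have hr := h.reflect.neg
    simp only [neg_neg] at hr
    exact
    { hr with
      le := by linarith [hx₀.1]
      left := by simp [hux₀]
      right := by simp [ha]
      nonneg := fun x hx => hpn (-x) ⟨by linarith [hx.2], by linarith [hx.1, hx₀.2]⟩
      sq_le := by
        simp only [even_two, Even.neg_pow]
        rw [intervalIntegral.integral_comp_neg (fun x => w x ^ 2), neg_neg, neg_neg]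
        exact (h.integral_sq_mono le_rfl hx₀.1.le hx₀.2.le).trans hA
      four_le := by
        simp only [show Even 4 by decide, Even.neg_pow]
        rw [intervalIntegral.integral_comp_neg (fun x => u x ^ 4), neg_neg, neg_neg]
        linarith }
  set η := p x₀
  have hη0 : 0 ≤ η := hpn x₀ (Ioo_subset_Icc_self hx₀)
  -- The gap above 9/64 enters here. On the right part the action is at least J∫u⁴, on the left part
  -- the 9/64 bound leaves a surplus of at least δ∫u⁴, so the total surplus is at least δ. With σ =
  -- δ/9 and ∫p² ≤ 9 the regularisation costs at most δ/2. Negative action then forces the boundary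
  -- term 4η³/δ to exceed δ/2, which a small η cannot do.
  have hη : δ / 2 ≤ η := by
    have h1 := h.action_add_nonneg_of_nonpos hx₀.1.le
      (fun x hx => hux₀ ▸ hmono x x₀ hx.1 hx.2 hx₀.2.le) ha hη0 (Or.inr hux₀)
      (σ := δ / 9) (by positivity)
    have h2 : ∫ x in a..x₀, p x ^ 2 ≤ 9 := by
      have := hL.integral_sq_le
      rwa [intervalIntegral.integral_comp_neg (fun x => p x ^ 2), neg_neg, neg_neg] at this
    have h3 := h.action_change J (9 / 64) a x₀
    have h4 := h.action_ge_of_nonneg (J := J) hx₀.2.le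
      (fun x hx => hR.fst_nonneg hx) (by simp [hux₀]) hb
    have h5 := h.action_add J a x₀ b
    have h6 : δ * (∫ x in a..x₀, u x ^ 4) ≤ (J - 9 / 64) * ∫ x in a..x₀, u x ^ 4 := by
      gcongr; linarith
    have h7 : δ * (∫ x in x₀..b, u x ^ 4) ≤ J * ∫ x in x₀..b, u x ^ 4 := by
      gcongr; linarith
    have h8 : δ / 9 / 2 * (∫ x in a..x₀, p x ^ 2) ≤ δ / 9 / 2 * 9 := by gcongr
    have h9 : δ / 2 < 4 / 9 * (η ^ 3 / (δ / 9)) := by nlinarith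
    have h10 : 4 / 9 * (η ^ 3 / (δ / 9)) = 4 * η ^ 3 / δ := by field_simp
    rw [h10, lt_div_iff₀ hδ] at h9
    by_contra! hlt
    have : η ^ 3 ≤ (δ / 2) ^ 3 := pow_le_pow_left₀ hη0 hlt.le 3
    nlinarith [mul_pos hδ hδ]
  have r1 := hR.le_length (half_pos hδ) hη
  have r2 := hR.length_le (half_pos hδ) hη
  have l2 := hL.length_le (κ := δ / 2) (half_pos hδ) (by simpa using hη)
  have l3 := hL.fst_le
  simp only [neg_neg] at l3
  refine ⟨hA, abs_le.2 ⟨by linarith, by linarith⟩, by linarith [hx₀.1], ?_⟩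
  unfold lengthBound
  linarith

/-- An arc of negative action yields a normalised increasing one. -/
lemma exists_normalised_arc {J : ℝ} (hJ0 : 0 ≤ J) (hJ : J ≤ 1 / 4) (hneg : ¬ ArcNonneg J) :
    ∃ u p w : ℝ → ℝ, ∃ a b : ℝ, IsH2 u p w ∧ a < b ∧ p a = 0 ∧ p b = 0 ∧
      (∀ x ∈ Ioo a b, 0 < p x) ∧ ∫ x in a..b, u x ^ 4 = 1 ∧ action J u w a b < 0 := by
  unfold ArcNonneg at hneg
  push Not at hneg
  obtain ⟨u, p, w, h, a, b, hab, ha, hb, hn⟩ := hneg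
  obtain ⟨a, b, hab, ha, hb, hne, hn⟩ := h.exists_monotone_subarc hJ0 hab ha hb hn
  obtain ⟨u, p, w, a, b, h, hab, ha, hb, hp, hn⟩ : ∃ u p w : ℝ → ℝ, ∃ a b : ℝ, IsH2 u p w ∧
      a < b ∧ p a = 0 ∧ p b = 0 ∧ (∀ x ∈ Ioo a b, 0 < p x) ∧ action J u w a b < 0 := by
    have hpc := h.continuous_snd
    by_cases hs : ∀ x ∈ Ioo a b, 0 < p x
    · exact ⟨u, p, w, a, b, h, hab, ha, hb, hs, hn⟩
    push Not at hs
    obtain ⟨y, hy, hpy⟩ := hs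
    have hs' : ∀ x ∈ Ioo a b, p x < 0 := by
      intro x hx
      by_contra! hge
      obtain ⟨z, hz, hpz⟩ := isPreconnected_Ioo.intermediate_value hy hx hpc.continuousOn
        ⟨hpy, hge⟩
      exact hne z hz hpz
    refine ⟨_, _, _, -b, -a, h.reflect, by linarith, by simp [hb], by simp [ha],
      fun x hx => neg_pos.2 (hs' (-x) ⟨by linarith [hx.2], by linarith [hx.1]⟩), ?_⟩
    have := action_scale J u w (l := -1) (by norm_num) 0 (-b) (-a)
    norm_num [Odd.neg_one_pow (by decide : Odd 7)] at this
    rw [this]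
    unfold action at hn ⊢
    rw [intervalIntegral.integral_symm, neg_neg]
    exact hn
  set C := ∫ x in a..b, u x ^ 4 with hC
  have hC0 : 0 < C := by
    have h1 := arcNonneg_quarter u p w h a b hab.le ha hb
    rw [h.action_change (1 / 4) J] at h1
    by_contra! hle
    nlinarith
  -- Chosen with l⁷ = 1/C, the factor by which ∫u⁴ is multiplied under scaling.
  set l : ℝ := (C⁻¹) ^ ((7 : ℝ)⁻¹) with hl
  have hl0 : 0 < l := by positivity
  have hl7 : l ^ 7 = C⁻¹ := by
    rw [hl, ← Real.rpow_natCast, ← Real.rpow_mul (by positivity)]; norm_num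
  have e : ∀ x, l * (l⁻¹ * x) + 0 = x := fun x => by field_simp; simp
  refine ⟨_, _, _, l⁻¹ * a, l⁻¹ * b, h.scale hl0.ne' 0, by gcongr, ?_, ?_, ?_, ?_, ?_⟩
  · simp only [e, ha, mul_zero]
  · simp only [e, hb, mul_zero]
  · intro x hx
    have h1 := mul_lt_mul_of_pos_left hx.1 hl0
    have h2 := mul_lt_mul_of_pos_left hx.2 hl0
    rw [mul_inv_cancel_left₀ hl0.ne'] at h1 h2
    have := hp (l * x + 0) ⟨by linarith, by linarith⟩
    positivity
  · rw [integral_four_scale u hl0.ne', e, e, hl7, ← hC, inv_mul_cancel₀ hC0.ne']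
  · rw [action_scale J u w hl0.ne', e, e]
    exact mul_neg_of_pos_of_neg (by positivity) hn

/-- Almost minimal arcs on `[0, 1]` can be chosen in a bounded set. -/
lemma exists_bounded_arcs {J : ℝ} (hJ0 : 9 / 64 < J) (hJ : J ≤ 1 / 4)
    (hbest : ∀ J' < J, ¬ ArcNonneg J') :
    ∃ K : ℝ, 0 < K ∧ ∀ ε > 0, ∃ u p w : ℝ → ℝ, IsH2 u p w ∧ p 0 = 0 ∧ p 1 = 0 ∧
      ∫ x in (0:ℝ)..1, w x ^ 2 ≤ K ∧ |u 0| ≤ K ∧ K⁻¹ ≤ ∫ x in (0:ℝ)..1, u x ^ 4 ∧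
      action J u w 0 1 ≤ ε := by
  set δ := (J - 9 / 64) / 2 with hδ
  have hδ0 : 0 < δ := by rw [hδ]; linarith
  set Λ := lengthBound δ with hΛ
  have hΛ0 : 0 < Λ := by rw [hΛ]; unfold lengthBound; positivity
  set κ := (δ / 2) ^ 2 / 4 with hκ
  have hκ0 : 0 < κ := by positivity
  set K := Λ ^ 7 + 3 * Λ ^ 2 + (κ ^ 7)⁻¹ with hK
  have hK0 : 0 < K := by positivity
  refine ⟨K, hK0, fun ε hε => ?_⟩
  -- The bound δ keeps J' ≥ 9/64 + δ, so that the length bounds apply. The bound ε/Λ⁷ leaves an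
  -- action of at most ε at the constant J after rescaling to unit length, which costs a factor l⁷ ≤
  -- Λ⁷.
  set J' := J - min δ (ε / Λ ^ 7) with hJ'
  have hm0 : 0 < min δ (ε / Λ ^ 7) := lt_min hδ0 (by positivity)
  have hm1 : min δ (ε / Λ ^ 7) ≤ δ := min_le_left _ _
  have hm2 : min δ (ε / Λ ^ 7) ≤ ε / Λ ^ 7 := min_le_right _ _
  obtain ⟨u, p, w, a, b, h, hab, ha, hb, hp, hC, hn⟩ :=
    exists_normalised_arc (J := J') (by linarith) (by linarith) (hbest J' (by linarith))
  obtain ⟨hA, hu, hl1, hl2⟩ := h.bounds_of_action_neg (δ := δ) hab ha hb hp hδ0 (by linarith)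
    (by linarith) hC hn
  set l := b - a with hl
  have hl0 : 0 < l := sub_pos.2 hab
  have e0 : l * 0 + a = a := by ring
  have e1 : l * 1 + a = b := by rw [hl]; ring
  refine ⟨_, _, _, h.scale hl0.ne' a, ?_, ?_, ?_, ?_, ?_, ?_⟩
  · rw [e0, ha, mul_zero]
  · simp only [e1, hb, mul_zero]
  · rw [integral_sq_scale w hl0.ne', e0, e1]
    have hA0 : 0 ≤ ∫ x in a..b, w x ^ 2 :=
      intervalIntegral.integral_nonneg hab.le fun x _ => sq_nonneg _
    calc l ^ 7 * ∫ x in a..b, w x ^ 2 ≤ Λ ^ 7 * 1 := by gcongr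
      _ ≤ K := by rw [hK, mul_one]; nlinarith [sq_nonneg Λ, inv_pos.2 (pow_pos hκ0 7)]
  · simp only [e0]
    rw [abs_mul, abs_of_pos (by positivity)]
    calc l ^ 2 * |u a| ≤ Λ ^ 2 * 3 := by gcongr
      _ ≤ K := by rw [hK]; nlinarith [pow_pos hΛ0 7, inv_pos.2 (pow_pos hκ0 7)]
  · rw [integral_four_scale u hl0.ne', e0, e1, hC, mul_one]
    have h1 : κ ^ 7 ≤ l ^ 7 := by gcongr
    refine le_trans ?_ h1
    rw [inv_le_comm₀ hK0 (by positivity), hK]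
    have := pow_pos hΛ0 7
    have := sq_nonneg Λ
    linarith
  · rw [action_scale J u w hl0.ne', e0, e1, h.action_change J J', hC]
    have h1 : action J' u w a b + (J - J') * 1 ≤ ε / Λ ^ 7 := by linarith
    calc l ^ 7 * (action J' u w a b + (J - J') * 1) ≤ l ^ 7 * (ε / Λ ^ 7) := by gcongr
      _ ≤ Λ ^ 7 * (ε / Λ ^ 7) := by gcongr
      _ = ε := by field_simp

/-! ### Weak compactness and the existence of a minimal arc -/

/-- Lebesgue measure on the unit interval. -/
noncomputable abbrev unitMeasure : Measure ℝ := volume.restrict (Ioc (0:ℝ) 1)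

instance : Fact ((2 : ENNReal) ≠ ⊤) := ⟨by norm_num⟩

/-- Weak sequential compactness of bounded sets in `L²(0, 1)`. -/
lemma exists_weak_limit {K : ℝ} (w : ℕ → ℝ → ℝ) (hw : ∀ n, MemLp (w n) 2 unitMeasure)
    (hK : ∀ n, ∫ x in (0:ℝ)..1, w n x ^ 2 ≤ K) :
    ∃ φ : ℕ → ℕ, StrictMono φ ∧ ∃ v : ℝ → ℝ, MemLp v 2 unitMeasure ∧
      ∀ g : ℝ → ℝ, MemLp g 2 unitMeasure →
        Tendsto (fun n => ∫ x in (0:ℝ)..1, w (φ n) x * g x) atTop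
          (𝓝 (∫ x in (0:ℝ)..1, v x * g x)) := by
  have : TopologicalSpace.SeparableSpace (Lp ℝ 2 unitMeasure) := by
    have := Lp.SecondCountableTopology (E := ℝ) (μ := unitMeasure) (p := 2)
    infer_instance
  let D := InnerProductSpace.toDual ℝ (Lp ℝ 2 unitMeasure)
  let W : ℕ → Lp ℝ 2 unitMeasure := fun n => (hw n).toLp
  have hin : ∀ (f g : ℝ → ℝ) (hf : MemLp f 2 unitMeasure) (hg : MemLp g 2 unitMeasure),
      inner ℝ (hf.toLp) (hg.toLp) = ∫ x in (0:ℝ)..1, f x * g x := by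
    intro f g hf hg
    rw [L2.inner_def, intervalIntegral.integral_of_le zero_le_one]
    refine integral_congr_ae ?_
    filter_upwards [hf.coeFn_toLp, hg.coeFn_toLp] with x h1 h2
    rw [h1, h2]
    simp [mul_comm]
  have hnorm : ∀ n, ‖W n‖ ≤ Real.sqrt K := by
    intro n
    refine Real.le_sqrt_of_sq_le ?_
    rw [← real_inner_self_eq_norm_sq, hin _ _ (hw n) (hw n)]
    simpa only [← pow_two] using hK n
  -- Sequential Banach-Alaoglu for the dual of a separable space, carried back to L² by the Riesz
  -- isometry.
  obtain ⟨F, -, φ, hφ, hlim⟩ := WeakDual.isSeqCompact_closedBall ℝ (Lp ℝ 2 unitMeasure) 0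
    (Real.sqrt K) (x := fun n => WeakDual.toStrongDual.symm (D (W n))) (fun n => by
      simp only [mem_preimage, LinearEquiv.apply_symm_apply, mem_closedBall_zero_iff]
      rw [LinearIsometryEquiv.norm_map]
      exact hnorm n)
  set V : Lp ℝ 2 unitMeasure := D.symm (WeakDual.toStrongDual F) with hV
  refine ⟨φ, hφ, V, Lp.memLp V, fun g hg => ?_⟩
  have h1 := (WeakDual.eval_continuous (𝕜 := ℝ) hg.toLp).continuousAt.tendsto.comp hlim
  have h2 : F (hg.toLp) = ∫ x in (0:ℝ)..1, V x * g x := by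
    rw [← hin V g (Lp.memLp V) hg, Lp.toLp_coeFn, hV]
    have := InnerProductSpace.toDual_symm_apply (𝕜 := ℝ) (x := hg.toLp)
      (y := WeakDual.toStrongDual F)
    rw [this]; rfl
  rw [← h2]
  refine h1.congr fun n => ?_
  rw [← hin _ _ (hw (φ n)) hg]
  rfl

lemma IsH2.memLp_unit {u p w : ℝ → ℝ} (h : IsH2 u p w) : MemLp w 2 unitMeasure := by
  have h1 := (intervalIntegrable_iff_integrableOn_Ioc_of_le zero_le_one).1 (h.integrable 0 1)
  have h2 := (intervalIntegrable_iff_integrableOn_Ioc_of_le zero_le_one).1 (h.sq_integrable 0 1)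
  exact (memLp_two_iff_integrable_sq h1.aestronglyMeasurable).2 h2

lemma IsH2.integral_mul_sq_of_arc {u p w : ℝ → ℝ} (h : IsH2 u p w) {a b : ℝ} (ha : p a = 0)
    (hb : p b = 0) : ∫ x in a..b, w x * u x ^ 2 = -∫ x in a..b, 2 * u x * p x ^ 2 := by
  have huc := h.continuous_fst
  have hpc := h.continuous_snd
  have e := h.integral_mul_sq a b
  have i2 : IntervalIntegrable (fun x => w x * u x ^ 2) volume a b :=
    h.mul_integrable (huc.pow 2) a b
  have i3 : IntervalIntegrable (fun x => 2 * u x * p x ^ 2) volume a b :=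
    Continuous.intervalIntegrable (by fun_prop) _ _
  rw [intervalIntegral.integral_add i2 i3, ha, hb] at e
  linarith

/-- Existence of a minimal arc. -/
lemma exists_minimal_arc {J : ℝ} (hJ0 : 9 / 64 < J) (hJ : J ≤ 1 / 4) (hA : ArcNonneg J)
    (hbest : ∀ J' < J, ¬ ArcNonneg J') :
    ∃ u p w : ℝ → ℝ, IsH2 u p w ∧ p 0 = 0 ∧ p 1 = 0 ∧ action J u w 0 1 = 0 ∧
      0 < ∫ x in (0:ℝ)..1, u x ^ 4 := by
  obtain ⟨K, hK, hseq⟩ := exists_bounded_arcs hJ0 hJ hbest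
  choose u p w hH hp0 hp1 hw hu hC hact using fun n : ℕ => hseq (1 / ((n : ℝ) + 1)) (by positivity)
  obtain ⟨α, -, φ₁, hφ₁, hα⟩ := tendsto_subseq_of_bounded (x := fun n => u n 0)
    (Metric.isBounded_closedBall (x := (0:ℝ)) (r := K))
    (fun n => by simpa using hu n)
  obtain ⟨φ₂, hφ₂, v₀, hv₀, hlim₀⟩ := exists_weak_limit (fun n => w (φ₁ n))
    (fun n => (hH _).memLp_unit) (fun n => hw _)
  set φ : ℕ → ℕ := fun n => φ₁ (φ₂ n) with hφ
  have hφt : Tendsto φ atTop atTop := (hφ₁.comp hφ₂).tendsto_atTop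
  have hα' : Tendsto (fun n => u (φ n) 0) atTop (𝓝 α) := hα.comp hφ₂.tendsto_atTop
  -- Extension by zero, so that primitives exist on the whole line as `IsH2` requires.
  set v : ℝ → ℝ := (Ioc (0:ℝ) 1).indicator v₀ with hv
  have hvi : Integrable v := by
    rw [hv, integrable_indicator_iff measurableSet_Ioc]
    exact hv₀.integrable (by norm_num)
  have hvi2 : Integrable (fun x => v x ^ 2) := by
    have : (fun x => v x ^ 2) = (Ioc (0:ℝ) 1).indicator (fun x => v₀ x ^ 2) := by
      ext x; simp only [hv, indicator]; split_ifs <;> simp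
    rw [this, integrable_indicator_iff measurableSet_Ioc]
    exact hv₀.integrable_sq
  have hve : ∀ x ∈ Ioc (0:ℝ) 1, v x = v₀ x := fun x hx => indicator_of_mem hx _
  have hvL : MemLp v 2 unitMeasure := hv₀.ae_eq (by
    filter_upwards [ae_restrict_mem measurableSet_Ioc] with x hx using (hve x hx).symm)
  have hlim : ∀ g : ℝ → ℝ, MemLp g 2 unitMeasure →
      Tendsto (fun n => ∫ x in (0:ℝ)..1, w (φ n) x * g x) atTop
        (𝓝 (∫ x in (0:ℝ)..1, v x * g x)) := by
    intro g hg
    have : ∫ x in (0:ℝ)..1, v x * g x = ∫ x in (0:ℝ)..1, v₀ x * g x :=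
      intervalIntegral.integral_congr_ae (ae_of_all _ fun x hx => by
        rw [uIoc_of_le zero_le_one] at hx; rw [hve x hx])
    rw [this]
    exact hlim₀ g hg
  have hU := IsH2.of_primitive (fun a b => hvi.intervalIntegrable (a := a) (b := b))
    (fun a b => hvi2.intervalIntegrable (a := a) (b := b)) 0 α 0
  set P : ℝ → ℝ := fun x => 0 + ∫ s in (0:ℝ)..x, v s with hP
  set U : ℝ → ℝ := fun x => α + ∫ t in (0:ℝ)..x, P t with hUdef
  have hP0 : P 0 = 0 := by simp [hP]
  have hU0 : U 0 = α := by simp [hUdef]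
  have hpb : ∀ n, ∀ x ∈ Icc (0:ℝ) 1, |p n x| ≤ Real.sqrt K := by
    intro n x hx
    have := (hH n).abs_sub_le (hw n) le_rfl hx.1 hx.2
    rw [hp0, sub_zero] at this
    refine this.trans (Real.sqrt_le_sqrt ?_)
    have := hx.2
    nlinarith
  have hub : ∀ n, ∀ x ∈ Icc (0:ℝ) 1, |u n x| ≤ K + Real.sqrt K := by
    intro n x hx
    have h1 : u n x = u n 0 + ∫ t in (0:ℝ)..x, p n t := by rw [(hH n).integral_snd]; ring
    have h2 : ‖∫ t in (0:ℝ)..x, p n t‖ ≤ Real.sqrt K * |x - 0| :=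
      intervalIntegral.norm_integral_le_of_norm_le_const fun y hy => by
        rw [uIoc_of_le hx.1] at hy
        exact hpb n y ⟨hy.1.le, hy.2.trans hx.2⟩
    rw [sub_zero, abs_of_nonneg hx.1, Real.norm_eq_abs] at h2
    rw [h1]
    refine (abs_add_le _ _).trans (add_le_add (hu n) (h2.trans ?_))
    exact mul_le_of_le_one_right (Real.sqrt_nonneg K) hx.2
  -- Testing weak convergence of w against the indicator of (0, x] gives pointwise convergence of
  -- the slopes.
  have hplim : ∀ x ∈ Icc (0:ℝ) 1, Tendsto (fun n => p (φ n) x) atTop (𝓝 (P x)) := by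
    intro x hx
    have key : ∀ f : ℝ → ℝ, ∫ t in (0:ℝ)..1, f t * (Ioc (0:ℝ) x).indicator 1 t =
        ∫ t in (0:ℝ)..x, f t := by
      intro f
      rw [intervalIntegral.integral_of_le zero_le_one, intervalIntegral.integral_of_le hx.1]
      have : (fun t => f t * (Ioc (0:ℝ) x).indicator 1 t) = (Ioc (0:ℝ) x).indicator f := by
        ext t; simp only [indicator]; split_ifs <;> simp
      rw [this, setIntegral_indicator measurableSet_Ioc,
        inter_eq_right.2 (Ioc_subset_Ioc_right hx.2)]
    have h1 := hlim ((Ioc (0:ℝ) x).indicator 1)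
      (memLp_indicator_const (μ := unitMeasure) 2 measurableSet_Ioc (1:ℝ)
        (Or.inr (measure_ne_top _ _)))
    simp only [key] at h1
    simp only [hP, zero_add]
    refine h1.congr fun n => ?_
    rw [(hH _).integral_eq, hp0, sub_zero]
  have hulim : ∀ x ∈ Icc (0:ℝ) 1, Tendsto (fun n => u (φ n) x) atTop (𝓝 (U x)) := by
    intro x hx
    have h1 : Tendsto (fun n => ∫ t in (0:ℝ)..x, p (φ n) t) atTop (𝓝 (∫ t in (0:ℝ)..x, P t)) := by
      refine intervalIntegral.tendsto_integral_filter_of_dominated_convergence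
        (fun _ => Real.sqrt K) (Eventually.of_forall fun n => ?_)
        (Eventually.of_forall fun n => ae_of_all _ fun t ht => ?_) intervalIntegrable_const
        (ae_of_all _ fun t ht => ?_)
      · exact (hH (φ n)).continuous_snd.aestronglyMeasurable
      · rw [uIoc_of_le hx.1] at ht
        exact hpb _ t ⟨ht.1.le, ht.2.trans hx.2⟩
      · rw [uIoc_of_le hx.1] at ht
        exact hplim t ⟨ht.1.le, ht.2.trans hx.2⟩
    refine (hα'.add h1).congr fun n => ?_
    rw [(hH _).integral_snd]; ring
  have hP1 : P 1 = 0 := by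
    have := hplim 1 ⟨zero_le_one, le_rfl⟩
    simp only [hp1] at this
    exact tendsto_nhds_unique this tendsto_const_nhds
  set B := K + Real.sqrt K with hB
  have hClim : Tendsto (fun n => ∫ x in (0:ℝ)..1, u (φ n) x ^ 4) atTop
      (𝓝 (∫ x in (0:ℝ)..1, U x ^ 4)) := by
    refine intervalIntegral.tendsto_integral_filter_of_dominated_convergence
      (fun _ => B ^ 4) (Eventually.of_forall fun n => ?_)
      (Eventually.of_forall fun n => ae_of_all _ fun t ht => ?_) intervalIntegrable_const
      (ae_of_all _ fun t ht => ?_)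
    · exact ((hH (φ n)).continuous_fst.pow 4).aestronglyMeasurable
    · rw [uIoc_of_le zero_le_one] at ht
      rw [norm_pow]
      exact pow_le_pow_left₀ (norm_nonneg _) (hub _ t ⟨ht.1.le, ht.2⟩) 4
    · rw [uIoc_of_le zero_le_one] at ht
      exact (hulim t ⟨ht.1.le, ht.2⟩).pow 4
  -- On arcs ∫w u² = -2∫u p², which no longer contains w; dominated convergence then suffices.
  have hDlim : Tendsto (fun n => ∫ x in (0:ℝ)..1, w (φ n) x * u (φ n) x ^ 2) atTop
      (𝓝 (∫ x in (0:ℝ)..1, v x * U x ^ 2)) := by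
    rw [hU.integral_mul_sq_of_arc hP0 hP1]
    simp only [fun n => (hH n).integral_mul_sq_of_arc (hp0 n) (hp1 n)]
    refine Tendsto.neg ?_
    refine intervalIntegral.tendsto_integral_filter_of_dominated_convergence
      (fun _ => 2 * B * Real.sqrt K ^ 2) (Eventually.of_forall fun n => ?_)
      (Eventually.of_forall fun n => ae_of_all _ fun t ht => ?_) intervalIntegrable_const
      (ae_of_all _ fun t ht => ?_)
    · have h1 := (hH (φ n)).continuous_fst
      have h2 := (hH (φ n)).continuous_snd
      exact Continuous.aestronglyMeasurable (by fun_prop)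
    · rw [uIoc_of_le zero_le_one] at ht
      have ht' : t ∈ Icc (0:ℝ) 1 := ⟨ht.1.le, ht.2⟩
      rw [norm_mul, norm_mul, norm_pow, Real.norm_eq_abs, Real.norm_eq_abs, Real.norm_eq_abs,
        abs_two]
      have := hub (φ n) t ht'
      have := hpb (φ n) t ht'
      gcongr
    · rw [uIoc_of_le zero_le_one] at ht
      have ht' : t ∈ Icc (0:ℝ) 1 := ⟨ht.1.le, ht.2⟩
      exact ((hulim t ht').const_mul 2).mul ((hplim t ht').pow 2)
  have hVlim := hlim v hvL
  -- Lower semicontinuity: w² is replaced by its minorant 2wv - v², which is affine in w and has the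
  -- limit v².
  have hlow : Tendsto (fun n => (2 * (∫ x in (0:ℝ)..1, w (φ n) x * v x) -
      ∫ x in (0:ℝ)..1, v x * v x) - (∫ x in (0:ℝ)..1, w (φ n) x * u (φ n) x ^ 2) +
      J * ∫ x in (0:ℝ)..1, u (φ n) x ^ 4) atTop (𝓝 (action J U v 0 1)) := by
    have h1 := (((hVlim.const_mul 2).sub_const (∫ x in (0:ℝ)..1, v x * v x)).sub hDlim).add
      (hClim.const_mul J)
    have h2 : (∫ x in (0:ℝ)..1, v x * v x) = ∫ x in (0:ℝ)..1, v x ^ 2 := by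
      simp only [pow_two]
    rw [hU.action_eq, ← h2]
    convert h1 using 2
    ring
  have hzero : Tendsto (fun n => 1 / ((φ n : ℝ) + 1)) atTop (𝓝 0) :=
    tendsto_one_div_add_atTop_nhds_zero_nat.comp hφt
  have hle : action J U v 0 1 ≤ 0 := by
    refine le_of_tendsto_of_tendsto' hlow hzero fun n => ?_
    refine le_trans ?_ (hact (φ n))
    rw [(hH (φ n)).action_eq]
    have hsq : ∀ x, w (φ n) x ^ 2 = 2 * (w (φ n) x * v x) - v x * v x + (w (φ n) x - v x) ^ 2 :=
      fun x => by ring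
    have i1 : IntervalIntegrable (fun x => w (φ n) x * v x) volume 0 1 := by
      rw [intervalIntegrable_iff_integrableOn_Ioc_of_le zero_le_one]
      exact (hH (φ n)).memLp_unit.integrable_mul hvL
    have i2 : IntervalIntegrable (fun x => v x * v x) volume 0 1 := by
      simpa only [← pow_two] using hvi2.intervalIntegrable (a := 0) (b := 1)
    have : 2 * (∫ x in (0:ℝ)..1, w (φ n) x * v x) - ∫ x in (0:ℝ)..1, v x * v x ≤
        ∫ x in (0:ℝ)..1, w (φ n) x ^ 2 := by
      rw [← intervalIntegral.integral_const_mul, ← intervalIntegral.integral_sub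
        (i1.const_mul 2) i2]
      refine intervalIntegral.integral_mono_on zero_le_one ((i1.const_mul 2).sub i2)
        ((hH (φ n)).sq_integrable 0 1) fun x _ => ?_
      rw [hsq]
      linarith [sq_nonneg (w (φ n) x - v x)]
    linarith
  refine ⟨U, P, v, hU, hP0, hP1, le_antisymm hle (hA U P v hU 0 1 zero_le_one hP0 hP1), ?_⟩
  have : K⁻¹ ≤ ∫ x in (0:ℝ)..1, U x ^ 4 := ge_of_tendsto' hClim fun n => hC (φ n)
  exact (inv_pos.2 hK).trans_le this

/-! ### Test functions and weak second derivatives -/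

lemma locallyIntegrable_of_intervalIntegrable {w : ℝ → ℝ}
    (h : ∀ a b, IntervalIntegrable w volume a b) : LocallyIntegrable w volume := by
  rw [locallyIntegrable_iff]
  intro k hk
  obtain ⟨R, hR⟩ := hk.isBounded.subset_closedBall 0
  have h1 : k ⊆ Ioc (-(|R| + 1)) (|R| + 1) := fun x hx => by
    have := hR hx
    rw [mem_closedBall_zero_iff, Real.norm_eq_abs] at this
    have := abs_le.1 (this.trans (le_abs_self R))
    exact ⟨by linarith, by linarith⟩
  have h2 : -(|R| + 1) ≤ |R| + 1 := by linarith [abs_nonneg R]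
  exact ((intervalIntegrable_iff_integrableOn_Ioc_of_le h2).1 (h _ _)).mono_set h1

/-- Smooth functions with compact support. -/
structure IsTest (φ : ℝ → ℝ) : Prop where
  smooth : ContDiff ℝ ∞ φ
  compact : HasCompactSupport φ

namespace IsTest

variable {φ : ℝ → ℝ}

lemma differentiable (h : IsTest φ) : Differentiable ℝ φ := h.smooth.differentiable (by simp)

lemma hasDerivAt (h : IsTest φ) (x : ℝ) : HasDerivAt φ (deriv φ x) x :=
  (h.differentiable x).hasDerivAt

lemma derivative (h : IsTest φ) : IsTest (deriv φ) :=
  ⟨(contDiff_infty_iff_deriv.1 h.smooth).2, h.compact.deriv⟩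

lemma continuous (h : IsTest φ) : Continuous φ := h.smooth.continuous

lemma exists_support (h : IsTest φ) : ∃ R > 0, ∀ x, R ≤ |x| → φ x = 0 := by
  obtain ⟨R, hR⟩ := h.compact.isCompact.isBounded.subset_closedBall 0
  refine ⟨max R 0 + 1, by positivity, fun x hx => ?_⟩
  by_contra hne
  have h1 := hR (subset_tsupport φ hne)
  rw [mem_closedBall_zero_iff, Real.norm_eq_abs] at h1
  linarith [le_max_left R 0]

lemma const_mul (h : IsTest φ) (c : ℝ) : IsTest (fun x => c * φ x) :=
  ⟨contDiff_const.mul h.smooth, h.compact.mul_left⟩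

lemma sub {ψ : ℝ → ℝ} (h : IsTest φ) (hψ : IsTest ψ) : IsTest (fun x => φ x - ψ x) :=
  ⟨h.smooth.sub hψ.smooth, h.compact.sub hψ.compact⟩

lemma integrable_mul {v : ℝ → ℝ} (h : IsTest φ) (hv : LocallyIntegrable v) :
    Integrable (fun x => v x * φ x) := by
  have := hv.integrable_smul_right_of_hasCompactSupport h.continuous h.compact
  simpa using this

end IsTest

lemma integral_eq_interval {f : ℝ → ℝ} {R : ℝ} (h : ∀ x, R ≤ |x| → f x = 0) :
    ∫ x, f x = ∫ x in (-R)..R, f x := by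
  refine (intervalIntegral.integral_eq_integral_of_support_subset fun x hx => ?_).symm
  have : |x| < R := by
    by_contra! hle
    exact hx (h x hle)
  rw [abs_lt] at this
  exact ⟨this.1, this.2.le⟩

lemma IsTest.exists_primitive {ψ : ℝ → ℝ} (h : IsTest ψ) (h0 : ∫ x, ψ x = 0) :
    ∃ Φ, IsTest Φ ∧ deriv Φ = ψ := by
  obtain ⟨R, hR, hsupp⟩ := h.exists_support
  set Φ : ℝ → ℝ := fun x => ∫ t in (-R)..x, ψ t with hΦ
  have hd : ∀ x, HasDerivAt Φ (ψ x) x := fun x =>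
    (h.continuous.integral_hasStrictDerivAt (-R) x).hasDerivAt
  have hderiv : deriv Φ = ψ := funext fun x => (hd x).deriv
  have hint : ∀ a b, IntervalIntegrable ψ volume a b := h.continuous.intervalIntegrable
  refine ⟨Φ, ⟨?_, ?_⟩, hderiv⟩
  · rw [contDiff_infty_iff_deriv, hderiv]
    exact ⟨fun x => (hd x).differentiableAt, h.smooth⟩
  · refine HasCompactSupport.of_support_subset_isCompact (isCompact_Icc (a := -R) (b := R)) ?_
    intro x hx
    by_contra hout
    apply hx
    rw [mem_Icc, not_and_or, not_le, not_le] at hout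
    rcases hout with hlt | hlt
    · refine (intervalIntegral.integral_congr_ae (ae_of_all _ fun t ht => ?_)).trans
        intervalIntegral.integral_zero
      rw [uIoc_of_ge hlt.le] at ht
      exact hsupp t (by rw [abs_of_nonpos (by linarith [ht.2])]; linarith [ht.2])
    · have h1 : ∫ t in R..x, ψ t = 0 := by
        refine (intervalIntegral.integral_congr_ae (ae_of_all _ fun t ht => ?_)).trans
          intervalIntegral.integral_zero
        rw [uIoc_of_le hlt.le] at ht
        exact hsupp t (by rw [abs_of_pos (by linarith [ht.1])]; linarith [ht.1])
      rw [integral_eq_interval hsupp] at h0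
      simp only [hΦ]
      rw [← intervalIntegral.integral_add_adjacent_intervals (hint (-R) R) (hint R x), h0, h1,
        add_zero]

lemma exists_unit_test : ∃ χ, IsTest χ ∧ ∫ x, χ x = 1 := by
  let f : ContDiffBump (0 : ℝ) := ⟨1, 2, one_pos, by norm_num⟩
  exact ⟨f.normed volume, ⟨f.contDiff_normed, f.hasCompactSupport_normed⟩, f.integral_normed⟩

/-- A test function has a compactly supported primitive exactly when its mean is zero; subtracting a
multiple of χ arranges this. -/
lemma IsTest.exists_primitive_sub {ψ χ : ℝ → ℝ} (h : IsTest ψ) (hχ : IsTest χ)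
    (h1 : ∫ x, χ x = 1) : ∃ Φ, IsTest Φ ∧ deriv Φ = fun x => ψ x - (∫ t, ψ t) * χ x := by
  refine (h.sub (hχ.const_mul _)).exists_primitive ?_
  rw [integral_sub (h.continuous.integrable_of_hasCompactSupport h.compact)
    ((hχ.continuous.integrable_of_hasCompactSupport hχ.compact).const_mul _),
    integral_const_mul, h1]
  ring

/-- The lemma of du Bois-Reymond. -/
lemma ae_eq_const_of_integral_mul_deriv {v : ℝ → ℝ} (hv : LocallyIntegrable v)
    (h : ∀ φ, IsTest φ → ∫ x, v x * deriv φ x = 0) : ∃ c, ∀ᵐ x, v x = c := by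
  obtain ⟨χ, hχ, hχ1⟩ := exists_unit_test
  set c := ∫ x, v x * χ x with hc
  refine ⟨c, ?_⟩
  have : ∀ᵐ x : ℝ, v x - c = 0 := by
    refine ae_eq_zero_of_integral_contDiff_smul_eq_zero
      (hv.sub (continuous_const.locallyIntegrable)) fun ψ h1 h2 => ?_
    have hψ : IsTest ψ := ⟨h1, h2⟩
    obtain ⟨Φ, hΦ, hΦ'⟩ := hψ.exists_primitive_sub hχ hχ1
    have h3 := h Φ hΦ
    rw [hΦ'] at h3
    have e1 : ∀ x, v x * (ψ x - (∫ t, ψ t) * χ x) = v x * ψ x - (∫ t, ψ t) * (v x * χ x) :=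
      fun x => by ring
    simp only [e1] at h3
    rw [integral_sub (hψ.integrable_mul hv) ((hχ.integrable_mul hv).const_mul _),
      integral_const_mul, ← hc] at h3
    have e2 : ∀ x, ψ x • (v x - c) = v x * ψ x - c * ψ x := fun x => by
      rw [smul_eq_mul]; ring
    simp only [e2]
    rw [integral_sub (hψ.integrable_mul hv)
      ((hψ.continuous.integrable_of_hasCompactSupport h2).const_mul _), integral_const_mul]
    linarith
  filter_upwards [this] with x hx
  linarith

/-- Two integrations by parts. As `w` is only locally L², the second uses the absolutely continuous
version `integral_pow_mul` with n = 0. -/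
lemma IsH2.hasWeakSecondDeriv {u p w : ℝ → ℝ} (h : IsH2 u p w) : HasWeakSecondDeriv u w := by
  intro φ h1 h2
  have hφ : IsTest φ := ⟨h1, h2⟩
  have hφ' := hφ.derivative
  have hφ'' := hφ'.derivative
  have e2 : iteratedDeriv 2 φ = deriv (deriv φ) := by
    rw [iteratedDeriv_succ, iteratedDeriv_one]
  obtain ⟨R₁, hR₁, hs₁⟩ := hφ.exists_support
  obtain ⟨R₂, hR₂, hs₂⟩ := hφ'.exists_support
  obtain ⟨R₃, hR₃, hs₃⟩ := hφ''.exists_support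
  set R := max R₁ (max R₂ R₃) with hR
  have t1 : ∀ x, R ≤ |x| → φ x = 0 := fun x hx => hs₁ x ((le_max_left _ _).trans hx)
  have t2 : ∀ x, R ≤ |x| → deriv φ x = 0 := fun x hx =>
    hs₂ x (((le_max_left _ _).trans (le_max_right _ _)).trans hx)
  have t3 : ∀ x, R ≤ |x| → deriv (deriv φ) x = 0 := fun x hx =>
    hs₃ x (((le_max_right _ _).trans (le_max_right _ _)).trans hx)
  have hR0 : 0 < R := lt_max_of_lt_left hR₁
  have r1 : R ≤ |R| := le_abs_self R
  have r2 : R ≤ |-R| := by rw [abs_neg]; exact r1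
  rw [e2, integral_eq_interval (f := fun x => u x * deriv (deriv φ) x) (R := R)
    (fun x hx => by simp [t3 x hx]), integral_eq_interval (f := fun x => w x * φ x) (R := R)
    (fun x hx => by simp [t1 x hx]),
    intervalIntegral.integral_mul_deriv_eq_deriv_mul (fun x _ => h.hasDerivAt x)
      (fun x _ => hφ'.hasDerivAt x) (h.continuous_snd.intervalIntegrable _ _)
      (hφ''.continuous.intervalIntegrable _ _), t2 R r1, t2 (-R) r2]
  have e := h.integral_pow_mul (a := -R) (b := R) 0 (fun x _ => hφ.hasDerivAt x)
    hφ'.continuous.continuousOn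
  simp only [Nat.cast_zero, zero_add, pow_zero, one_mul, pow_one] at e
  have i2 : IntervalIntegrable (fun x => p x * deriv φ x) volume (-R) R :=
    (h.continuous_snd.mul hφ'.continuous).intervalIntegrable _ _
  rw [intervalIntegral.integral_add (h.mul_integrable hφ.continuous _ _) i2, t1 R r1,
    t1 (-R) r2] at e
  linarith

/-- Functions with a weak second derivative in `L²_loc` are of class `H²_loc`. -/
lemma exists_isH2_of_weak {g w : ℝ → ℝ} (hg : LocallyIntegrable g)
    (hw : ∀ a b, IntervalIntegrable w volume a b)
    (hw2 : ∀ a b, IntervalIntegrable (fun x => w x ^ 2) volume a b)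
    (h : HasWeakSecondDeriv g w) : ∃ G R, IsH2 G R w ∧ g =ᵐ[volume] G := by
  -- After subtraction of a double primitive of `w`, the remainder v has zero weak second derivative
  -- and must be affine.
  have h0 := IsH2.of_primitive hw hw2 0 0 0
  set G₀ : ℝ → ℝ := fun x => 0 + ∫ t in (0:ℝ)..x, (0 + ∫ s in (0:ℝ)..t, w s)
  set R₀ : ℝ → ℝ := fun x => 0 + ∫ s in (0:ℝ)..x, w s
  set v : ℝ → ℝ := fun x => g x - G₀ x with hv
  have hvl : LocallyIntegrable v := hg.sub h0.continuous_fst.locallyIntegrable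
  have hv0 : ∀ φ, IsTest φ → ∫ x, v x * deriv (deriv φ) x = 0 := by
    intro φ hφ
    have e2 : iteratedDeriv 2 φ = deriv (deriv φ) := by
      rw [iteratedDeriv_succ, iteratedDeriv_one]
    have h1 := h φ hφ.smooth hφ.compact
    have h2 := h0.hasWeakSecondDeriv φ hφ.smooth hφ.compact
    rw [e2] at h1 h2
    simp only [hv, sub_mul]
    rw [integral_sub (hφ.derivative.derivative.integrable_mul hg)
      (hφ.derivative.derivative.integrable_mul h0.continuous_fst.locallyIntegrable), h1, h2, sub_self]
  obtain ⟨χ, hχ, hχ1⟩ := exists_unit_test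
  -- Since ∫χ = 1, an affine v has slope -β; thus v + βx is the candidate for a constant.
  set β := ∫ x, v x * deriv χ x with hβ
  obtain ⟨c, hc⟩ := ae_eq_const_of_integral_mul_deriv (v := fun x => v x + β * x)
    (hvl.add (Continuous.locallyIntegrable (by fun_prop))) fun ψ hψ => by
    obtain ⟨Φ, hΦ, hΦ'⟩ := hψ.exists_primitive_sub hχ hχ1
    have h3 := hv0 Φ hΦ
    have h4 : deriv (deriv Φ) = fun x => deriv ψ x - (∫ t, ψ t) * deriv χ x := by
      rw [hΦ']; ext x
      exact ((hψ.hasDerivAt x).sub ((hχ.hasDerivAt x).const_mul _)).deriv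
    rw [h4] at h3
    have e1 : ∀ x, v x * (deriv ψ x - (∫ t, ψ t) * deriv χ x) =
      v x * deriv ψ x - (∫ t, ψ t) * (v x * deriv χ x) := fun x => by ring
    simp only [e1] at h3
    rw [integral_sub (hψ.derivative.integrable_mul hvl) ((hχ.derivative.integrable_mul hvl).const_mul _),
      integral_const_mul, ← hβ] at h3
    have h5 : ∫ x, x * deriv ψ x = -∫ x, ψ x := by
      have := integral_mul_deriv_eq_deriv_mul_of_integrable (u := fun x : ℝ => x) (v := ψ)
        (u' := fun _ => 1) (v' := deriv ψ) (fun x _ => hasDerivAt_id x)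
        (fun x _ => hψ.hasDerivAt x)
        (hψ.derivative.integrable_mul continuous_id.locallyIntegrable)
        (hψ.integrable_mul continuous_const.locallyIntegrable)
        (hψ.integrable_mul continuous_id.locallyIntegrable)
      simpa using this
    have e2 : ∀ x, (v x + β * x) * deriv ψ x = v x * deriv ψ x + β * (x * deriv ψ x) :=
      fun x => by ring
    simp only [e2]
    have hid : LocallyIntegrable (fun x : ℝ => x) volume := continuous_id.locallyIntegrable
    rw [integral_add (hψ.derivative.integrable_mul hvl) ((hψ.derivative.integrable_mul hid).const_mul _),
      integral_const_mul, h5]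
    linarith
  have hlin : IsH2 (fun x => c - β * x) (fun _ => -β) (fun _ => 0) :=
    .of_hasDerivAt (fun x => by simpa using ((hasDerivAt_id x).const_mul β).const_sub c)
      (fun x => hasDerivAt_const x _) continuous_const
  refine ⟨_, _, by simpa using h0.add hlin continuous_const, ?_⟩
  filter_upwards [hc] with x hx
  simp only [hv] at hx
  linarith

/-! ### The Euler-Lagrange equation as an ODE -/

/-- Solutions of the Euler-Lagrange equation, as a first order system. -/
structure IsSol (J : ℝ) (u p q r : ℝ → ℝ) : Prop where
  fst : ∀ x, HasDerivAt u (p x) x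
  snd : ∀ x, HasDerivAt p (q x + u x ^ 2 / 2) x
  thd : ∀ x, HasDerivAt q (r x) x
  fth : ∀ x, HasDerivAt r ((q x + u x ^ 2 / 2) * u x - 2 * J * u x ^ 3) x

lemma hasDerivAt_of_primitive {p w v : ℝ → ℝ} (h : ∀ a b, ∫ x in a..b, w x = p b - p a)
    (hv : Continuous v) (hwv : w =ᵐ[volume] v) (x : ℝ) : HasDerivAt p (v x) x := by
  have : p = fun x => p 0 + ∫ t in (0:ℝ)..x, v t := by
    ext y
    rw [← intervalIntegral.integral_congr_ae (f := w) (by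
      filter_upwards [hwv] with x hx _ using hx), h]
    ring
  rw [this]
  exact (hv.integral_hasStrictDerivAt 0 x).hasDerivAt.const_add _

/-- The weak equation prescribes the second derivative of 2w - u² by a locally L² function, so q = w
- u²/2 has an H² representative. This makes w continuous up to null sets, and the system then holds
classically. -/
lemma IsH2.exists_isSol {J : ℝ} {u p w : ℝ → ℝ} (h : IsH2 u p w)
    (hEL : HasWeakSecondDeriv (fun x => 2 * w x - u x ^ 2)
      (fun x => 2 * w x * u x - 4 * J * u x ^ 3)) :
    ∃ q r, IsSol J u p q r ∧ w =ᵐ[volume] fun x => q x + u x ^ 2 / 2 := by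
  have huc := h.continuous_fst
  have hwl := locallyIntegrable_of_intervalIntegrable h.integrable
  have hgl : LocallyIntegrable (fun x => 2 * w x - u x ^ 2) volume :=
    (hwl.smul (2 : ℝ)).sub (huc.pow 2).locallyIntegrable
  obtain ⟨G, R, hG, hae⟩ := exists_isH2_of_weak hgl
    (fun a b => by
      refine (((h.mul_integrable huc a b).const_mul 2).sub
        ((by fun_prop : Continuous fun x => 4 * J * u x ^ 3).intervalIntegrable a b)).congr ?_
      intro x _; simp only; ring)
    (fun a b => by
      have i1 := ((h.sq_integrable a b).mul_continuousOn (g := fun x => 4 * u x ^ 2)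
        (by fun_prop))
      have i2 := h.mul_integrable (f := fun x => 16 * J * u x ^ 4) (by fun_prop) a b
      have i3 : IntervalIntegrable (fun x => 16 * J ^ 2 * u x ^ 6) volume a b :=
        Continuous.intervalIntegrable (by fun_prop) _ _
      refine ((i1.sub i2).add i3).congr ?_
      intro x _; simp only; ring) hEL
  have hw : w =ᵐ[volume] fun x => G x / 2 + u x ^ 2 / 2 := by
    filter_upwards [hae] with x hx
    linarith
  refine ⟨fun x => G x / 2, fun x => R x / 2, ⟨h.hasDerivAt, ?_, ?_, ?_⟩, hw⟩
  · have hGc := hG.continuous_fst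
    exact hasDerivAt_of_primitive h.integral_eq (by fun_prop) hw
  · exact fun x => (hG.hasDerivAt x).div_const 2
  · intro x
    have hGc := hG.continuous_fst
    have := (hasDerivAt_of_primitive hG.integral_eq
      (v := fun x => 2 * (G x / 2 + u x ^ 2 / 2) * u x - 4 * J * u x ^ 3) (by fun_prop)
      (by filter_upwards [hw] with x hx; rw [hx]) x).div_const 2
    refine this.congr_deriv ?_
    ring

lemma IsSol.unique {J : ℝ} {u p q r u' p' q' r' : ℝ → ℝ} (h : IsSol J u p q r)
    (h' : IsSol J u' p' q' r') {t₀ : ℝ} (hu : u t₀ = u' t₀) (hp : p t₀ = p' t₀)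
    (hq : q t₀ = q' t₀) (hr : r t₀ = r' t₀) : u = u' := by
  set V : ℝ × ℝ × ℝ × ℝ → ℝ × ℝ × ℝ × ℝ := fun y =>
    (y.2.1, y.2.2.1 + y.1 ^ 2 / 2, y.2.2.2, (y.2.2.1 + y.1 ^ 2 / 2) * y.1 - 2 * J * y.1 ^ 3)
    with hV
  have hVc : ContDiff ℝ 1 V := by rw [hV]; fun_prop
  set f : ℝ → ℝ × ℝ × ℝ × ℝ := fun x => (u x, p x, q x, r x) with hf
  set g : ℝ → ℝ × ℝ × ℝ × ℝ := fun x => (u' x, p' x, q' x, r' x) with hg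
  have hfd : ∀ x, HasDerivAt f (V (f x)) x := fun x =>
    (h.fst x).prodMk ((h.snd x).prodMk ((h.thd x).prodMk (h.fth x)))
  have hgd : ∀ x, HasDerivAt g (V (g x)) x := fun x =>
    (h'.fst x).prodMk ((h'.snd x).prodMk ((h'.thd x).prodMk (h'.fth x)))
  have hfc : Continuous f := continuous_iff_continuousAt.2 fun x => (hfd x).continuousAt
  have hgc : Continuous g := continuous_iff_continuousAt.2 fun x => (hgd x).continuousAt
  have heq : f t₀ = g t₀ := by simp [hf, hg, hu, hp, hq, hr]
  ext x
  set a := min x t₀ - 1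
  set b := max x t₀ + 1
  have hxa : a < x := by linarith [min_le_left x t₀]
  have hta : a < t₀ := by linarith [min_le_right x t₀]
  have hxb : x < b := by linarith [le_max_left x t₀]
  have htb : t₀ < b := by linarith [le_max_right x t₀]
  obtain ⟨B₁, hB₁⟩ := isCompact_Icc.exists_bound_of_continuousOn (s := Icc a b) hfc.continuousOn
  obtain ⟨B₂, hB₂⟩ := isCompact_Icc.exists_bound_of_continuousOn (s := Icc a b) hgc.continuousOn
  set s : Set (ℝ × ℝ × ℝ × ℝ) := Metric.closedBall 0 (max B₁ B₂) with hs
  obtain ⟨K, hK⟩ := (hVc.locallyLipschitz.locallyLipschitzOn (s := s)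
    ).exists_lipschitzOnWith_of_compact (isCompact_closedBall _ _)
  have := ODE_solution_unique_of_mem_Icc (v := fun _ => V) (s := fun _ => s) (a := a) (b := b)
    (fun t _ => hK) ⟨hta, htb⟩ hfc.continuousOn (fun t _ => hfd t)
    (fun t ht => by
      rw [hs, mem_closedBall_zero_iff]
      exact (hB₁ t (Ioo_subset_Icc_self ht)).trans (le_max_left _ _))
    hgc.continuousOn (fun t _ => hgd t)
    (fun t ht => by
      rw [hs, mem_closedBall_zero_iff]
      exact (hB₂ t (Ioo_subset_Icc_self ht)).trans (le_max_right _ _)) heq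
    ⟨hxa.le, hxb.le⟩
  exact congrArg Prod.fst this

/-- Two solutions which agree on an open interval agree everywhere. -/
lemma IsSol.unique_of_eqOn {J : ℝ} {u p q r u' p' q' r' : ℝ → ℝ} (h : IsSol J u p q r)
    (h' : IsSol J u' p' q' r') {s : Set ℝ} (hs : IsOpen s) (hne : s.Nonempty)
    (heq : EqOn u u' s) : u = u' := by
  obtain ⟨t, ht⟩ := hne
  have step : ∀ {f g f' g' : ℝ → ℝ}, (∀ x, HasDerivAt f (f' x) x) → (∀ x, HasDerivAt g (g' x) x) →
      EqOn f g s → EqOn f' g' s := by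
    intro f g f' g' hf hg hfg x hx
    have : f =ᶠ[𝓝 x] g := hfg.eventuallyEq_of_mem (hs.mem_nhds hx)
    exact ((hf x).congr_of_eventuallyEq this.symm).unique (hg x)
  have e1 := step h.fst h'.fst heq
  have e2 : EqOn q q' s := fun x hx => by
    have := step h.snd h'.snd e1 hx
    simp only [heq hx] at this
    linarith
  have e3 := step h.thd h'.thd e2
  exact h.unique h' (heq ht) (e1 ht) (e2 ht) (e3 ht)

lemma IsSol.contDiff {J : ℝ} {u p q r : ℝ → ℝ} (h : IsSol J u p q r) : ContDiff ℝ ∞ u := by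
  have key : ∀ n : ℕ, ContDiff ℝ n u ∧ ContDiff ℝ n p ∧ ContDiff ℝ n q ∧ ContDiff ℝ n r := by
    intro n
    induction n with
    | zero =>
      simp only [Nat.cast_zero, contDiff_zero]
      exact ⟨continuous_iff_continuousAt.2 fun x => (h.fst x).continuousAt,
        continuous_iff_continuousAt.2 fun x => (h.snd x).continuousAt,
        continuous_iff_continuousAt.2 fun x => (h.thd x).continuousAt,
        continuous_iff_continuousAt.2 fun x => (h.fth x).continuousAt⟩
    | succ n ih =>
      obtain ⟨hu, hp, hq, hr⟩ := ih
      have step : ∀ {f f' : ℝ → ℝ}, (∀ x, HasDerivAt f (f' x) x) → ContDiff ℝ n f' →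
          ContDiff ℝ (n + 1 : ℕ) f := by
        intro f f' hf hf'
        rw [Nat.cast_add, Nat.cast_one, contDiff_succ_iff_deriv]
        refine ⟨fun x => (hf x).differentiableAt, by simp, ?_⟩
        rwa [funext fun x => (hf x).deriv]
      exact ⟨step h.fst hp, step h.snd (by fun_prop), step h.thd hr, step h.fth (by fun_prop)⟩
  exact contDiff_infty.2 fun n => (key n).1

/-! ### Minimality under local perturbations and unique continuation -/

lemma action_self (J : ℝ) (u w : ℝ → ℝ) (a : ℝ) : action J u w a a = 0 :=
  intervalIntegral.integral_same

/-- Rolle gives a point where `p` vanishes. Starting the loop there, by joining a translate at the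
closing point, turns it into an arc with the same action. -/
lemma ArcNonneg.loop {J : ℝ} (hJ : ArcNonneg J) {u p w : ℝ → ℝ} (h : IsH2 u p w) {a b : ℝ}
    (hab : a ≤ b) (hu : u a = u b) (hp : p a = p b) : 0 ≤ action J u w a b := by
  rcases hab.eq_or_lt with rfl | hlt
  · rw [action_self]
  obtain ⟨c, hc, hpc⟩ := exists_hasDerivAt_eq_zero hlt h.continuous_fst.continuousOn hu
    fun x _ => h.hasDerivAt x
  have hs := h.shift (-(b - a))
  have e1 : b + -(b - a) = a := by ring
  have e2 : c + (b - a) + -(b - a) = c := by ring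
  have hj := h.join hs (c := b) (by rw [e1, hu]) (by rw [e1, hp])
  have h0 := hJ _ _ _ hj c (c + (b - a)) (by linarith) (by rw [join_of_le hc.2.le, hpc])
    (by rw [join_of_lt (by linarith [hc.1]), e2, hpc])
  rw [← hj.action_add J c b, action_congr (u' := u) (w' := w) hc.2.le
    (fun x hx => join_of_le hx.2.le) (fun x hx => join_of_le hx.2.le),
    action_congr (a := b) (by linarith [hc.1]) (fun x hx => join_of_lt hx.1)
      (fun x hx => join_of_lt hx.1), action_shift, e1, e2, add_comm, h.action_add] at h0
  exact h0

/-- Support control for a test function and its first two derivatives. -/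
def VanishesOutside (R : ℝ) (φ : ℝ → ℝ) : Prop :=
  ∀ x, R ≤ |x| → φ x = 0 ∧ deriv φ x = 0 ∧ deriv (deriv φ) x = 0

lemma IsTest.exists_vanishesOutside {φ : ℝ → ℝ} (hφ : IsTest φ) :
    ∃ R > 0, VanishesOutside R φ := by
  obtain ⟨R₁, hR₁, hs₁⟩ := hφ.exists_support
  obtain ⟨R₂, hR₂, hs₂⟩ := hφ.derivative.exists_support
  obtain ⟨R₃, hR₃, hs₃⟩ := hφ.derivative.derivative.exists_support
  refine ⟨max R₁ (max R₂ R₃), lt_max_of_lt_left hR₁, fun x hx => ?_⟩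
  simp only [max_le_iff] at hx
  exact ⟨hs₁ x hx.1, hs₂ x hx.2.1, hs₃ x hx.2.2⟩

lemma IsTest.isH2 {φ : ℝ → ℝ} (hφ : IsTest φ) : IsH2 φ (deriv φ) (deriv (deriv φ)) :=
  .of_hasDerivAt hφ.hasDerivAt hφ.derivative.hasDerivAt hφ.derivative.derivative.continuous

/-- Minimality with respect to compactly supported perturbations, up to small errors on
large intervals. -/
def IsMinimal (J : ℝ) (z w : ℝ → ℝ) : Prop :=
  ∀ φ, IsTest φ → ∀ R > 0, VanishesOutside R φ → ∀ ε > 0, ∃ a b, a ≤ -R ∧ R ≤ b ∧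
    action J z w a b ≤ ε ∧
    -ε ≤ action J (fun x => z x + φ x) (fun x => w x + deriv (deriv φ) x) a b

/-- The change of action along z + tφ is exactly a quartic polynomial in t without constant term.
Letting ε tend to 0, minimality makes it nonnegative for all t, so its linear coefficient, the first
variation, vanishes. -/
lemma IsMinimal.weak {J : ℝ} {z p w : ℝ → ℝ} (h : IsH2 z p w) (hmin : IsMinimal J z w) :
    HasWeakSecondDeriv (fun x => 2 * w x - z x ^ 2) (fun x => 2 * w x * z x - 4 * J * z x ^ 3) := by
  intro φ hφ1 hφ2
  have hφ : IsTest φ := ⟨hφ1, hφ2⟩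
  have e2 : iteratedDeriv 2 φ = deriv (deriv φ) := by rw [iteratedDeriv_succ, iteratedDeriv_one]
  rw [e2]
  obtain ⟨R, hR, hv⟩ := hφ.exists_vanishesOutside
  have hz := h.continuous_fst
  have hc := hφ.continuous
  set ψ := deriv (deriv φ) with hψ
  have hcψ : Continuous ψ := hφ.derivative.derivative.continuous
  rw [integral_eq_interval (R := R) (fun x hx => mul_eq_zero_of_right _ (hv x hx).2.2),
    integral_eq_interval (R := R) (fun x hx => mul_eq_zero_of_right _ (hv x hx).1), ← sub_eq_zero]
  have iw : ∀ f : ℝ → ℝ, Continuous f → IntervalIntegrable (fun x => w x * f x) volume (-R) R :=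
    fun f hf => h.mul_integrable hf _ _
  have ic : ∀ f : ℝ → ℝ, Continuous f → IntervalIntegrable f volume (-R) R :=
    fun f hf => hf.intervalIntegrable _ _
  set c₁ : ℝ → ℝ := fun x => w x * (2 * ψ x - 2 * z x * φ x) +
    (-ψ x * z x ^ 2 + 4 * J * z x ^ 3 * φ x) with hc₁
  set c₂ : ℝ → ℝ := fun x => w x * (-φ x ^ 2) +
    (ψ x ^ 2 - 2 * z x * φ x * ψ x + 6 * J * z x ^ 2 * φ x ^ 2) with hc₂
  set c₃ : ℝ → ℝ := fun x => -ψ x * φ x ^ 2 + 4 * J * z x * φ x ^ 3 with hc₃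
  set c₄ : ℝ → ℝ := fun x => J * φ x ^ 4 with hc₄
  have i₁ : IntervalIntegrable c₁ volume (-R) R := (iw _ (by fun_prop)).add (ic _ (by fun_prop))
  have i₂ : IntervalIntegrable c₂ volume (-R) R := (iw _ (by fun_prop)).add (ic _ (by fun_prop))
  have i₃ : IntervalIntegrable c₃ volume (-R) R := ic _ (by fun_prop)
  have i₄ : IntervalIntegrable c₄ volume (-R) R := ic _ (by fun_prop)
  have hlhs : (∫ x in (-R)..R, (2 * w x - z x ^ 2) * ψ x) -
      ∫ x in (-R)..R, (2 * w x * z x - 4 * J * z x ^ 3) * φ x = ∫ x in (-R)..R, c₁ x := by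
    rw [← intervalIntegral.integral_sub]
    · congr 1; ext x; simp only [hc₁]; ring
    · refine ((iw (fun x => 2 * ψ x) (by fun_prop)).sub
        (ic (fun x => z x ^ 2 * ψ x) (by fun_prop))).congr ?_
      intro x _; simp only; ring
    · refine ((iw (fun x => 2 * z x * φ x) (by fun_prop)).sub
        (ic (fun x => 4 * J * z x ^ 3 * φ x) (by fun_prop))).congr ?_
      intro x _; simp only; ring
  rw [hlhs]
  set C₁ := ∫ x in (-R)..R, c₁ x
  set C₂ := ∫ x in (-R)..R, c₂ x with hC₂
  set C₃ := ∫ x in (-R)..R, c₃ x with hC₃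
  set C₄ := ∫ x in (-R)..R, c₄ x with hC₄
  have key : ∀ t : ℝ, 0 ≤ t * C₁ + t ^ 2 * C₂ + t ^ 3 * C₃ + t ^ 4 * C₄ := by
    intro t
    have htφ := hφ.const_mul t
    have hd1 : deriv (fun x => t * φ x) = fun x => t * deriv φ x :=
      funext fun x => ((hφ.hasDerivAt x).const_mul t).deriv
    have hd2 : deriv (deriv (fun x => t * φ x)) = fun x => t * ψ x := by
      rw [hd1]; exact funext fun x => ((hφ.derivative.hasDerivAt x).const_mul t).deriv
    have htv : VanishesOutside R (fun x => t * φ x) := fun x hx => by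
      obtain ⟨h1, h2, h3⟩ := hv x hx
      rw [← hψ] at h3
      rw [hd2, hd1]
      simp only [h1, h2, h3, mul_zero, and_self]
    have hH := h.add htφ.isH2 htφ.derivative.derivative.continuous
    have hexp : action J (fun x => z x + t * φ x) (fun x => w x + t * ψ x) (-R) R =
        action J z w (-R) R + (t * C₁ + t ^ 2 * C₂ + t ^ 3 * C₃ + t ^ 4 * C₄) := by
      rw [hC₂, hC₃, hC₄, ← intervalIntegral.integral_const_mul,
        ← intervalIntegral.integral_const_mul, ← intervalIntegral.integral_const_mul,
        ← intervalIntegral.integral_const_mul,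
        ← intervalIntegral.integral_add (i₁.const_mul t) (i₂.const_mul (t ^ 2)),
        ← intervalIntegral.integral_add ((i₁.const_mul t).add (i₂.const_mul (t ^ 2)))
          (i₃.const_mul (t ^ 3)),
        ← intervalIntegral.integral_add (((i₁.const_mul t).add (i₂.const_mul (t ^ 2))).add
          (i₃.const_mul (t ^ 3))) (i₄.const_mul (t ^ 4))]
      unfold action
      rw [← intervalIntegral.integral_add (h.lag_integrable J _ _)
        ((((i₁.const_mul t).add (i₂.const_mul (t ^ 2))).add (i₃.const_mul (t ^ 3))).add
          (i₄.const_mul (t ^ 4)))]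
      congr 1; ext x
      simp only [hc₁, hc₂, hc₃, hc₄]
      ring
    refine le_of_forall_pos_le_add fun ε hε => ?_
    obtain ⟨a, b, ha, hb, h1, h2⟩ := hmin _ htφ R hR htv (ε / 2) (half_pos hε)
    have hout : ∀ c d, (c ≤ d) → (∀ x ∈ Ioo c d, R ≤ |x|) →
        action J (fun x => z x + t * φ x) (fun x => w x + deriv (deriv fun x => t * φ x) x) c d =
          action J z w c d := fun c d hcd hx =>
      action_congr hcd (fun x hxx => add_eq_left.2 (htv x (hx x hxx)).1)
        (fun x hxx => add_eq_left.2 (htv x (hx x hxx)).2.2)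
    have s1 := h.action_add J a (-R) R
    have s2 := h.action_add J a R b
    have s3 := hH.action_add J a (-R) R
    have s4 := hH.action_add J a R b
    rw [hout a (-R) ha fun x hx => by rw [abs_of_neg (by linarith [hx.2])]; linarith [hx.2]] at s3
    rw [hout R b hb fun x hx => by rw [abs_of_pos (by linarith [hx.1])]; linarith [hx.1]] at s4
    have s5 : action J (fun x => z x + t * φ x)
      (fun x => w x + deriv (deriv fun x => t * φ x) x) (-R) R =
        action J z w (-R) R + (t * C₁ + t ^ 2 * C₂ + t ^ 3 * C₃ + t ^ 4 * C₄) := by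
      rw [hd2]; exact hexp
    linarith
  have hder : HasDerivAt (fun t : ℝ => t * C₁ + t ^ 2 * C₂ + t ^ 3 * C₃ + t ^ 4 * C₄) C₁ 0 := by
    have h1 := (((hasDerivAt_id (0:ℝ)).mul_const C₁).add
      (((hasDerivAt_id (0:ℝ)).pow 2).mul_const C₂)).add
      (((hasDerivAt_id (0:ℝ)).pow 3).mul_const C₃) |>.add
      (((hasDerivAt_id (0:ℝ)).pow 4).mul_const C₄)
    refine h1.congr_deriv ?_
    simp
  have hloc : IsLocalMin (fun t : ℝ => t * C₁ + t ^ 2 * C₂ + t ^ 3 * C₃ + t ^ 4 * C₄) 0 :=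
    Eventually.of_forall fun t => by simpa using key t
  exact hloc.hasDerivAt_eq_zero hder

lemma IsMinimal.exists_isSol {J : ℝ} {z p w : ℝ → ℝ} (h : IsH2 z p w) (hmin : IsMinimal J z w) :
    ∃ q r, IsSol J z p q r ∧ w =ᵐ[volume] fun x => q x + z x ^ 2 / 2 :=
  h.exists_isSol (hmin.weak h)

/-- Unique continuation through a minimal junction. -/
lemma eq_of_isMinimal_join {J : ℝ} {u₁ p₁ w₁ u₂ p₂ w₂ q₁ r₁ q₂ r₂ : ℝ → ℝ}
    (h₁ : IsH2 u₁ p₁ w₁) (h₂ : IsH2 u₂ p₂ w₂) (hs₁ : IsSol J u₁ p₁ q₁ r₁)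
    (hs₂ : IsSol J u₂ p₂ q₂ r₂) {c : ℝ} (hu : u₁ c = u₂ c) (hp : p₁ c = p₂ c)
    (hmin : IsMinimal J (join c u₁ u₂) (join c w₁ w₂)) : u₁ = u₂ := by
  obtain ⟨q, r, hs, -⟩ := hmin.exists_isSol (h₁.join h₂ hu hp)
  -- The joined function is a single solution agreeing with each piece on a half line, hence equal
  -- to both everywhere.
  have e1 := hs.unique_of_eqOn hs₁ isOpen_Iio nonempty_Iio
    fun x (hx : x < c) => join_of_le hx.le
  have e2 := hs.unique_of_eqOn hs₂ isOpen_Ioi nonempty_Ioi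
    fun x (hx : c < x) => join_of_lt hx
  rw [← e1, e2]

/-! ### Periodic minimizers: regularity and uniqueness up to scaling -/

lemma integral_pow_pos {u : ℝ → ℝ} (hu : Continuous u) {T : ℝ} (hT : 0 < T)
    (hper : Function.Periodic u T) (hne : u ≠ 0) {n : ℕ} (hn : Even n) (x : ℝ) :
    0 < ∫ t in x..(x + T), u t ^ n := by
  have hper : Function.Periodic (fun x => u x ^ n) T := fun x => by simp only [hper x]
  obtain ⟨y, hy⟩ := Function.ne_iff.1 hne
  rw [hper.intervalIntegral_add_eq x y]
  exact intervalIntegral.integral_pos (by linarith) (hu.pow n).continuousOn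
    (fun t _ => hn.pow_nonneg _) ⟨y, ⟨le_rfl, by linarith⟩, hn.pow_pos hy⟩

/-- Periodic functions realising equality. -/
structure IsPeriodicMin (J T : ℝ) (u p w : ℝ → ℝ) : Prop extends IsH2 u p w where
  pos : 0 < T
  periodic_fst : Function.Periodic u T
  periodic_snd : Function.Periodic p T
  periodic_thd : Function.Periodic w T
  action_zero : action J u w 0 T = 0

namespace IsPeriodicMin

variable {J T T₁ T₂ : ℝ} {u p w u₁ p₁ w₁ u₂ p₂ w₂ : ℝ → ℝ}

lemma lag_periodic (h : IsPeriodicMin J T u p w) :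
    Function.Periodic (fun x => w x ^ 2 - w x * u x ^ 2 + J * u x ^ 4) T := fun x => by
  simp only [h.periodic_fst x, h.periodic_thd x]

lemma action_period (h : IsPeriodicMin J T u p w) (x : ℝ) : action J u w x (x + T) = 0 := by
  have := h.lag_periodic.intervalIntegral_add_eq x 0
  rw [zero_add] at this
  exact this.trans h.action_zero

lemma action_nat_mul (h : IsPeriodicMin J T u p w) (x : ℝ) (n : ℕ) :
    action J u w x (x + n * T) = 0 := by
  induction n with
  | zero => simp [action_self]
  | succ n ih =>
    have h1 := h.action_add J x (x + n * T) (x + n * T + T)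
    rw [ih, h.action_period, add_zero] at h1
    rw [show x + (n + 1 : ℕ) * T = x + n * T + T by push_cast; ring, ← h1]

lemma scale (h : IsPeriodicMin J T u p w) {l : ℝ} (hl : 0 < l) (τ : ℝ) :
    IsPeriodicMin J (T / l) (fun x => l ^ 2 * u (l * x + τ)) (fun x => l ^ 3 * p (l * x + τ))
      (fun x => l ^ 4 * w (l * x + τ)) := by
  have e : ∀ x, l * (x + T / l) + τ = l * x + τ + T := fun x => by field_simp; ring
  exact
  { h.toIsH2.scale hl.ne' τ with
    pos := div_pos h.pos hl
    periodic_fst := fun x => by simp only [e, h.periodic_fst (l * x + τ)]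
    periodic_snd := fun x => by simp only [e, h.periodic_snd (l * x + τ)]
    periodic_thd := fun x => by simp only [e, h.periodic_thd (l * x + τ)]
    action_zero := by
      rw [action_scale J u w hl.ne', show l * (T / l) + τ = l * 0 + τ + T by field_simp; ring,
        h.action_period, mul_zero] }

lemma shift (h : IsPeriodicMin J T u p w) (τ : ℝ) :
    IsPeriodicMin J T (fun x => u (x + τ)) (fun x => p (x + τ)) (fun x => w (x + τ)) := by
  simpa using h.scale one_pos τ

/-- Going n₁ periods to the left and n₂ to the right leads past the support of φ and back to the
common values of u and p at 0. The perturbed junction is therefore a loop, while the unperturbed one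
has action zero. -/
lemma isMinimal_join (hJ : ArcNonneg J) (h₁ : IsPeriodicMin J T₁ u₁ p₁ w₁)
    (h₂ : IsPeriodicMin J T₂ u₂ p₂ w₂) (hu : u₁ 0 = u₂ 0) (hp : p₁ 0 = p₂ 0) :
    IsMinimal J (join 0 u₁ u₂) (join 0 w₁ w₂) := by
  intro φ hφ R hR hv ε hε
  have hj := h₁.toIsH2.join h₂.toIsH2 hu hp
  obtain ⟨n₁, hn₁⟩ := exists_nat_ge (R / T₁)
  obtain ⟨n₂, hn₂⟩ := exists_nat_ge (R / T₂)
  rw [div_le_iff₀ h₁.pos] at hn₁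
  rw [div_le_iff₀ h₂.pos] at hn₂
  have ha : -(n₁ * T₁) ≤ -R := by linarith
  have ha0 : -(n₁ * T₁) ≤ 0 := by linarith
  have hb0 : 0 ≤ n₂ * T₂ := by linarith
  have va := hv (-(n₁ * T₁)) (by rw [abs_of_nonpos ha0]; linarith)
  have vb := hv (n₂ * T₂) (by rw [abs_of_nonneg hb0]; linarith)
  have pu₁ : u₁ (-(n₁ * T₁)) = u₁ 0 := by
    have := h₁.periodic_fst.nat_mul n₁ (-(n₁ * T₁)); rw [neg_add_cancel] at this; exact this.symm
  have pp₁ : p₁ (-(n₁ * T₁)) = p₁ 0 := by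
    have := h₁.periodic_snd.nat_mul n₁ (-(n₁ * T₁)); rw [neg_add_cancel] at this; exact this.symm
  have pu₂ : u₂ (n₂ * T₂) = u₂ 0 := h₂.periodic_fst.nat_mul_eq n₂
  have pp₂ : p₂ (n₂ * T₂) = p₂ 0 := h₂.periodic_snd.nat_mul_eq n₂
  refine ⟨_, _, ha, hn₂, ?_, ?_⟩
  · rw [← hj.action_add J _ 0, action_congr (u' := u₁) (w' := w₁) ha0
      (fun x hx => join_of_le hx.2.le) (fun x hx => join_of_le hx.2.le),
      action_congr (u' := u₂) (w' := w₂) hb0 (fun x hx => join_of_lt hx.1)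
      (fun x hx => join_of_lt hx.1)]
    have e1 := h₁.action_nat_mul (-(n₁ * T₁)) n₁
    have e2 := h₂.action_nat_mul 0 n₂
    rw [neg_add_cancel] at e1
    rw [zero_add] at e2
    rw [e1, e2]
    linarith
  · refine le_trans (by linarith) (hJ.loop
      (hj.add hφ.isH2 hφ.derivative.derivative.continuous) (ha0.trans hb0) ?_ ?_)
    · rw [va.1, vb.1, join_of_le ha0, join_of_ge hu hb0, pu₁, pu₂, hu]
    · rw [va.2.1, vb.2.1, join_of_le ha0, join_of_ge hp hb0, pp₁, pp₂, hp]

lemma join_self (c : ℝ) (f : ℝ → ℝ) : join c f f = f := by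
  ext x; simp [join]

/-- A periodic minimizer joined to itself is minimal for compactly supported perturbations. -/
lemma exists_isSol (hJ : ArcNonneg J) (h : IsPeriodicMin J T u p w) :
    ∃ q r, IsSol J u p q r ∧ w =ᵐ[volume] fun x => q x + u x ^ 2 / 2 := by
  have := isMinimal_join hJ h h rfl rfl
  rw [join_self, join_self] at this
  exact this.exists_isSol h.toIsH2

/-- Position and slope alone determine a periodic minimizer, although the equation is of fourth
order; the two periods need not be assumed equal. -/
lemma eq_of_eq (hJ : ArcNonneg J) (h₁ : IsPeriodicMin J T₁ u₁ p₁ w₁)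
    (h₂ : IsPeriodicMin J T₂ u₂ p₂ w₂) (hu : u₁ 0 = u₂ 0) (hp : p₁ 0 = p₂ 0) : u₁ = u₂ := by
  obtain ⟨q₁, r₁, hs₁, -⟩ := h₁.exists_isSol hJ
  obtain ⟨q₂, r₂, hs₂, -⟩ := h₂.exists_isSol hJ
  exact eq_of_isMinimal_join h₁.toIsH2 h₂.toIsH2 hs₁ hs₂ hu hp (isMinimal_join hJ h₁ h₂ hu hp)

lemma four_pos (h : IsPeriodicMin J T u p w) (hne : u ≠ 0) (x : ℝ) :
    0 < ∫ t in x..(x + T), u t ^ 4 :=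
  integral_pow_pos h.continuous_fst h.pos h.periodic_fst hne (by decide) x

lemma exists_max (h : IsPeriodicMin J T u p w) : ∃ x, p x = 0 ∧ ∀ y, u y ≤ u x := by
  obtain ⟨x, -, hx⟩ := isCompact_Icc.exists_isMaxOn (nonempty_Icc.2 h.pos.le)
    h.continuous_fst.continuousOn
  have hmax : ∀ y, u y ≤ u x := fun y => by
    obtain ⟨z, hz, e⟩ := h.periodic_fst.exists_mem_Ico₀ h.pos y
    rw [e]; exact hx ⟨hz.1, hz.2.le⟩
  have hl : IsLocalMax u x := Eventually.of_forall hmax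
  exact ⟨x, hl.hasDerivAt_eq_zero (h.hasDerivAt x), hmax⟩

lemma exists_min (h : IsPeriodicMin J T u p w) : ∃ x, p x = 0 ∧ ∀ y, u x ≤ u y := by
  obtain ⟨x, -, hx⟩ := isCompact_Icc.exists_isMinOn (nonempty_Icc.2 h.pos.le)
    h.continuous_fst.continuousOn
  have hmin : ∀ y, u x ≤ u y := fun y => by
    obtain ⟨z, hz, e⟩ := h.periodic_fst.exists_mem_Ico₀ h.pos y
    rw [e]; exact hx ⟨hz.1, hz.2.le⟩
  have hl : IsLocalMin u x := Eventually.of_forall hmin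
  exact ⟨x, hl.hasDerivAt_eq_zero (h.hasDerivAt x), hmin⟩

/-- Otherwise u ≤ 0, and the 9/64 bound leaves a strictly positive action over a period because J >
9/64. -/
lemma max_pos (h : IsPeriodicMin J T u p w) (hJ : 9 / 64 < J) (hne : u ≠ 0) {x : ℝ}
    (hp : p x = 0) (hmax : ∀ y, u y ≤ u x) : 0 < u x := by
  by_contra! hle
  have h1 := h.action_nonneg_of_nonpos (a := x) (b := x + T) (by linarith [h.pos])
    (fun y _ => (hmax y).trans hle) hp (by rw [h.periodic_snd, hp])
  have h2 := h.action_period x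
  rw [h.action_change J (9 / 64)] at h2
  nlinarith [h.four_pos hne x]

lemma min_neg (h : IsPeriodicMin J T u p w) (hJ : 9 / 64 < J) (hne : u ≠ 0) {x : ℝ}
    (hp : p x = 0) (hmin : ∀ y, u x ≤ u y) : u x < 0 := by
  by_contra! hge
  have h1 := h.action_ge_of_nonneg (J := J) (a := x) (b := x + T) (by linarith [h.pos])
    (fun y _ => hge.trans (hmin y)) (by simp [hp]) (by rw [h.periodic_snd, hp])
  rw [h.action_period x] at h1
  nlinarith [h.four_pos hne x]

/-- Nontrivial periodic minimizers coincide up to scaling and translation. -/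
lemma exists_scale_eq (hA : ArcNonneg J) (hJ : 9 / 64 < J) (h₁ : IsPeriodicMin J T₁ u₁ p₁ w₁)
    (h₂ : IsPeriodicMin J T₂ u₂ p₂ w₂) (hne₁ : u₁ ≠ 0) (hne₂ : u₂ ≠ 0) :
    ∃ l > 0, ∃ τ, ∀ x, u₁ x = l ^ 2 * u₂ (l * x + τ) := by
  obtain ⟨x₁, hp₁, hm₁⟩ := h₁.exists_max
  obtain ⟨x₂, hp₂, hm₂⟩ := h₂.exists_max
  have hpos₁ := h₁.max_pos hJ hne₁ hp₁ hm₁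
  have hpos₂ := h₂.max_pos hJ hne₂ hp₂ hm₂
  -- Scaling by l matches the two maximal values; the slopes there are zero and remain so.
  set l := Real.sqrt (u₁ x₁ / u₂ x₂) with hl
  have hl0 : 0 < l := Real.sqrt_pos.2 (div_pos hpos₁ hpos₂)
  have hl2 : l ^ 2 = u₁ x₁ / u₂ x₂ := Real.sq_sqrt (div_pos hpos₁ hpos₂).le
  have := eq_of_eq hA (h₁.shift x₁) (h₂.scale hl0 x₂) (by
    simp only [zero_add, mul_zero, hl2]; field_simp) (by
    simp only [zero_add, mul_zero, hp₁, hp₂])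
  refine ⟨l, hl0, x₂ - l * x₁, fun x => ?_⟩
  have h3 := congrFun this (x - x₁)
  simp only [sub_add_cancel] at h3
  rw [h3]
  congr 2; ring

end IsPeriodicMin

/-! ### Capping open ends and decay at infinity -/

/-- Cost of continuing from the state `(α, β)` to a state with vanishing derivative. -/
noncomputable def capCost (J α β : ℝ) : ℝ :=
  β ^ 2 + |β| * (|α| + |β|) ^ 2 + J * (|α| + |β|) ^ 4

lemma capCost_neg (J α β : ℝ) : capCost J α (-β) = capCost J α β := by
  simp [capCost]

namespace IsH2

variable {u p w : ℝ → ℝ} {a b J : ℝ}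

/-- Continuation with vanishing derivative after a unit length. -/
lemma exists_cap (h : IsH2 u p w) (hJ : 0 ≤ J) (b : ℝ) :
    ∃ z p' w', IsH2 z p' w' ∧ (∀ x ≤ b, z x = u x ∧ p' x = p x ∧ w' x = w x) ∧
      p' (b + 1) = 0 ∧ action J z w' b (b + 1) ≤ capCost J (u b) (p b) := by
  set α := u b
  set β := p b
  -- The constant second derivative -β brings the slope β to 0 over a unit length.
  have hc : IsH2 (fun x => α + β * (x - b) - β * (x - b) ^ 2 / 2) (fun x => β - β * (x - b))
      (fun _ => -β) := by
    refine .of_hasDerivAt (fun x => ?_) (fun x => ?_) continuous_const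
    · have h1 : HasDerivAt (fun x => x - b) 1 x := (hasDerivAt_id x).sub_const b
      refine (((h1.const_mul β).const_add α).sub (((h1.pow 2).const_mul β).div_const 2)).congr_deriv
        ?_
      simp; ring
    · have h1 : HasDerivAt (fun x => x - b) 1 x := (hasDerivAt_id x).sub_const b
      simpa using (h1.const_mul β).const_sub β
  have hj := h.join hc (c := b) (by simp [α]) (by simp [β])
  refine ⟨_, _, _, hj, fun x hx => ⟨join_of_le hx, join_of_le hx, join_of_le hx⟩, ?_, ?_⟩
  · rw [join_of_lt (by linarith)]; ring
  · rw [action_congr (by linarith) (fun x hx => join_of_lt hx.1) (fun x hx => join_of_lt hx.1)]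
    have h1 := intervalIntegral.integral_mono_on (a := b) (b := b + 1) (by linarith)
      (hc.lag_integrable J b (b + 1)) (intervalIntegrable_const (c := capCost J α β))
      fun x hx => by
        have hs0 : 0 ≤ x - b := by linarith [hx.1]
        have hs1 : x - b ≤ 1 := by linarith [hx.2]
        set s := x - b
        set y := α + β * s - β * s ^ 2 / 2 with hy
        have hyb : |y| ≤ |α| + |β| := by
          have e : y = α + β * (s - s ^ 2 / 2) := by rw [hy]; ring
          rw [e]
          refine (abs_add_le _ _).trans ?_
          rw [abs_mul]
          have : |s - s ^ 2 / 2| ≤ 1 := abs_le.2 ⟨by nlinarith, by nlinarith⟩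
          have := mul_le_of_le_one_right (abs_nonneg β) this
          linarith
        have h2 : y ^ 2 ≤ (|α| + |β|) ^ 2 := by
          rw [← sq_abs]; exact pow_le_pow_left₀ (abs_nonneg _) hyb 2
        have h4 : y ^ 4 ≤ (|α| + |β|) ^ 4 := by
          rw [← Even.pow_abs (by decide : Even 4)]; exact pow_le_pow_left₀ (abs_nonneg _) hyb 4
        have h5 : β * y ^ 2 ≤ |β| * (|α| + |β|) ^ 2 :=
          mul_le_mul (le_abs_self β) h2 (sq_nonneg _) (abs_nonneg _)
        have h6 : J * y ^ 4 ≤ J * (|α| + |β|) ^ 4 := mul_le_mul_of_nonneg_left h4 hJ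
        unfold capCost
        linarith
    rw [intervalIntegral.integral_const, smul_eq_mul] at h1
    unfold action
    linarith

lemma action_reflect (J : ℝ) (u w : ℝ → ℝ) (a b : ℝ) :
    action J (fun x => u (-x)) (fun x => w (-x)) a b = action J u w (-b) (-a) :=
  intervalIntegral.integral_comp_neg (fun x => w x ^ 2 - w x * u x ^ 2 + J * u x ^ 4)

/-- The capped function is an arc, so its action is nonnegative, and the cap accounts for at most
`capCost` of it. -/
lemma neg_capCost_le_of_left (h : IsH2 u p w) (hA : ArcNonneg J) (hJ : 0 ≤ J) (hab : a ≤ b)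
    (ha : p a = 0) : -capCost J (u b) (p b) ≤ action J u w a b := by
  obtain ⟨z, p', w', hz, heq, hp, hact⟩ := h.exists_cap hJ b
  have h1 := hA _ _ _ hz a (b + 1) (by linarith) (by rw [(heq a hab).2.1, ha]) hp
  rw [← hz.action_add J a b, action_congr (u' := u) (w' := w) hab
    (fun x hx => (heq x hx.2.le).1) (fun x hx => (heq x hx.2.le).2.2)] at h1
  linarith

lemma neg_capCost_le_of_right (h : IsH2 u p w) (hA : ArcNonneg J) (hJ : 0 ≤ J) (hab : a ≤ b)
    (hb : p b = 0) : -capCost J (u a) (p a) ≤ action J u w a b := by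
  have := h.reflect.neg_capCost_le_of_left hA hJ (a := -b) (b := -a) (by linarith)
    (by simp [hb])
  rwa [action_reflect, neg_neg, neg_neg, capCost_neg] at this

lemma neg_capCost_le (h : IsH2 u p w) (hA : ArcNonneg J) (hJ : 0 ≤ J) (hab : a ≤ b) :
    -(capCost J (u a) (p a) + capCost J (u b) (p b)) ≤ action J u w a b := by
  obtain ⟨z, p', w', hz, heq, hp, hact⟩ := h.exists_cap hJ b
  have h1 := hz.neg_capCost_le_of_right hA hJ (a := a) (b := b + 1) (by linarith) hp
  rw [(heq a hab).1, (heq a hab).2.1, ← hz.action_add J a b, action_congr (u' := u) (w' := w) hab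
    (fun x hx => (heq x hx.2.le).1) (fun x hx => (heq x hx.2.le).2.2)] at h1
  linarith

lemma exists_abs_le_of_integral_lt (h : IsH2 u p w) {c d ε : ℝ} (hε : 0 < ε) (hac : a ≤ c)
    (hcd : c ≤ d) (hdb : d ≤ b) (hU : ∫ x in a..b, u x ^ 4 < (d - c) * ε ^ 4) :
    ∃ s ∈ Icc c d, |u s| ≤ ε := by
  by_contra! hcon
  have hi : ∀ c d, IntervalIntegrable (fun x => u x ^ 4) volume c d := fun c d =>
    (h.continuous_fst.pow 4).intervalIntegrable _ _
  have h1 := intervalIntegral.integral_mono_on hcd (μ := volume) (f := fun _ => ε ^ 4)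
    (g := fun x => u x ^ 4) intervalIntegrable_const (hi c d)
    fun x hx => by
      rw [← Even.pow_abs (by decide : Even 4) (u x)]
      exact pow_le_pow_left₀ hε.le (hcon x hx).le 4
  rw [intervalIntegral.integral_const, smul_eq_mul] at h1
  have h2 : ∫ x in c..d, u x ^ 4 ≤ ∫ x in a..b, u x ^ 4 :=
    intervalIntegral.integral_mono_interval hac hcd hdb
      (ae_of_all _ fun x => by simp only [Pi.zero_apply]; positivity) (hi a b)
  linarith

/-- Interpolation on a unit interval. -/
lemma abs_le_of_small (h : IsH2 u p w) {x ε : ℝ} (hε : 0 < ε)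
    (hU : ∫ t in x..(x + 1), u t ^ 4 < 1 / 3 * ε ^ 4)
    (hW : ∫ t in x..(x + 1), w t ^ 2 ≤ ε ^ 2) : |u x| ≤ 9 * ε ∧ |p x| ≤ 9 * ε := by
  -- Points with |u| ≤ ε are found in both outer thirds. The mean value theorem gives a slope of at
  -- most 6ε between them, and the bound on ∫w² lets slopes vary by at most ε from there to x.
  obtain ⟨s, hs, hus⟩ := h.exists_abs_le_of_integral_lt (a := x) (b := x + 1) (c := x)
    (d := x + 1 / 3) hε le_rfl (by linarith) (by linarith) (hU.trans_eq (by ring))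
  obtain ⟨t, ht, hut⟩ := h.exists_abs_le_of_integral_lt (a := x) (b := x + 1) (c := x + 2 / 3)
    (d := x + 1) hε (by linarith) (by linarith) le_rfl (hU.trans_eq (by ring))
  have hst : s + 1 / 3 ≤ t := by linarith [hs.2, ht.1]
  obtain ⟨c, hc, hpc⟩ := exists_hasDerivAt_eq_slope u p (by linarith : s < t)
    h.continuous_fst.continuousOn fun y _ => h.hasDerivAt y
  have hpc' : |p c| ≤ 6 * ε := by
    rw [hpc, abs_div, abs_of_pos (by linarith : 0 < t - s), div_le_iff₀ (by linarith)]
    have := (abs_sub (u t) (u s)).trans (add_le_add hut hus)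
    nlinarith
  have hxc : x ≤ c := by linarith [hs.1, hc.1]
  have hc1 : c ≤ x + 1 := by linarith [ht.2, hc.2]
  have hp0 : |p x| ≤ 7 * ε := by
    have h1 := h.abs_sub_le hW le_rfl hxc hc1
    have h2 : Real.sqrt ((c - x) * ε ^ 2) ≤ ε :=
      Real.sqrt_le_iff.2 ⟨hε.le, by nlinarith [sq_nonneg ε]⟩
    have h3 : |p x| ≤ |p c| + |p c - p x| := by
      have := abs_sub (p c) (p c - p x); rwa [sub_sub_cancel] at this
    linarith
  have hp : ∀ y ∈ Icc x (x + 1), |p y| ≤ 8 * ε := by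
    intro y hy
    have h1 := h.abs_sub_le hW le_rfl hy.1 hy.2
    have h2 : Real.sqrt ((y - x) * ε ^ 2) ≤ ε :=
      Real.sqrt_le_iff.2 ⟨hε.le, by nlinarith [sq_nonneg ε, hy.2]⟩
    have h3 : |p y| ≤ |p y - p x| + |p x| := by
      have := abs_add_le (p y - p x) (p x); rwa [sub_add_cancel] at this
    linarith
  refine ⟨?_, by linarith⟩
  have h1 := h.sub_le_of_le hs.1 fun y hy => (abs_le.1 (hp y ⟨hy.1, by linarith [hy.2, hs.2]⟩)).2
  have h2 := h.sub_ge_of_ge hs.1 fun y hy => (abs_le.1 (hp y ⟨hy.1, by linarith [hy.2, hs.2]⟩)).1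
  have h3 := abs_le.1 hus
  have h4 : s - x ≤ 1 := by linarith [hs.2]
  refine abs_le.2 ⟨by nlinarith, by nlinarith⟩

end IsH2

lemma tendsto_integral_unit {f : ℝ → ℝ} (hf : Integrable f) :
    Tendsto (fun x => ∫ t in x..(x + 1), f t) atTop (𝓝 0) := by
  have h1 := intervalIntegral_tendsto_integral_Ioi 0 hf.integrableOn
    (tendsto_id (α := ℝ) (x := atTop))
  have h2 := h1.comp (tendsto_atTop_add_const_right atTop (1:ℝ) tendsto_id)
  have h3 := h2.sub h1
  rw [sub_self] at h3
  refine h3.congr fun x => ?_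
  exact intervalIntegral.integral_interval_sub_left hf.intervalIntegrable hf.intervalIntegrable

lemma IsH2.tendsto_atTop {u p w : ℝ → ℝ} (h : IsH2 u p w) (hu : Integrable fun x => u x ^ 4)
    (hw : Integrable fun x => w x ^ 2) :
    Tendsto u atTop (𝓝 0) ∧ Tendsto p atTop (𝓝 0) := by
  have key : ∀ ε > 0, ∀ᶠ x in atTop, |u x| ≤ 9 * ε ∧ |p x| ≤ 9 * ε := by
    intro ε hε
    filter_upwards [(tendsto_integral_unit hu).eventually_lt_const
      (show (0:ℝ) < 1 / 3 * ε ^ 4 by positivity), (tendsto_integral_unit hw).eventually_le_const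
      (show (0:ℝ) < ε ^ 2 by positivity)] with x h1 h2
    exact h.abs_le_of_small hε h1 h2
  constructor
  · rw [Metric.tendsto_nhds]
    intro ε hε
    filter_upwards [key (ε / 10) (by positivity)] with x hx
    rw [Real.dist_eq, sub_zero]
    linarith [hx.1]
  · rw [Metric.tendsto_nhds]
    intro ε hε
    filter_upwards [key (ε / 10) (by positivity)] with x hx
    rw [Real.dist_eq, sub_zero]
    linarith [hx.2]

/-! ### The inequality on the line: validity, strictness, optimality -/

/-- Functions of finite energy on the line. -/
structure IsGlobal (u p w : ℝ → ℝ) : Prop extends IsH2 u p w where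
  four : Integrable fun x => u x ^ 4
  sq : Integrable fun x => w x ^ 2

namespace IsGlobal

variable {u p w : ℝ → ℝ} {J : ℝ}

lemma reflect (h : IsGlobal u p w) :
    IsGlobal (fun x => u (-x)) (fun x => -p (-x)) (fun x => w (-x)) :=
  { h.toIsH2.reflect with
    four := h.four.comp_neg
    sq := h.sq.comp_neg }

lemma shift (h : IsGlobal u p w) (τ : ℝ) :
    IsGlobal (fun x => u (x + τ)) (fun x => p (x + τ)) (fun x => w (x + τ)) :=
  { h.toIsH2.shift τ with
    four := h.four.comp_add_right τ
    sq := h.sq.comp_add_right τ }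

lemma tendsto_atBot (h : IsGlobal u p w) : Tendsto u atBot (𝓝 0) ∧ Tendsto p atBot (𝓝 0) := by
  obtain ⟨h1, h2⟩ := h.reflect.toIsH2.tendsto_atTop h.reflect.four h.reflect.sq
  refine ⟨?_, ?_⟩
  · simpa [Function.comp_def] using h1.comp tendsto_neg_atBot_atTop
  · simpa [Function.comp_def] using (h2.comp tendsto_neg_atBot_atTop).neg

lemma mul_integrable (h : IsGlobal u p w) : Integrable fun x => w x * u x ^ 2 := by
  have hwl := locallyIntegrable_of_intervalIntegrable h.integrable
  refine (h.sq.add h.four).mono' (hwl.aestronglyMeasurable.mul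
    (h.continuous_fst.pow 2).aestronglyMeasurable) (ae_of_all _ fun x => ?_)
  rw [Real.norm_eq_abs, abs_mul, abs_of_nonneg (sq_nonneg (u x))]
  have h1 := sq_nonneg (|w x| - u x ^ 2)
  have h2 := sq_abs (w x)
  have h3 : 0 ≤ |w x| * u x ^ 2 := by positivity
  simp only [Pi.add_apply]
  nlinarith

lemma lag_integrable' (h : IsGlobal u p w) (J : ℝ) :
    Integrable fun x => w x ^ 2 - w x * u x ^ 2 + J * u x ^ 4 :=
  (h.sq.sub h.mul_integrable).add (h.four.const_mul J)

lemma tendsto_action (h : IsGlobal u p w) (J : ℝ) :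
    Tendsto (fun R : ℝ => action J u w (-R) R) atTop
      (𝓝 (∫ x, (w x ^ 2 - w x * u x ^ 2 + J * u x ^ 4))) :=
  intervalIntegral_tendsto_integral (h.lag_integrable' J) tendsto_neg_atTop_atBot tendsto_id

lemma tendsto_capCost (J : ℝ) {l : Filter ℝ} (hu : Tendsto u l (𝓝 0)) (hp : Tendsto p l (𝓝 0)) :
    Tendsto (fun x => capCost J (u x) (p x)) l (𝓝 0) := by
  have hc : Continuous fun z : ℝ × ℝ => capCost J z.1 z.2 := by unfold capCost; fun_prop
  have := (hc.tendsto (0, 0)).comp (hu.prodMk_nhds hp)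
  simpa [Function.comp_def, capCost] using this

lemma tendsto_capCost_atTop (h : IsGlobal u p w) (J : ℝ) :
    Tendsto (fun x => capCost J (u x) (p x)) atTop (𝓝 0) :=
  tendsto_capCost J (h.toIsH2.tendsto_atTop h.four h.sq).1 (h.toIsH2.tendsto_atTop h.four h.sq).2

lemma tendsto_capCost_neg (h : IsGlobal u p w) (J : ℝ) :
    Tendsto (fun x => capCost J (u (-x)) (p (-x))) atTop (𝓝 0) :=
  (tendsto_capCost J h.tendsto_atBot.1 h.tendsto_atBot.2).comp tendsto_neg_atTop_atBot

/-- On [-R, R] the action is bounded below by minus the cost of two caps, which tends to 0 because u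
and u' decay. -/
lemma nonneg (h : IsGlobal u p w) (hA : ArcNonneg J) (hJ : 0 ≤ J) :
    0 ≤ ∫ x, (w x ^ 2 - w x * u x ^ 2 + J * u x ^ 4) := by
  have h1 := ((h.tendsto_capCost_neg J).add (h.tendsto_capCost_atTop J)).neg
  rw [add_zero, neg_zero] at h1
  refine le_of_tendsto_of_tendsto h1 (h.tendsto_action J) ?_
  filter_upwards [eventually_ge_atTop 0] with R hR
  exact h.neg_capCost_le hA hJ (by linarith)

lemma isMinimal (h : IsGlobal u p w) (hA : ArcNonneg J) (hJ : 0 ≤ J)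
    (h0 : ∫ x, (w x ^ 2 - w x * u x ^ 2 + J * u x ^ 4) = 0) : IsMinimal J u w := by
  intro φ hφ R hR hv ε hε
  have h1 := (h.tendsto_capCost_neg J).add (h.tendsto_capCost_atTop J)
  have h2 := h.tendsto_action J
  rw [add_zero] at h1
  rw [h0] at h2
  obtain ⟨b, hbR, hb1, hb2⟩ := ((eventually_ge_atTop R).and
    ((h1.eventually_le_const hε).and (h2.eventually_le_const hε))).exists
  have hb0 : 0 ≤ b := hR.le.trans hbR
  refine ⟨-b, b, by linarith, hbR, hb2, ?_⟩
  have h3 := (h.toIsH2.add hφ.isH2 hφ.derivative.derivative.continuous).neg_capCost_le hA hJ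
    (by linarith : -b ≤ b)
  obtain ⟨a1, a2, -⟩ := hv (-b) (by rw [abs_neg, abs_of_nonneg hb0]; exact hbR)
  obtain ⟨b1, b2, -⟩ := hv b (by rw [abs_of_nonneg hb0]; exact hbR)
  rw [a1, a2, b1, b2, add_zero, add_zero, add_zero, add_zero] at h3
  linarith

/-- A nonzero function tending to 0 at both ends attains a positive maximum or a negative minimum.
-/
lemma exists_critical (h : IsGlobal u p w) (hne : u ≠ 0) : ∃ x, p x = 0 ∧ u x ≠ 0 := by
  have hco : Tendsto u (cocompact ℝ) (𝓝 0) := by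
    rw [cocompact_eq_atBot_atTop]
    exact h.tendsto_atBot.1.sup (h.toIsH2.tendsto_atTop h.four h.sq).1
  obtain ⟨y, hy⟩ := Function.ne_iff.1 hne
  rcases lt_or_gt_of_ne hy with hlt | hgt
  · obtain ⟨x, hx⟩ := h.continuous_fst.exists_forall_le' y (hco.eventually_const_le hlt)
    have hl : IsLocalMin u x := Eventually.of_forall hx
    exact ⟨x, hl.hasDerivAt_eq_zero (h.hasDerivAt x), ((hx y).trans_lt hlt).ne⟩
  · obtain ⟨x, hx⟩ := h.continuous_fst.exists_forall_ge' y (hco.eventually_le_const hgt)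
    have hl : IsLocalMax u x := Eventually.of_forall hx
    exact ⟨x, hl.hasDerivAt_eq_zero (h.hasDerivAt x), (lt_of_lt_of_le hgt (hx y)).ne'⟩

end IsGlobal

/-- Equality on the line would allow gluing with a periodic minimizer. -/
lemma IsGlobal.ne_zero_action_of_critical {J T : ℝ} {u p w v p' w' : ℝ → ℝ}
    (h : IsGlobal u p w) (hA : ArcNonneg J) (hJ : 0 ≤ J) (hv : IsPeriodicMin J T v p' w')
    (hp : p 0 = 0) (hp' : p' 0 = 0) (huv : u 0 = v 0) (hne : u 0 ≠ 0) :
    ∫ x, (w x ^ 2 - w x * u x ^ 2 + J * u x ^ 4) ≠ 0 := by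
  intro h0
  obtain ⟨q, r, hs, -⟩ := (h.isMinimal hA hJ h0).exists_isSol h.toIsH2
  obtain ⟨q', r', hs', -⟩ := hv.exists_isSol hA
  -- The critical point 0 separates two half-line arcs. Each has asymptotically nonnegative action
  -- and the sum tends to zero, so the left one tends to zero.
  have hhalf : Tendsto (fun R : ℝ => action J u w (-R) 0) atTop (𝓝 0) := by
    have hright := h.tendsto_capCost_atTop J
    have hleft := (h.tendsto_capCost_neg J).neg
    have htot := h.tendsto_action J
    rw [h0] at htot
    have hup := htot.add hright
    rw [neg_zero] at hleft
    rw [add_zero] at hup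
    refine tendsto_of_tendsto_of_tendsto_of_le_of_le' hleft hup ?_ ?_
    · filter_upwards [eventually_ge_atTop 0] with R hR
      exact h.neg_capCost_le_of_right hA hJ (by linarith) hp
    · filter_upwards [eventually_ge_atTop 0] with R hR
      have h1 := h.neg_capCost_le_of_left hA hJ hR hp
      have h2 := h.action_add J (-R) 0 R
      linarith
  have hj := h.toIsH2.join hv.toIsH2 huv (by rw [hp, hp'])
  have hmin : IsMinimal J (join 0 u v) (join 0 w w') := by
    intro φ hφ R hR hvan ε hε
    obtain ⟨a, haR, ha1, ha2⟩ := ((eventually_ge_atTop R).and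
      ((hhalf.eventually_le_const hε).and
        ((h.tendsto_capCost_neg J).eventually_le_const hε))).exists
    obtain ⟨n, hn⟩ := exists_nat_ge (R / T)
    rw [div_le_iff₀ hv.pos] at hn
    have ha0 : -a ≤ 0 := by linarith
    have hb0 : 0 ≤ n * T := by linarith
    refine ⟨-a, n * T, by linarith, hn, ?_, ?_⟩
    · rw [← hj.action_add J _ 0, action_congr (u' := u) (w' := w) ha0
        (fun x hx => join_of_le hx.2.le) (fun x hx => join_of_le hx.2.le),
        action_congr (u' := v) (w' := w') hb0 (fun x hx => join_of_lt hx.1)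
        (fun x hx => join_of_lt hx.1)]
      have e2 := hv.action_nat_mul 0 n
      rw [zero_add] at e2
      rw [e2, add_zero]
      exact ha1
    · obtain ⟨a1, a2, -⟩ := hvan (-a) (by rw [abs_of_nonpos ha0]; linarith)
      obtain ⟨b1, b2, -⟩ := hvan (n * T) (by rw [abs_of_nonneg hb0]; exact hn)
      have h3 := (hj.add hφ.isH2 hφ.derivative.derivative.continuous).neg_capCost_le_of_right
        hA hJ (ha0.trans hb0) (by
          rw [b2, join_of_ge (by rw [hp, hp']) hb0, hv.periodic_snd.nat_mul_eq n, hp', add_zero])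
      rw [a1, a2, join_of_le ha0, join_of_le ha0, add_zero, add_zero] at h3
      linarith
  -- The gluing makes u equal to the periodic v; sampled at multiples of T it is constant, yet it
  -- tends to 0.
  have heq := eq_of_isMinimal_join h.toIsH2 hv.toIsH2 hs hs' huv (by rw [hp, hp']) hmin
  have hlim := (h.toIsH2.tendsto_atTop h.four h.sq).1
  have hseq : Tendsto (fun n : ℕ => (n : ℝ) * T) atTop atTop :=
    tendsto_natCast_atTop_atTop.atTop_mul_const hv.pos
  have h1 := hlim.comp hseq
  have h2 : (u ∘ fun n : ℕ => (n : ℝ) * T) = fun _ => u 0 := by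
    ext n
    simp only [Function.comp_apply, heq, hv.periodic_fst.nat_mul_eq n]
  rw [h2] at h1
  exact hne (tendsto_nhds_unique tendsto_const_nhds h1)

/-- Scaling multiplies values by a positive factor, so a critical value of u is matched with the
minimum or the maximum of v according to its sign. This works because v takes both signs. -/
lemma IsGlobal.action_pos {J T : ℝ} {u p w v p' w' : ℝ → ℝ} (h : IsGlobal u p w)
    (hA : ArcNonneg J) (hJ : 9 / 64 < J) (hv : IsPeriodicMin J T v p' w') (hv0 : v ≠ 0)
    (hne : u ≠ 0) : 0 < ∫ x, (w x ^ 2 - w x * u x ^ 2 + J * u x ^ 4) := by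
  refine lt_of_le_of_ne (h.nonneg hA (by linarith)) (Ne.symm ?_)
  obtain ⟨x, hpx, hux⟩ := h.exists_critical hne
  obtain ⟨y, hpy, hpos⟩ : ∃ y, p' y = 0 ∧ 0 < u x / v y := by
    rcases lt_or_gt_of_ne hux with hlt | hgt
    · obtain ⟨y, hy, hm⟩ := hv.exists_min
      exact ⟨y, hy, div_pos_of_neg_of_neg hlt (hv.min_neg hJ hv0 hy hm)⟩
    · obtain ⟨y, hy, hm⟩ := hv.exists_max
      exact ⟨y, hy, div_pos hgt (hv.max_pos hJ hv0 hy hm)⟩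
  have hvy : v y ≠ 0 := fun h0 => by simp [h0] at hpos
  have hl0 : 0 < Real.sqrt (u x / v y) := Real.sqrt_pos.2 hpos
  have hl2 : Real.sqrt (u x / v y) ^ 2 = u x / v y := Real.sq_sqrt hpos.le
  have h1 := (h.shift x).ne_zero_action_of_critical hA (by linarith) (hv.scale hl0 y)
    (by simp [hpx]) (by simp [hpy]) (by simp only [hl2, zero_add, mul_zero]; field_simp)
    (by simpa using hux)
  rwa [integral_add_right_eq_self (fun x => w x ^ 2 - w x * u x ^ 2 + J * u x ^ 4) x] at h1

/-- A finite-energy cut-off of value `α` and slope `0` at the origin, vanishing after `1`. -/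
lemma exists_cutoff (α : ℝ) : ∃ k k' k'' : ℝ → ℝ, IsH2 k k' k'' ∧ k 0 = α ∧ k' 0 = 0 ∧
    ∀ x, 1 < x → k x = 0 ∧ k'' x = 0 := by
  have h1 : IsH2 (fun x => α * (1 - 3 * x ^ 2 + 2 * x ^ 3)) (fun x => α * (-6 * x + 6 * x ^ 2))
      (fun x => α * (-6 + 12 * x)) := by
    refine .of_hasDerivAt (fun x => ?_) (fun x => ?_) (by fun_prop)
    · have := ((((hasDerivAt_id x).pow 2).const_mul 3).const_sub 1 |>.add
        (((hasDerivAt_id x).pow 3).const_mul 2)).const_mul α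
      refine this.congr_deriv ?_
      simp; left; ring
    · have := (((hasDerivAt_id x).const_mul (-6)).add
        (((hasDerivAt_id x).pow 2).const_mul 6)).const_mul α
      refine this.congr_deriv ?_
      simp; left; ring
  have h0 : IsH2 (fun _ => 0) (fun _ => 0) (fun _ => 0) :=
    .of_hasDerivAt (fun x => hasDerivAt_const x _) (fun x => hasDerivAt_const x _)
      continuous_const
  refine ⟨_, _, _, h1.join h0 (c := 1) (by norm_num) (by norm_num), ?_, ?_, ?_⟩
  · rw [join_of_le zero_le_one]; ring
  · rw [join_of_le zero_le_one]; ring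
  · intro x hx
    exact ⟨join_of_lt hx, join_of_lt hx⟩

/-- The constant is not improvable on the line. -/
lemma exists_isGlobal_action_neg {J J' T : ℝ} {v p w : ℝ → ℝ} (hv : IsPeriodicMin J T v p w)
    (hv0 : v ≠ 0) (hJ : J' < J) : ∃ u p w : ℝ → ℝ, IsGlobal u p w ∧
      ∫ x, (w x ^ 2 - w x * u x ^ 2 + J' * u x ^ 4) < 0 := by
  obtain ⟨x₀, hx₀, -⟩ := hv.exists_max
  -- Translation to a maximum, so that the cut-offs of zero slope can be attached at multiples of T.
  replace hv := hv.shift x₀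
  have hp0 : (fun x => p (x + x₀)) 0 = 0 := by simp [hx₀]
  have hv0' : (fun x => v (x + x₀)) ≠ 0 := fun h => hv0 (by
    ext x; simpa using congrFun h (x - x₀))
  clear hx₀ hv0
  set v' := fun x => v (x + x₀)
  set p' := fun x => p (x + x₀)
  set w' := fun x => w (x + x₀)
  obtain ⟨k, k', k'', hk, hk0, hk'0, hkv⟩ := exists_cutoff (v' 0)
  set K := action J' k k'' 0 1 with hK
  set C := ∫ x in (0:ℝ)..T, v' x ^ 4 with hC
  have hC0 : 0 < C := by simpa using hv.four_pos hv0' 0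
  -- Each period gains (J - J')C, and the two tails cost 2K in total, independently of n.
  obtain ⟨n, hn⟩ := exists_nat_gt (2 * K / ((J - J') * C))
  have hJC : 0 < (J - J') * C := mul_pos (sub_pos.2 hJ) hC0
  rw [div_lt_iff₀ hJC] at hn
  have hnT : 0 ≤ n * T := mul_nonneg n.cast_nonneg hv.pos.le
  have hj₁ := hv.toIsH2.join (hk.shift (-(n * T))) (c := n * T)
    (by rw [hv.periodic_fst.nat_mul_eq n, add_neg_cancel, hk0])
    (by rw [hv.periodic_snd.nat_mul_eq n, hp0, add_neg_cancel, hk'0])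
  have hj := hk.reflect.join hj₁ (c := 0)
    (by rw [neg_zero, join_of_le hnT, hk0]) (by rw [neg_zero, join_of_le hnT, hk'0, hp0, neg_zero])
  set u₁ := join (n * T) v' (fun x => k (x + -(n * T))) with hu₁
  set w₁ := join (n * T) w' (fun x => k'' (x + -(n * T))) with hw₁
  set u := join 0 (fun x => k (-x)) u₁ with hu
  set w₀ := join 0 (fun x => k'' (-x)) w₁ with hw₀
  have hleft : ∀ x, x < -1 → u x = 0 ∧ w₀ x = 0 := by
    intro x hx
    have hx0 : x ≤ 0 := by linarith
    rw [hu, hw₀, join_of_le hx0, join_of_le hx0]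
    exact hkv (-x) (by linarith)
  have hright : ∀ x, n * T + 1 < x → u x = 0 ∧ w₀ x = 0 := by
    intro x hx
    have hx0 : 0 < x := by linarith
    have hx1 : n * T < x := by linarith
    rw [hu, hw₀, join_of_lt hx0, join_of_lt hx0, hu₁, hw₁, join_of_lt hx1, join_of_lt hx1]
    exact hkv _ (by linarith)
  have hsupp : ∀ x, x ∉ Ioc (-2 : ℝ) (n * T + 1) → u x = 0 ∧ w₀ x = 0 := by
    intro x hx
    rw [mem_Ioc, not_and_or, not_lt, not_le] at hx
    rcases hx with hx | hx
    · exact hleft x (by linarith)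
    · exact hright x hx
  have hab : (-2 : ℝ) ≤ n * T + 1 := by linarith
  have hint : ∀ f : ℝ → ℝ, IntervalIntegrable f volume (-2) (n * T + 1) →
      (∀ x ∉ Ioc (-2 : ℝ) (n * T + 1), f x = 0) → Integrable f := by
    intro f hf h0
    have h1 := (intervalIntegrable_iff_integrableOn_Ioc_of_le hab).1 hf
    exact (integrableOn_iff_integrable_of_support_subset fun x hx => by
      by_contra hout; exact hx (h0 x hout)).1 h1
  have hG : IsGlobal u _ w₀ := { hj with
    four := hint _ ((hj.continuous_fst.pow 4).intervalIntegrable _ _)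
      (fun x hx => by rw [(hsupp x hx).1]; norm_num)
    sq := hint _ (hj.sq_integrable _ _) (fun x hx => by rw [(hsupp x hx).2]; norm_num) }
  refine ⟨u, _, w₀, hG, ?_⟩
  have hwhole : ∫ x, (w₀ x ^ 2 - w₀ x * u x ^ 2 + J' * u x ^ 4) =
      action J' u w₀ (-2) (n * T + 1) := by
    refine (intervalIntegral.integral_eq_integral_of_support_subset fun x hx => ?_).symm
    by_contra hout
    apply hx
    rw [(hsupp x hout).1, (hsupp x hout).2]
    norm_num
  have e1 : action J' u w₀ (-2) (-1) = 0 := by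
    rw [action_congr (u' := fun _ => 0) (w' := fun _ => 0) (by norm_num)
      (fun x hx => (hleft x hx.2).1) (fun x hx => (hleft x hx.2).2)]
    simp [action]
  have e2 : action J' u w₀ (-1) 0 = K := by
    rw [action_congr (by norm_num) (fun x hx => join_of_le hx.2.le)
      (fun x hx => join_of_le hx.2.le), IsH2.action_reflect, neg_zero, neg_neg]
  have e3 : action J' u w₀ 0 (n * T) = -(n * ((J - J') * C)) := by
    rw [action_congr (u' := v') (w' := w') hnT
      (fun x hx => (join_of_lt hx.1).trans (join_of_le hx.2.le))
      (fun x hx => (join_of_lt hx.1).trans (join_of_le hx.2.le)), hv.action_change J' J]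
    have h1 := hv.action_nat_mul 0 n
    rw [zero_add] at h1
    have hper : Function.Periodic (fun x => v' x ^ 4) T := fun x => by
      simp only [hv.periodic_fst x]
    have h2 := hper.intervalIntegral_add_zsmul_eq n 0 fun a b =>
      (hv.continuous_fst.pow 4).intervalIntegrable a b
    simp only [zero_add, natCast_zsmul, nsmul_eq_mul] at h2
    rw [h1, h2, ← hC]
    ring
  have e4 : action J' u w₀ (n * T) (n * T + 1) = K := by
    rw [action_congr (u' := fun x => k (x + -(n * T))) (w' := fun x => k'' (x + -(n * T)))
      (by linarith)
      (fun x hx => (join_of_lt (hnT.trans_lt hx.1)).trans (join_of_lt hx.1))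
      (fun x hx => (join_of_lt (hnT.trans_lt hx.1)).trans (join_of_lt hx.1)), action_shift]
    congr 1 <;> ring
  rw [hwhole, ← hj.action_add J' (-2) (-1), ← hj.action_add J' (-1) 0,
    ← hj.action_add J' 0 (n * T), e1, e2, e3, e4]
  linarith

/-! ### Least periods, smooth minimizers, and J ≠ 1/4 -/

/-- The second derivative is determined almost everywhere by the first. -/
lemma IsH2.ae_eq_of_snd {u p w u' w' : ℝ → ℝ} (h : IsH2 u p w) (h' : IsH2 u' p w') :
    w =ᵐ[volume] w' := by
  have h1 := ae_all_iff.2 fun n : ℕ => h.ae_hasDerivAt (-n) n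
  have h2 := ae_all_iff.2 fun n : ℕ => h'.ae_hasDerivAt (-n) n
  filter_upwards [h1, h2] with x hx hx'
  obtain ⟨n, hn⟩ := exists_nat_ge |x|
  have hm : x ∈ uIcc (-(n : ℝ)) n := by
    rw [uIcc_of_le (by linarith [abs_nonneg x])]
    exact abs_le.1 hn
  exact (hx n hm).unique (hx' n hm)

lemma IsH2.periodic_snd {u p w : ℝ → ℝ} (h : IsH2 u p w) {T : ℝ} (hu : Function.Periodic u T) :
    Function.Periodic p T := fun x => by
  have := (h.hasDerivAt (x + T)).comp_add_const x T
  rw [funext hu] at this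
  exact this.unique (h.hasDerivAt x)

lemma periodic_of_ae {u : ℝ → ℝ} (hu : Continuous u) {S : ℝ}
    (h : (fun x => u (x + S)) =ᵐ[volume] u) : Function.Periodic u S :=
  congrFun ((Continuous.ae_eq_iff_eq volume (by fun_prop) hu).1 h)

lemma ae_eq_comp_add {u v : ℝ → ℝ} (h : u =ᵐ[volume] v) (S : ℝ) :
    (fun x => u (x + S)) =ᵐ[volume] fun x => v (x + S) :=
  (measurePreserving_add_right volume S).quasiMeasurePreserving.ae_eq_comp h

lemma hasMinimalPeriod_iff {u v : ℝ → ℝ} (h : u =ᵐ[volume] v) (hv : Continuous v) (T : ℝ) :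
    HasMinimalPeriod u T ↔ IsLeast {S : ℝ | 0 < S ∧ Function.Periodic v S} T := by
  have : {S : ℝ | 0 < S ∧ (fun x => u (x + S)) =ᵐ[volume] u} =
      {S : ℝ | 0 < S ∧ Function.Periodic v S} := by
    ext S
    refine and_congr_right fun _ => ⟨fun hS => ?_, fun hS => ?_⟩
    · exact periodic_of_ae hv ((ae_eq_comp_add h S).symm.trans (hS.trans h))
    · refine (ae_eq_comp_add h S).trans ?_
      rw [funext hS]
      exact h.symm
  rw [HasMinimalPeriod, this]

/-- A continuous nonconstant periodic function has a smallest period. -/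
lemma exists_least_period {u : ℝ → ℝ} (hu : Continuous u) {T x y : ℝ} (hT : 0 < T)
    (hper : Function.Periodic u T) (hxy : u x ≠ u y) :
    ∃ S : ℝ, 0 < S ∧ Function.Periodic u S ∧ (∃ n : ℕ, 0 < n ∧ T = n * S) ∧
      ∀ S' > 0, Function.Periodic u S' → S ≤ S' := by
  -- The periods form a subgroup of ℝ, either dense or cyclic; density would make the continuous u
  -- constant.
  let P : AddSubgroup ℝ :=
    { carrier := {S | Function.Periodic u S}
      zero_mem' := fun x => by rw [add_zero]
      add_mem' := fun h h' => h.add_period h'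
      neg_mem' := fun h => h.neg }
  rcases P.dense_or_cyclic with hd | ⟨a, ha⟩
  · exfalso
    have : u = fun _ => u 0 := hu.ext_on hd continuous_const fun S hS => by
      have : Function.Periodic u S := hS
      simpa using this 0
    exact hxy (by rw [this])
  · have hmem : ∀ S, Function.Periodic u S ↔ ∃ n : ℤ, n • a = S := fun S => by
      rw [← AddSubgroup.mem_closure_singleton, ← ha]; rfl
    have habs : ∀ S > 0, Function.Periodic u S → ∃ n : ℕ, 0 < n ∧ S = n * |a| := by
      intro S hS hp
      obtain ⟨n, hn⟩ := (hmem S).1 hp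
      rw [zsmul_eq_mul] at hn
      refine ⟨n.natAbs, Int.natAbs_pos.2 fun h0 => ?_, ?_⟩
      · rw [h0] at hn; simp at hn; linarith
      · rw [Nat.cast_natAbs, Int.cast_abs, ← abs_mul, hn, abs_of_pos hS]
    obtain ⟨n, hn, hTn⟩ := habs T hT hper
    have ha0 : 0 < |a| := abs_pos.2 fun h0 => by simp [h0] at hTn; linarith
    refine ⟨|a|, ha0, ?_, ⟨n, hn, hTn⟩, fun S' hS' hp => ?_⟩
    · rcases abs_choice a with h | h
      · rw [h]; exact (hmem a).2 ⟨1, one_zsmul a⟩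
      · rw [h]; exact (hmem (-a)).2 ⟨-1, by simp⟩
    · obtain ⟨m, hm, rfl⟩ := habs S' hS' hp
      have : (1 : ℝ) ≤ m := by exact_mod_cast hm
      nlinarith

namespace IsPeriodicMin

variable {J T : ℝ} {u p w : ℝ → ℝ}

/-- The continuous version of the second derivative. -/
lemma exists_smooth (hA : ArcNonneg J) (h : IsPeriodicMin J T u p w) :
    ContDiff ℝ ∞ u ∧ IsPeriodicMin J T u p (iteratedDeriv 2 u) := by
  obtain ⟨q, r, hs, hw⟩ := h.exists_isSol hA
  have hd : iteratedDeriv 2 u = fun x => q x + u x ^ 2 / 2 := by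
    rw [iteratedDeriv_succ, iteratedDeriv_one, funext fun x => (hs.fst x).deriv]
    exact funext fun x => (hs.snd x).deriv
  refine ⟨hs.contDiff, ?_⟩
  rw [← hd] at hw
  exact
  { h.toIsH2.congr_snd hw with
    pos := h.pos
    periodic_fst := h.periodic_fst
    periodic_snd := h.periodic_snd
    periodic_thd := fun x => by
      have h1 : HasDerivAt p (iteratedDeriv 2 u (x + T)) (x + T) := by
        rw [hd]; exact hs.snd (x + T)
      have h2 := h1.comp_add_const x T
      rw [funext h.periodic_snd] at h2
      exact h2.unique (by rw [hd]; exact hs.snd x)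
    action_zero := by
      refine Eq.trans ?_ h.action_zero
      refine intervalIntegral.integral_congr_ae ?_
      filter_upwards [hw] with x hx _
      rw [hx] }

/-- The action over T is n times the action over S, so it also vanishes over the shorter period. -/
lemma of_period (h : IsPeriodicMin J T u p w) (hw : Continuous w) {S : ℝ} (hS : 0 < S)
    (hper : Function.Periodic u S) {n : ℕ} (hn : 0 < n) (hT : T = n * S) :
    IsPeriodicMin J S u p w := by
  have hp := h.toIsH2.periodic_snd hper
  have hwp : Function.Periodic w S := by
    refine periodic_of_ae hw ((h.toIsH2.shift S).ae_eq_of_snd (u' := u) ?_)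
    rw [funext hp]
    exact h.toIsH2
  refine { h.toIsH2 with
    pos := hS, periodic_fst := hper, periodic_snd := hp, periodic_thd := hwp, action_zero := ?_ }
  have hl : Function.Periodic (fun x => w x ^ 2 - w x * u x ^ 2 + J * u x ^ 4) S := fun x => by
    simp only [hper x, hwp x]
  have h1 := hl.intervalIntegral_add_zsmul_eq n 0 fun a b => h.lag_integrable J a b
  simp only [zero_add, natCast_zsmul, nsmul_eq_mul, ← hT] at h1
  have h2 : n * action J u w 0 S = 0 := h1.symm.trans h.action_zero
  exact (mul_eq_zero.1 h2).resolve_left (by positivity)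

/-- At the value `1 / 4` the functional is a perfect square, and only `0` minimizes it. -/
lemma eq_zero_of_quarter (h : IsPeriodicMin (1 / 4) T u p w) : u = 0 := by
  by_contra hne
  have hu := h.continuous_fst
  have hu2 : IntervalIntegrable (fun x => u x ^ 2) volume 0 T := (hu.pow 2).intervalIntegrable _ _
  set s := ∫ x in (0:ℝ)..T, u x ^ 2 with hs
  have hs0 : 0 < s := by
    simpa using integral_pow_pos hu h.pos h.periodic_fst hne even_two 0
  have hw0 : ∫ x in (0:ℝ)..T, w x = 0 := by
    have := h.periodic_snd 0
    rw [zero_add] at this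
    rw [h.integral_eq, this, sub_self]
  -- As w has mean zero, adding t inside the square changes its integral by t²T - ts. This t
  -- minimises the change, at -ts/2 < 0, so the square would have negative integral.
  set t := s / (2 * T) with ht
  have hpos : 0 ≤ ∫ x in (0:ℝ)..T, (w x - u x ^ 2 / 2 + t) ^ 2 :=
    intervalIntegral.integral_nonneg h.pos.le fun x _ => sq_nonneg _
  have e : ∫ x in (0:ℝ)..T, (w x - u x ^ 2 / 2 + t) ^ 2 =
      ∫ x in (0:ℝ)..T, ((w x ^ 2 - w x * u x ^ 2 + 1 / 4 * u x ^ 4) +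
        (2 * t * w x - t * u x ^ 2 + t ^ 2)) := by
    congr 1; ext x; ring
  have i1 : IntervalIntegrable (fun x => 2 * t * w x) volume 0 T := (h.integrable 0 T).const_mul _
  have i2 : IntervalIntegrable (fun x => t * u x ^ 2) volume 0 T := hu2.const_mul _
  rw [e, intervalIntegral.integral_add (h.lag_integrable _ _ _)
      ((i1.sub i2).add intervalIntegrable_const),
    intervalIntegral.integral_add (i1.sub i2) intervalIntegrable_const,
    intervalIntegral.integral_sub i1 i2, intervalIntegral.integral_const_mul,
    intervalIntegral.integral_const_mul, hw0, ← hs, intervalIntegral.integral_const,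
    smul_eq_mul] at hpos
  have h0 : ∫ x in (0:ℝ)..T, (w x ^ 2 - w x * u x ^ 2 + 1 / 4 * u x ^ 4) = 0 := h.action_zero
  have hTt : T * t = s / 2 := by rw [ht]; have := h.pos.ne'; field_simp
  have ht0 : 0 < t := div_pos hs0 (by linarith [h.pos])
  rw [h0] at hpos
  nlinarith

end IsPeriodicMin

/-- The minimal arc on [0, 1] is followed by its mirror image u(2 - x). The vanishing slopes at 0
and 1 make both the junction and the closing of the loop of class H². -/
lemma exists_isPeriodicMin {J : ℝ} (hJ0 : 9 / 64 < J) (hJ : J ≤ 1 / 4) (hA : ArcNonneg J)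
    (hbest : ∀ J' < J, ¬ ArcNonneg J') :
    ∃ u p w : ℝ → ℝ, IsPeriodicMin J 2 u p w ∧ u ≠ 0 := by
  obtain ⟨u, p, w, h, hp0, hp1, hact, hpos⟩ := exists_minimal_arc hJ0 hJ hA hbest
  have hr := h.scale (l := -1) (by norm_num) 2
  have hj := h.join hr (c := 1) (by norm_num) (by norm_num [hp1])
  obtain ⟨U, P, W, hH, hU, hP, hW, eU, eP, eW⟩ := hj.exists_periodic (a := 0) (T := 2)
    two_pos (by rw [join_of_le zero_le_one, join_of_lt (by norm_num)]; norm_num)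
    (by rw [join_of_le zero_le_one, join_of_lt (by norm_num)]; norm_num [hp0])
  rw [zero_add] at eU eP eW
  refine ⟨U, P, W, { hH with
    pos := two_pos, periodic_fst := hU, periodic_snd := hP, periodic_thd := hW,
    action_zero := ?_ }, fun h0 => ?_⟩
  · rw [action_congr zero_le_two (fun x hx => eU x ⟨hx.1.le, hx.2.le⟩)
      (fun x hx => eW x ⟨hx.1, hx.2.le⟩), ← hj.action_add J 0 1,
      action_congr zero_le_one (fun x hx => join_of_le hx.2.le) (fun x hx => join_of_le hx.2.le),
      action_congr one_le_two (fun x hx => join_of_lt hx.1) (fun x hx => join_of_lt hx.1),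
      action_scale J u w (by norm_num)]
    have : action J u w 1 0 = 0 := by
      rw [action, intervalIntegral.integral_symm, neg_eq_zero]; exact hact
    norm_num [hact, this]
  · have : ∫ x in (0:ℝ)..1, u x ^ 4 = 0 := by
      rw [intervalIntegral.integral_congr (g := fun _ => 0), intervalIntegral.integral_zero]
      intro x hx
      rw [uIcc_of_le zero_le_one] at hx
      have := eU x ⟨hx.1, by linarith [hx.2]⟩
      rw [join_of_le hx.2, h0] at this
      simp [← this]
    linarith

/-- Every length is the smallest period of a nontrivial smooth periodic minimizer. -/
lemma exists_least_isPeriodicMin {J T : ℝ} (hJ0 : 9 / 64 < J) (hJ : J ≤ 1 / 4)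
    (hA : ArcNonneg J) (hbest : ∀ J' < J, ¬ ArcNonneg J') (hT : 0 < T) :
    ∃ u p : ℝ → ℝ, IsPeriodicMin J T u p (iteratedDeriv 2 u) ∧ u ≠ 0 ∧ ContDiff ℝ ∞ u ∧
      ∀ S > 0, Function.Periodic u S → T ≤ S := by
  obtain ⟨v, p, w, h, hne⟩ := exists_isPeriodicMin hJ0 hJ hA hbest
  obtain ⟨hv, h⟩ := h.exists_smooth hA
  obtain ⟨x, hx, hmx⟩ := h.exists_max
  obtain ⟨y, hy, hmy⟩ := h.exists_min
  obtain ⟨S, hS, hper, ⟨n, hn, hT2⟩, hmin⟩ := exists_least_period hv.continuous h.pos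
    h.periodic_fst ((h.min_neg hJ0 hne hy hmy).trans (h.max_pos hJ0 hne hx hmx)).ne
  -- The minimizer is regarded as one of its own least period S, then scaled by S/T so that the
  -- least period becomes T.
  have h1 := (h.of_period (hv.continuous_iteratedDeriv 2 ENat.LEInfty.out) hS hper hn
    hT2).scale (div_pos hS hT) 0
  rw [div_div_cancel₀ hS.ne'] at h1
  obtain ⟨hs, h2⟩ := h1.exists_smooth hA
  set l := S / T with hl
  have hl0 : 0 < l := div_pos hS hT
  have hvl : ∀ z, l ^ 2 * v (l * (z / l) + 0) = l ^ 2 * v z := fun z => by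
    rw [add_zero, mul_div_cancel₀ _ hl0.ne']
  refine ⟨_, _, h2, fun h0 => hne ?_, hs, fun R hR hRp => ?_⟩
  · ext z
    have := congrFun h0 (z / l)
    rw [hvl, Pi.zero_apply] at this
    exact (mul_eq_zero.1 this).resolve_left (by positivity)
  · have hp : Function.Periodic v (l * R) := fun z => by
      have h3 := hRp (z / l)
      have e : l * (z / l + R) + 0 = z + l * R := by field_simp; ring
      simp only [hvl, e] at h3
      exact mul_left_cancel₀ (by positivity) h3
    have h4 := hmin (l * R) (mul_pos hl0 hR) hp
    rw [hl, div_mul_eq_mul_div, le_div_iff₀ hT] at h4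
    exact le_of_mul_le_mul_left h4 hS

/-! ### From admissible functions and quotients to H² and the action -/

lemma quotient_congr {u w u' w' : ℝ → ℝ} (hu : u =ᵐ[volume] u') (hw : w =ᵐ[volume] w')
    (K : Set ℝ) : quotient K u w = quotient K u' w' := by
  have h1 : ∫ x in K, w x ^ 2 = ∫ x in K, w' x ^ 2 :=
    integral_congr_ae (ae_restrict_of_ae (by filter_upwards [hw] with x hx; rw [hx]))
  have h2 : ∫ x in K, w x * u x ^ 2 = ∫ x in K, w' x * u' x ^ 2 :=
    integral_congr_ae (ae_restrict_of_ae (by filter_upwards [hu, hw] with x hx hx'; rw [hx, hx']))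
  have h3 : ∫ x in K, u x ^ 4 = ∫ x in K, u' x ^ 4 :=
    integral_congr_ae (ae_restrict_of_ae (by filter_upwards [hu] with x hx; rw [hx]))
  rw [quotient, quotient, energy, energy, h1, h2, h3]

lemma memLp_four_iff {u : ℝ → ℝ} {μ : Measure ℝ} (hu : AEStronglyMeasurable u μ) :
    MemLp u 4 μ ↔ Integrable (fun x => u x ^ 4) μ := by
  rw [← integrable_norm_rpow_iff hu (by norm_num) (by norm_num)]
  refine integrable_congr (ae_of_all _ fun x => ?_)
  norm_num [Even.pow_abs]

lemma exists_isH2 {u w : ℝ → ℝ} (hu : ∀ K : Set ℝ, IsCompact K → MemLp u 4 (volume.restrict K))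
    (hw : ∀ K : Set ℝ, IsCompact K → MemLp w 2 (volume.restrict K)) (h : HasWeakSecondDeriv u w) :
    ∃ U P, IsH2 U P w ∧ u =ᵐ[volume] U := by
  have hfin : ∀ K : Set ℝ, IsCompact K → IsFiniteMeasure (volume.restrict K) := fun K hK =>
    isFiniteMeasure_restrict.2 hK.measure_lt_top.ne
  refine exists_isH2_of_weak ?_ (fun a b => ?_) (fun a b => ?_) h
  · rw [locallyIntegrable_iff]
    intro K hK
    have := hfin K hK
    exact (hu K hK).integrable (by norm_num)
  · have := hfin _ (isCompact_uIcc (a := a) (b := b))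
    have h1 : IntegrableOn w (uIcc a b) := (hw _ isCompact_uIcc).integrable one_le_two
    exact intervalIntegrable_iff.2 (h1.mono_set uIoc_subset_uIcc)
  · have h1 : IntegrableOn (fun x => w x ^ 2) (uIcc a b) := (hw _ isCompact_uIcc).integrable_sq
    exact intervalIntegrable_iff.2 (h1.mono_set uIoc_subset_uIcc)

namespace IsGlobal

variable {J : ℝ} {u p w : ℝ → ℝ}

lemma isAdmissible (h : IsGlobal u p w) : IsAdmissible u w where
  memLp_fun := (memLp_four_iff h.continuous_fst.aestronglyMeasurable).2 h.four
  memLp_deriv := (memLp_two_iff_integrable_sq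
    (locallyIntegrable_of_intervalIntegrable h.integrable).aestronglyMeasurable).2 h.sq
  weakDeriv := h.toIsH2.hasWeakSecondDeriv

lemma integral_lag (h : IsGlobal u p w) (J : ℝ) :
    ∫ x, (w x ^ 2 - w x * u x ^ 2 + J * u x ^ 4) =
      (∫ x, w x ^ 2) - (∫ x, w x * u x ^ 2) + J * ∫ x, u x ^ 4 := by
  refine (integral_add (h.sq.sub h.mul_integrable) (h.four.const_mul J)).trans ?_
  congr 1
  · exact integral_sub h.sq h.mul_integrable
  · exact integral_const_mul _ _

lemma four_pos (h : IsGlobal u p w) (hne : u ≠ 0) : 0 < ∫ x, u x ^ 4 := by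
  obtain ⟨x, hx⟩ := Function.ne_iff.1 hne
  exact integral_pos_of_integrable_nonneg_nonzero (x := x) (h.continuous_fst.pow 4) h.four
    (fun y => by positivity) (pow_ne_zero 4 hx)

/-- For any J, the sign of the action with constant J decides how the quotient compares with -J. -/
lemma quotient_eq (h : IsGlobal u p w) (hne : u ≠ 0) (J : ℝ) :
    quotient univ u w = (∫ x, (w x ^ 2 - w x * u x ^ 2 + J * u x ^ 4)) / (∫ x, u x ^ 4) - J := by
  have := h.four_pos hne
  rw [h.integral_lag, quotient, energy]
  simp only [Measure.restrict_univ]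
  field_simp
  ring

end IsGlobal

lemma exists_isGlobal {u w : ℝ → ℝ} (h : IsAdmissible u w) :
    ∃ U P, IsGlobal U P w ∧ u =ᵐ[volume] U := by
  obtain ⟨U, P, hH, hae⟩ := exists_isH2 (fun K _ => h.memLp_fun.restrict K)
    (fun K _ => h.memLp_deriv.restrict K) h.weakDeriv
  exact ⟨U, P, { hH with
    four := (memLp_four_iff hH.continuous_fst.aestronglyMeasurable).1
      ((memLp_congr_ae hae).1 h.memLp_fun)
    sq := h.memLp_deriv.integrable_sq }, hae⟩

lemma IsH2.isPeriodicAdmissible {u p w : ℝ → ℝ} (h : IsH2 u p w) {T : ℝ}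
    (hper : Function.Periodic u T) : IsPeriodicAdmissible T u w where
  memLp_fun K hK := (memLp_four_iff h.continuous_fst.aestronglyMeasurable).2
    ((h.continuous_fst.pow 4).locallyIntegrable.integrableOn_isCompact hK)
  memLp_deriv K hK := (memLp_two_iff_integrable_sq
    (locallyIntegrable_of_intervalIntegrable h.integrable).aestronglyMeasurable.restrict).2
    ((locallyIntegrable_of_intervalIntegrable h.sq_integrable).integrableOn_isCompact hK)
  weakDeriv := h.hasWeakSecondDeriv
  periodic := by rw [funext hper]

lemma isPeriodicAdmissible_of_smooth {T : ℝ} {u : ℝ → ℝ} (h : u ∈ smoothPeriodic T) :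
    IsPeriodicAdmissible T u (iteratedDeriv 2 u) := by
  obtain ⟨hu, hper, -⟩ := h
  have hd : ContDiff ℝ ∞ (deriv u) := (contDiff_infty_iff_deriv.1 hu).2
  refine (IsH2.of_hasDerivAt (p := deriv u) (fun x => ?_) (fun x => ?_)
    (hu.continuous_iteratedDeriv 2 ENat.LEInfty.out)).isPeriodicAdmissible hper
  · exact (hu.differentiable (by simp) x).hasDerivAt
  · rw [iteratedDeriv_succ, iteratedDeriv_one]
    exact (hd.differentiable (by simp) x).hasDerivAt

lemma IsH2.quotient_period_eq {u p w : ℝ → ℝ} (h : IsH2 u p w) {T : ℝ} (hT : 0 ≤ T)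
    (h4 : 0 < ∫ x in (0:ℝ)..T, u x ^ 4) (J : ℝ) :
    quotient (period T) u w = action J u w 0 T / (∫ x in (0:ℝ)..T, u x ^ 4) - J := by
  rw [h.action_eq, quotient, energy]
  simp only [period, ← intervalIntegral.integral_of_le hT]
  field_simp
  ring

/-- Periodic functions of finite energy have a continuously differentiable periodic
representative. -/
lemma exists_periodic_isH2 {T : ℝ} (hT : 0 < T) {u w : ℝ → ℝ} (h : IsPeriodicAdmissible T u w) :
    ∃ U P W, IsH2 U P W ∧ Function.Periodic U T ∧ Function.Periodic P T ∧
      Function.Periodic W T ∧ u =ᵐ[volume] U ∧ w =ᵐ[volume] W := by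
  obtain ⟨G, R, hG, hae⟩ := exists_isH2 h.memLp_fun h.memLp_deriv h.weakDeriv
  have hGp : Function.Periodic G T := periodic_of_ae hG.continuous_fst
    ((ae_eq_comp_add hae T).symm.trans (h.periodic.trans hae))
  -- G and R are already periodic. The extension serves to replace `w` by a second derivative that
  -- is periodic everywhere, not merely almost everywhere.
  obtain ⟨U, P, W, hH, hU, hP, hW, eU, eP, eW⟩ := hG.exists_periodic (a := 0) hT
    (by rw [hGp]) (by rw [hG.periodic_snd hGp])
  have hext : ∀ {f g : ℝ → ℝ}, Function.Periodic f T → Function.Periodic g T →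
      (∀ x ∈ Icc 0 (0 + T), f x = g x) → f = g := by
    intro f g hf hg hfg
    ext x
    obtain ⟨n, hn⟩ := existsUnique_add_zsmul_mem_Ico hT x 0 |>.exists
    rw [← hf.zsmul n x, ← hg.zsmul n x]
    exact hfg _ ⟨hn.1, hn.2.le⟩
  obtain rfl := hext hU hGp eU
  obtain rfl := hext hP (hG.periodic_snd hGp) eP
  exact ⟨U, P, W, hH, hU, hP, hW, hae, hG.ae_eq_of_snd hH⟩

/-- The quotient is bounded below by `-J`, with equality only for periodic minimizers. -/
lemma neg_le_quotient {J T : ℝ} (hA : ArcNonneg J) (hT : 0 < T) {u w : ℝ → ℝ}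
    (h : IsPeriodicAdmissible T u w) (hne : ¬ u =ᵐ[volume] 0) :
    -J ≤ quotient (period T) u w ∧ (quotient (period T) u w = -J →
      ∃ U P W, IsPeriodicMin J T U P W ∧ U ≠ 0 ∧ u =ᵐ[volume] U) := by
  obtain ⟨U, P, W, hH, hU, hP, hW, hu, hw⟩ := exists_periodic_isH2 hT h
  have hU0 : U ≠ 0 := fun h0 => hne (h0 ▸ hu)
  have h4 : 0 < ∫ x in (0:ℝ)..T, U x ^ 4 := by
    simpa using integral_pow_pos hH.continuous_fst hT hU hU0 (by decide) 0 (n := 4)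
  have hq := hH.quotient_period_eq hT.le h4 J
  have h0 : U 0 = U T := by simpa using (hU 0).symm
  have h1 : P 0 = P T := by simpa using (hP 0).symm
  rw [quotient_congr hu hw, hq]
  refine ⟨?_, fun he => ⟨U, P, W, { hH with
    pos := hT, periodic_fst := hU, periodic_snd := hP, periodic_thd := hW,
    action_zero := ?_ }, hU0, hu⟩⟩
  · have := div_nonneg (hA.loop hH hT.le h0 h1) h4.le
    linarith
  · have : action J U W 0 T / (∫ x in (0:ℝ)..T, U x ^ 4) = 0 := by linarith
    exact (div_eq_zero_iff.1 this).resolve_right h4.ne'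

/-- The scaling relating two minimizers with the same smallest period is trivial. -/
lemma eq_one_of_scale {u v : ℝ → ℝ} {T l τ : ℝ} (hl : 0 < l)
    (hu : IsLeast {S : ℝ | 0 < S ∧ Function.Periodic u S} T)
    (hv : IsLeast {S : ℝ | 0 < S ∧ Function.Periodic v S} T)
    (h : ∀ x, u x = l ^ 2 * v (l * x + τ)) : l = 1 := by
  have hT := hu.1.1
  have h1 : Function.Periodic u (T / l) := fun x => by
    rw [h, h, show l * (x + T / l) + τ = l * x + τ + T by field_simp; ring, hv.1.2]
  have h2 : Function.Periodic v (l * T) := fun x => by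
    have e := h ((x - τ) / l + T)
    rw [hu.1.2, h, show l * ((x - τ) / l) + τ = x by field_simp; ring,
      show l * ((x - τ) / l + T) + τ = x + l * T by field_simp; ring] at e
    exact (mul_left_cancel₀ (by positivity) e).symm
  -- Minimality of T for u gives T ≤ T/l, and for v it gives T ≤ lT; together these force l = 1.
  have h3 := hu.2 ⟨div_pos hT hl, h1⟩
  have h4 := hv.2 ⟨mul_pos hl hT, h2⟩
  rw [le_div_iff₀ hl] at h3
  nlinarith

end BestConstant

open BestConstant

theorem theorem1 :
    ∃ I : ℝ,
      -- `I` is the best constant in the inequality on `ℝ`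
      IsGreatest {c : ℝ | ∀ u w : ℝ → ℝ, IsAdmissible u w →
        c * (∫ x, u x ^ 4) ≤ (∫ x, w x ^ 2) - ∫ x, w x * u x ^ 2} I ∧
      -- it is the infimum of the quotient on `ℝ`, and it is not attained there
      IsGLB {q : ℝ | ∃ u w : ℝ → ℝ, IsAdmissible u w ∧ ¬ (u =ᵐ[volume] 0) ∧
        quotient Set.univ u w = q} I ∧
      (∀ u w : ℝ → ℝ, IsAdmissible u w → ¬ (u =ᵐ[volume] 0) →
        quotient Set.univ u w ≠ I) ∧
      -- for every period it is the infimum over smooth periodic functions, and it is attained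
      (∀ T : ℝ, 0 < T →
        IsLeast ((fun u : ℝ → ℝ => quotient (period T) u (iteratedDeriv 2 u)) ''
          smoothPeriodic T) I) ∧
      -- the same over all periodic functions of finite energy
      (∀ T : ℝ, 0 < T →
        IsLeast {q : ℝ | ∃ u w : ℝ → ℝ, IsPeriodicAdmissible T u w ∧
          ¬ (u =ᵐ[volume] 0) ∧ quotient (period T) u w = q} I) ∧
      -- the bounds
      I ∈ Set.Ioo (-1 / 4 : ℝ) (-9 / 64) ∧
      -- for every period `T`, existence and uniqueness up to translations of a minimizer
      -- with minimal period `T`; it is smooth and changes sign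
      (∀ T : ℝ, 0 < T → ∃ u₀ ∈ smoothPeriodic T,
        HasMinimalPeriod u₀ T ∧
        quotient (period T) u₀ (iteratedDeriv 2 u₀) = I ∧
        (∃ x, 0 < u₀ x) ∧ (∃ x, u₀ x < 0) ∧
        ∀ u w : ℝ → ℝ, IsPeriodicAdmissible T u w → ¬ (u =ᵐ[volume] 0) →
          HasMinimalPeriod u T → quotient (period T) u w = I →
          ∃ a : ℝ, u =ᵐ[volume] fun x => u₀ (x + a)) := by

  obtain ⟨J, hJ0, hJ, hA, hbest⟩ := exists_best_arc
  have hJnn : 0 ≤ J := by linarith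
  have hmin := fun (T : ℝ) (hT : 0 < T) => exists_least_isPeriodicMin hJ0 hJ hA hbest hT
  have hbound : J ≠ 1 / 4 := by
    rintro rfl
    obtain ⟨u, p, h, hne, -⟩ := hmin 1 one_pos
    exact hne h.eq_zero_of_quarter
  -- A reference periodic minimizer of arbitrary period: it supplies the test functions on the line
  -- and the partner for gluing.
  obtain ⟨v, p', hv, hv0, -⟩ := hmin 1 one_pos
  have hquot : ∀ {T : ℝ} {u p : ℝ → ℝ}, 0 < T → IsPeriodicMin J T u p (iteratedDeriv 2 u) →
      u ≠ 0 → quotient (period T) u (iteratedDeriv 2 u) = -J := by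
    intro T u p hT h hne
    rw [h.toIsH2.quotient_period_eq hT.le (by simpa using h.four_pos hne 0) J, h.action_zero]
    simp
  have hsmooth : ∀ {T : ℝ} {u : ℝ → ℝ}, u ∈ smoothPeriodic T → ¬ u =ᵐ[volume] 0 := fun h h0 =>
    h.2.2 ((Continuous.ae_eq_iff_eq volume h.1.continuous continuous_const).1 h0)
  refine ⟨-J, ⟨?_, ?_⟩, ⟨?_, ?_⟩, ?_, ?_, ?_, ⟨?_, ?_⟩, ?_⟩
  · intro u w h
    obtain ⟨U, P, hG, hae⟩ := exists_isGlobal h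
    have h1 := hG.nonneg hA hJnn
    rw [hG.integral_lag] at h1
    rw [integral_congr_ae (g := fun x => U x ^ 4) (by filter_upwards [hae] with x hx; rw [hx]),
      integral_congr_ae (f := fun x => w x * u x ^ 2) (g := fun x => w x * U x ^ 2)
        (by filter_upwards [hae] with x hx; rw [hx])]
    linarith
  · intro c hc
    by_contra! hlt
    obtain ⟨u, p, w, hG, hneg⟩ := exists_isGlobal_action_neg hv hv0 (J' := -c) (by linarith)
    have := hc u w hG.isAdmissible
    rw [hG.integral_lag] at hneg
    linarith
  · rintro q ⟨u, w, h, hne, rfl⟩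
    obtain ⟨U, P, hG, hae⟩ := exists_isGlobal h
    have hU0 : U ≠ 0 := fun h0 => hne (h0 ▸ hae)
    rw [quotient_congr hae (ae_eq_refl w), hG.quotient_eq hU0 J]
    have := div_nonneg (hG.nonneg hA hJnn) (hG.four_pos hU0).le
    linarith
  · intro b hb
    by_contra! hlt
    obtain ⟨u, p, w, hG, hneg⟩ := exists_isGlobal_action_neg hv hv0 (J' := -b) (by linarith)
    -- The zero function has nonnegative action, so negativity rules it out.
    have hu0 : u ≠ 0 := by
      rintro rfl
      refine hneg.not_ge (integral_nonneg fun x => ?_)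
      simpa using sq_nonneg (w x)
    have h1 := hb ⟨u, w, hG.isAdmissible, fun h0 => hu0
      ((Continuous.ae_eq_iff_eq volume hG.continuous_fst continuous_const).1 h0), rfl⟩
    rw [hG.quotient_eq hu0 (-b)] at h1
    have := div_neg_of_neg_of_pos hneg (hG.four_pos hu0)
    linarith
  · intro u w h hne
    obtain ⟨U, P, hG, hae⟩ := exists_isGlobal h
    have hU0 : U ≠ 0 := fun h0 => hne (h0 ▸ hae)
    rw [quotient_congr hae (ae_eq_refl w), hG.quotient_eq hU0 J]
    have := div_pos (hG.action_pos hA hJ0 hv hv0 hU0) (hG.four_pos hU0)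
    linarith
  · intro T hT
    obtain ⟨u, p, h, hne, hs, -⟩ := hmin T hT
    refine ⟨⟨u, ⟨hs, h.periodic_fst, hne⟩, hquot hT h hne⟩, ?_⟩
    rintro q ⟨z, hz, rfl⟩
    exact (neg_le_quotient hA hT (isPeriodicAdmissible_of_smooth hz) (hsmooth hz)).1
  · intro T hT
    obtain ⟨u, p, h, hne, hs, -⟩ := hmin T hT
    refine ⟨⟨u, _, h.toIsH2.isPeriodicAdmissible h.periodic_fst,
      hsmooth (T := T) ⟨hs, h.periodic_fst, hne⟩, hquot hT h hne⟩, ?_⟩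
    rintro q ⟨z, w, hz, hz0, rfl⟩
    exact (neg_le_quotient hA hT hz hz0).1
  · have := lt_of_le_of_ne hJ hbound
    linarith
  · linarith
  · intro T hT
    obtain ⟨u, p, h, hne, hs, hleast⟩ := hmin T hT
    have hper : IsLeast {S : ℝ | 0 < S ∧ Function.Periodic u S} T :=
      ⟨⟨hT, h.periodic_fst⟩, fun S hS => hleast S hS.1 hS.2⟩
    obtain ⟨x, hx, hmx⟩ := h.exists_max
    obtain ⟨y, hy, hmy⟩ := h.exists_min
    refine ⟨u, ⟨hs, h.periodic_fst, hne⟩, ?_, hquot hT h hne, ⟨x, h.max_pos hJ0 hne hx hmx⟩,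
      ⟨y, h.min_neg hJ0 hne hy hmy⟩, fun z w hz hz0 hzT hzq => ?_⟩
    · exact (hasMinimalPeriod_iff (ae_eq_refl u) hs.continuous T).2 hper
    · obtain ⟨U, P, W, hU, hU0, hae⟩ := (neg_le_quotient hA hT hz hz0).2 hzq
      obtain ⟨l, hl, τ, he⟩ := hU.exists_scale_eq hA hJ0 h hU0 hne
      -- Equal least periods remove the scaling freedom, and only the translation τ remains.
      have hl1 := eq_one_of_scale hl ((hasMinimalPeriod_iff hae hU.continuous_fst T).1 hzT) hper he
      refine ⟨τ, hae.trans (ae_of_all _ fun s => ?_)⟩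
      simp only [he, hl1, one_pow, one_mul]
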